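/- Let $n\ge 2$, let $\Lambda=\bigoplus_{j=1}^n\mathbb Z\epsilon_j$ with $\langle\epsilon_i,\epsilon_j\rangle=\delta_{ij}$, extend $\langle\cdot,\cdot\rangle$ to $\Lambda\oplus\frac12\mathbb Z\delta$ with $\delta$ in the radical, and let $a_0=\delta-2\epsilon_1$, $a_i=\epsilon_i-\epsilon_{i+1}$ ($1\le i<n$), $a_n=2\epsilon_n$, $\beta^\vee=2\beta/\langle\beta,\beta\rangle$, $s_i\beta=\beta-\langle\beta,a_i^\vee\rangle a_i$. Let $\mathcal A=\mathbb C[\Lambda]=\mathbb C[x_1^{\pm1},\dots,x_n^{\pm1}]$, fix $q\in\mathbb C^\times$ with a square root $q^{1/2}$, write $x^{\mu+c\delta}=q^cx^\mu$, and let $s_i$ act on $\mathcal A$ by $x^\mu\mapsto x^{s_i\mu}$. Let $\mathbf t$ consist of $t_0=t_{a_0}$, $t_0^\vee=t_{a_0/2}$, $t=t_{a_i}$ ($1\le i<n$), $t_n=t_{a_n}$, $t_n^\vee=t_{a_n/2}$ in $\mathbb C^\times$, write $t_i=t_{a_i}$, put $t_{a_i/2}=1$ for $1\le i<n$ and $t_{-\beta}=t_\beta$,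 and for $\beta=\pm a_i$ let $$v_\beta(x;\mathbf t)=\frac{(1-t_\beta t_{\beta/2}x^{\beta/2})(1+t_\beta t_{\beta/2}^{-1}x^{\beta/2})}{1-x^\beta}.$$ Let $T_i=t_i+t_i^{-1}v_{a_i}(x;\mathbf t)(s_i-\mathrm{id})\in\mathrm{End}_{\mathbb C}(\mathcal A)$ ($0\le i\le n$), which are invertible, $Y_i=T_i\cdots T_{n-1}T_nT_{n-1}\cdots T_1T_0T_1^{-1}\cdots T_{i-1}^{-1}$ ($1\le i\le n$), $Y^\lambda=Y_1^{\lambda_1}\cdots Y_n^{\lambda_n}$, and $f(Y)=\sum_\lambda c_\lambda Y^\lambda$ for $f=\sum_\lambda c_\lambda x^\lambda\in\mathcal A$. Let $\Sigma_m^+=\{\epsilon_i\pm\epsilon_j: i<j\}$, $\Sigma_l^+=\{2\epsilon_i\}$, let $\epsilon(m)=1$ for $m\ge0$ and $\epsilon(m)=-1$ for $m<0$, put $\rho_\bullet(\lambda)=\sum_{\alpha\in\Sigma_\bullet^+}\epsilon(\langle\lambda,\alpha\rangle)\alpha^\vee$ for $\bullet\in\{m,l\}$, and let $\gamma_\lambda\in(\mathbb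 C^\times)^n$ have components $(\gamma_\lambda)_j=(t_0t_n)^{\rho_l(\lambda)_j}t^{\rho_m(\lambda)_j}q^{\lambda_j}$. For $\lambda,\mu\in\Lambda$ write $\lambda\le\mu$ if $\mu-\lambda\in\sum_{i=1}^n\mathbb Z_{\ge0}a_i^\vee$, and $\lambda\preceq\mu$ if $\lambda^+<\mu^+$, or $\lambda^+=\mu^+$ and $\lambda\le\mu$; here $\lambda^+$ is the unique weight with $\langle\lambda^+,a_i^\vee\rangle\ge0$ ($1\le i\le n$) that arises from $\lambda$ by permutations and sign changes of the coordinates. Assume that the parameters are generic in the following sense: $q^at^b(t_0t_n)^c\neq1$ for all integers $a\ne0$, $b$, $c$; $t^2\ne1$; and $t_0^2t_n^2\neq1$. Then there is a unique basis $\{P_\lambda\}_{\lambda\in\Lambda}$ of $\mathcal A$ such that, for all $\lambda$, $P_\lambda\in x^\lambda+\sum_{\mu\prec\lambda}\mathbb C x^\mu$ and $f(Y)P_\lambda=f(\gamma_\lambda)P_\lambda$ for all $f\in\mathcal A$ (the monic non-symmetric Koornwinder polynomials). Moreover, let $\tilde{\mathbf t}$ be the dual parameters, obtained from $\mathbf t$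 by interchanging $t_0$ and $t_n^\vee$, and $\tilde v_\beta(x)=v_\beta(x;\tilde{\mathbf t})$. Then for all $i\in\{1,\dots,n\}$ and $\lambda\in\Lambda$ one has $\gamma_\lambda^{a_i}\ne1$ and $$T_iP_\lambda=\xi_i(\gamma_\lambda)P_\lambda+\eta_i(\gamma_\lambda)P_{s_i\lambda},$$ where $$\xi_i(x)=\tilde t_i-\tilde t_i^{-1}\tilde v_{-a_i}(x)=\frac{(\tilde t_{a_i}^{-1}-\tilde t_{a_i})x^{a_i}+(\tilde t_{a_i/2}^{-1}-\tilde t_{a_i/2})x^{a_i/2}}{1-x^{a_i}}$$ as rational functions, and $\eta_i(\gamma_\lambda)=\tilde t_i$ if $\langle\lambda,a_i\rangle<0$, while $\eta_i(\gamma_\lambda)=\tilde t_i^{-3}\,\tilde v_{a_i}(\gamma_\lambda)\,\tilde v_{-a_i}(\gamma_\lambda)$ if $\langle\lambda,a_i\rangle\ge0$. -/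

import Mathlib

open scoped Matrix

noncomputable section

namespace Koornwinder

/-! ### The root system of type `C^∨ C_n`: simple roots, co-roots, affine weights -/

/-- The weight lattice `Λ = ⊕ ℤ ε_j`. -/
abbrev Weight (n : ℕ) := Fin n → ℤ

/-- Affine weights `μ + c δ` with `μ ∈ Λ`, `c ∈ ½ ℤ`, stored as the pair `(μ, 2c)`. -/
abbrev AffWeight (n : ℕ) := Weight n × ℤ

/-- The basis vector `ε_j`, `1 ≤ j ≤ n`. -/
def eps (n j : ℕ) : Weight n := fun k => if (k : ℕ) + 1 = j then 1 else 0

/-- The simple roots `a_0 = δ - 2ε_1`, `a_i = ε_i - ε_{i+1}` for `1 ≤ i < n`, `a_n = 2ε_n`. -/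
def simpleRoot (n i : ℕ) : AffWeight n :=
  if i = 0 then (-2 * eps n 1, 2)
  else if i = n then (2 * eps n n, 0)
  else (eps n i - eps n (i + 1), 0)

/-- The simple co-roots `a_0^∨ = a_0 / 2`, `a_i^∨ = a_i` for `1 ≤ i < n`, `a_n^∨ = a_n / 2`. -/
def simpleCoroot (n i : ℕ) : AffWeight n :=
  if i = 0 then (-eps n 1, 1)
  else if i = n then (eps n n, 0)
  else (eps n i - eps n (i + 1), 0)

/-- The simple reflection `s_i β = β - ⟨β, a_i^∨⟩ a_i` on affine weights (`δ` lies in the radical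
of the form). -/
def reflect (n i : ℕ) (β : AffWeight n) : AffWeight n :=
  β - (β.1 ⬝ᵥ (simpleCoroot n i).1) • simpleRoot n i

/-- The multiplicity function, given by its values on the five orbits of the affine Weyl group:
`t0 = t_{a_0}`, `t0v = t_{a_0^∨}`, `t = t_{a_i}` (`1 ≤ i < n`), `tn = t_{a_n}`,
`tnv = t_{a_n^∨}`. -/
structure Multiplicity where
  t0 : ℂˣ
  t0v : ℂˣ
  t : ℂˣ
  tn : ℂˣ
  tnv : ℂˣ

/-- The dual multiplicity function: the values at `a_0` and at `a_n^∨` are interchanged. -/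
def Multiplicity.dual (k : Multiplicity) : Multiplicity where
  t0 := k.tnv
  t0v := k.t0v
  t := k.t
  tn := k.tn
  tnv := k.t0

/-- `t_i = t_{a_i}`. -/
def Multiplicity.root (k : Multiplicity) (n i : ℕ) : ℂˣ :=
  if i = 0 then k.t0 else if i = n then k.tn else k.t

/-- `t_{a_i / 2}`, which is `1` for `1 ≤ i < n` because then `a_i / 2` is not a root. -/
def Multiplicity.half (k : Multiplicity) (n i : ℕ) : ℂˣ :=
  if i = 0 then k.t0v else if i = n then k.tnv else 1

/-- The numerator and the denominator of `v_{a_i}`, as functions of the values `e β` of the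
monomials `x^β`. For `i = 0, n` one has `a_i / 2 = a_i^∨`; for `1 ≤ i < n` one has
`t_{a_i / 2} = 1`, and the two factors multiply to `1 - t_i² x^{a_i}`. -/
def vNum {n : ℕ} {K : Type*} [CommRing K] [Algebra ℂ K] (k : Multiplicity) (i : ℕ)
    (e : AffWeight n → K) : K :=
  if i = 0 ∨ i = n then
    (1 - algebraMap ℂ K (k.root n i * k.half n i) * e (simpleCoroot n i)) *
      (1 + algebraMap ℂ K (k.root n i * (k.half n i)⁻¹) * e (simpleCoroot n i))
  else 1 - algebraMap ℂ K (k.root n i ^ 2) * e (simpleRoot n i)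

/-- `v_{a_i} = (1 - t_{a_i} t_{a_i/2} x^{a_i/2}) (1 + t_{a_i} t_{a_i/2}⁻¹ x^{a_i/2}) / (1 - x^{a_i})`,
as a function of the values `e β` of the monomials `x^β`. Composing `e` with `β ↦ -β` gives
`v_{-a_i}`, since `t_{-β} = t_β`. -/
def vRoot {n : ℕ} {K : Type*} [Field K] [Algebra ℂ K] (k : Multiplicity) (i : ℕ)
    (e : AffWeight n → K) : K :=
  vNum k i e / (1 - e (simpleRoot n i))

/-! ### The group algebra of the weight lattice and the difference-reflection operators -/

/-- The group algebra `𝒜` of `Λ` over `ℂ`, i.e. Laurent polynomials in `n` variables. -/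
abbrev LaurentAlg (n : ℕ) := AddMonoidAlgebra ℂ (Weight n)

/-- `x^{μ + cδ} = q^c x^μ`, where `r = q^{1/2}` is the fixed square root of `q`. -/
def mono {n : ℕ} (r : ℂˣ) (β : AffWeight n) : LaurentAlg n :=
  AddMonoidAlgebra.single β.1 ((r ^ β.2 : ℂˣ) : ℂ)

/-- `x^β` as an element of the field of rational functions `ℂ(x)`, the fraction field of `𝒜`. -/
def monoX {n : ℕ} (r : ℂˣ) (β : AffWeight n) : FractionRing (LaurentAlg n) :=
  algebraMap (LaurentAlg n) (FractionRing (LaurentAlg n)) (mono r β)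

theorem mono_add {n : ℕ} (r : ℂˣ) (β β' : AffWeight n) :
    mono r (β + β') = mono r β * mono r β' := by
  simp [mono, AddMonoidAlgebra.single_mul_single, zpow_add]

theorem mono_zero {n : ℕ} (r : ℂˣ) : mono r (0 : AffWeight n) = 1 := by
  simp [mono, AddMonoidAlgebra.one_def]

theorem reflect_add (n i : ℕ) (β β' : AffWeight n) :
    reflect n i (β + β') = reflect n i β + reflect n i β' := by
  simp only [reflect, Prod.fst_add, add_dotProduct, add_smul]
  abel

/-- The action of `s_i` on `𝒜`: the algebra homomorphism with `x^μ ↦ x^{s_i μ}`. -/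
def sAct (n : ℕ) (r : ℂˣ) (i : ℕ) : LaurentAlg n →ₐ[ℂ] LaurentAlg n :=
  AddMonoidAlgebra.lift ℂ (LaurentAlg n) (Weight n)
    { toFun := fun μ => mono r (reflect n i (μ.toAdd, 0))
      map_one' := by
        have : ((Multiplicative.toAdd (1 : Multiplicative (Weight n)), 0) : AffWeight n) = 0 := rfl
        rw [this]
        simp [reflect, mono_zero]
      map_mul' := fun μ ν => by
        rw [← mono_add, ← reflect_add]
        simp }

/-- The divided difference operator `f ↦ (f - s_i f) / (1 - x^{a_i})` on `𝒜`, by its values on the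
monomials: for `m = ⟨λ, a_i^∨⟩` the value at `x^λ` is
`-(x^{λ - a_i} + ⋯ + x^{λ - m a_i})` if `m > 0`, and `x^λ + x^{λ + a_i} + ⋯ + x^{λ - (m+1) a_i}`
if `m ≤ 0`. See `one_sub_mul_divDiff`. -/
def divDiff (n : ℕ) (r : ℂˣ) (i : ℕ) : LaurentAlg n →ₗ[ℂ] LaurentAlg n :=
  Finsupp.linearCombination ℂ (fun l : Weight n =>
      if 0 < l ⬝ᵥ (simpleCoroot n i).1 then
        -∑ j ∈ Finset.range (l ⬝ᵥ (simpleCoroot n i).1).toNat,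
          mono r ((l, 0) - ((j : ℤ) + 1) • simpleRoot n i)
      else
        ∑ j ∈ Finset.range (-(l ⬝ᵥ (simpleCoroot n i).1)).toNat,
          mono r ((l, 0) + (j : ℤ) • simpleRoot n i)) ∘ₗ
    (AddMonoidAlgebra.coeffLinearEquiv ℂ).toLinearMap

/-- The difference-reflection operator `T_i = t_i + t_i⁻¹ v_{a_i}(x) (s_i - id)` on `𝒜`
(the Noumi representation), see `algebraMap_T`. -/
def T (n : ℕ) (k : Multiplicity) (r : ℂˣ) (i : ℕ) : Module.End ℂ (LaurentAlg n) :=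
  (k.root n i : ℂ) • LinearMap.id -
    ((k.root n i)⁻¹ : ℂ) • LinearMap.mulLeft ℂ (vNum k i (mono r)) ∘ₗ divDiff n r i

theorem sAct_single (n : ℕ) (r : ℂˣ) (i : ℕ) (l : Weight n) :
    sAct n r i (AddMonoidAlgebra.single l 1) = mono r (reflect n i (l, 0)) := by
  simp [sAct, AddMonoidAlgebra.lift_single]

theorem divDiff_single (n : ℕ) (r : ℂˣ) (i : ℕ) (l : Weight n) :
    divDiff n r i (AddMonoidAlgebra.single l 1) =
      if 0 < l ⬝ᵥ (simpleCoroot n i).1 then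
        -∑ j ∈ Finset.range (l ⬝ᵥ (simpleCoroot n i).1).toNat,
          mono r ((l, 0) - ((j : ℤ) + 1) • simpleRoot n i)
      else
        ∑ j ∈ Finset.range (-(l ⬝ᵥ (simpleCoroot n i).1)).toNat,
          mono r ((l, 0) + (j : ℤ) • simpleRoot n i) := by
  simp [divDiff]

theorem single_eq_mono {n : ℕ} (r : ℂˣ) (l : Weight n) :
    (AddMonoidAlgebra.single l 1 : LaurentAlg n) = mono r (l, 0) := by
  simp [mono]

theorem lin_ext {n : ℕ} {f g : LaurentAlg n →ₗ[ℂ] LaurentAlg n}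
    (h : ∀ l, f (AddMonoidAlgebra.single l 1) = g (AddMonoidAlgebra.single l 1))
    (x : LaurentAlg n) : f x = g x := by
  induction x using AddMonoidAlgebra.induction_linear with
  | zero => simp
  | add a b ha hb => simp [ha, hb]
  | single m c =>
    have : (AddMonoidAlgebra.single m c : LaurentAlg n) = c • AddMonoidAlgebra.single m 1 := by
      simp
    rw [this, map_smul, map_smul, h]

/-- `divDiff` is the operator `f ↦ (f - s_i f) / (1 - x^{a_i})`. -/
theorem one_sub_mul_divDiff (n : ℕ) (r : ℂˣ) (i : ℕ) (f : LaurentAlg n) :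
    (1 - mono r (simpleRoot n i)) * divDiff n r i f = f - sAct n r i f := by
  refine lin_ext (f := LinearMap.mulLeft ℂ (1 - mono r (simpleRoot n i)) ∘ₗ divDiff n r i)
    (g := LinearMap.id - (sAct n r i).toLinearMap) (fun l => ?_) f
  simp only [LinearMap.comp_apply, LinearMap.mulLeft_apply, LinearMap.sub_apply,
    LinearMap.id_apply, AlgHom.toLinearMap_apply, sAct_single, divDiff_single]
  rw [single_eq_mono r]
  set m := l ⬝ᵥ (simpleCoroot n i).1 with hm
  have hrefl : reflect n i (l, 0) = (l, 0) - m • simpleRoot n i := rfl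
  rw [hrefl]
  split_ifs with h
  · rw [mul_neg, Finset.mul_sum]
    have := Finset.sum_range_sub
      (fun j : ℕ => mono r ((l, 0) - (j : ℤ) • simpleRoot n i)) m.toNat
    rw [Int.toNat_of_nonneg h.le] at this
    have e : ∀ j : ℕ, (1 - mono r (simpleRoot n i)) *
        mono r ((l, 0) - ((j : ℤ) + 1) • simpleRoot n i) =
        mono r ((l, 0) - (((j + 1 : ℕ) : ℤ)) • simpleRoot n i) -
          mono r ((l, 0) - (j : ℤ) • simpleRoot n i) := by
      intro j
      rw [sub_mul, one_mul, ← mono_add]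
      congr 2
      rw [add_smul, one_smul]
      abel
    rw [Finset.sum_congr rfl fun j _ => e j, this]
    simp
  · rw [Finset.mul_sum]
    have := Finset.sum_range_sub
      (fun j : ℕ => mono r ((l, 0) + (j : ℤ) • simpleRoot n i)) (-m).toNat
    rw [Int.toNat_of_nonneg (by omega)] at this
    have e : ∀ j : ℕ, (1 - mono r (simpleRoot n i)) *
        mono r ((l, 0) + (j : ℤ) • simpleRoot n i) =
        -(mono r ((l, 0) + (((j + 1 : ℕ) : ℤ)) • simpleRoot n i) -
          mono r ((l, 0) + (j : ℤ) • simpleRoot n i)) := by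
      intro j
      rw [sub_mul, one_mul, ← mono_add, neg_sub]
      congr 2
      rw [Nat.cast_add, Nat.cast_one, add_smul, one_smul]
      abel
    rw [Finset.sum_congr rfl fun j _ => e j, Finset.sum_neg_distrib, this]
    simp [sub_eq_add_neg]

theorem eps_dot {n i j : ℕ} (hi : 1 ≤ i) (hin : i ≤ n) :
    eps n i ⬝ᵥ eps n j = if i = j then 1 else 0 := by
  have : ∀ x : Fin n, eps n i x * eps n j x =
      if x = ⟨i - 1, by omega⟩ then (if i = j then 1 else 0) else 0 := by
    intro x
    simp only [eps, Fin.ext_iff]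
    split_ifs <;> first | rfl | omega
  simp [dotProduct, this]

theorem root_dot_coroot {n i : ℕ} (hn : 1 ≤ n) (hi : i ≤ n) :
    (simpleRoot n i).1 ⬝ᵥ (simpleCoroot n i).1 = 2 := by
  unfold simpleRoot simpleCoroot
  split_ifs with h0 h1
  · have : (-2 * eps n 1 : Weight n) = (-2 : ℤ) • eps n 1 := by ext; simp
    rw [this, smul_dotProduct, dotProduct_neg, eps_dot le_rfl hn, if_pos rfl]
    rfl
  · have : (2 * eps n n : Weight n) = (2 : ℤ) • eps n n := by ext; simp
    rw [this, smul_dotProduct, eps_dot hn le_rfl, if_pos rfl]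
    rfl
  · simp only [sub_dotProduct, dotProduct_sub]
    rw [eps_dot (by omega) hi, eps_dot (by omega) hi, eps_dot (by omega) (by omega),
      eps_dot (by omega) (by omega)]
    simp

theorem root_eq_two_smul_coroot {n i : ℕ} (h : i = 0 ∨ i = n) :
    simpleRoot n i = (2 : ℤ) • simpleCoroot n i := by
  unfold simpleRoot simpleCoroot
  split_ifs with h0 h1
  · ext <;> simp
  · ext <;> simp
  · omega

theorem coroot_fst_eq_zero {n i : ℕ} (h : ¬ (1 ≤ n ∧ i ≤ n)) : (simpleCoroot n i).1 = 0 := by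
  ext x
  have := x.2
  unfold simpleCoroot
  split_ifs with h0 h1
  · omega
  · omega
  · simp only [eps, Pi.sub_apply, Pi.zero_apply]
    split_ifs <;> first | rfl | omega

theorem one_sub_mono_ne_zero {n i : ℕ} (r : ℂˣ) (hn : 1 ≤ n) (hi : i ≤ n) :
    (1 : LaurentAlg n) - mono r (simpleRoot n i) ≠ 0 := by
  intro h
  have h0 : (simpleRoot n i).1 ≠ 0 := by
    intro h0
    have := root_dot_coroot hn hi
    simp [h0] at this
  have h1 := congrArg (fun f : LaurentAlg n => f.coeff 0) h
  simp [mono, AddMonoidAlgebra.one_def, h0] at h1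

/-- The literal formula `T_i = t_i + t_i⁻¹ v_{a_i}(x) (s_i - id)`, read in the field of fractions
`ℂ(x)` of `𝒜`. -/
theorem algebraMap_T {n i : ℕ} (k : Multiplicity) (r : ℂˣ) (hn : 1 ≤ n) (hi : i ≤ n)
    (f : LaurentAlg n) :
    algebraMap (LaurentAlg n) (FractionRing (LaurentAlg n)) (T n k r i f) =
      (k.root n i : ℂ) • algebraMap (LaurentAlg n) (FractionRing (LaurentAlg n)) f +
        ((k.root n i)⁻¹ : ℂ) •
          (vRoot k i (monoX r) *
            (algebraMap (LaurentAlg n) (FractionRing (LaurentAlg n)) (sAct n r i f) -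
              algebraMap (LaurentAlg n) (FractionRing (LaurentAlg n)) f)) := by
  set A := algebraMap (LaurentAlg n) (FractionRing (LaurentAlg n)) with hA
  have hne : (1 : FractionRing (LaurentAlg n)) - A (mono r (simpleRoot n i)) ≠ 0 := by
    rw [← map_one A, ← map_sub]
    exact (map_ne_zero_iff A (IsFractionRing.injective _ _)).2 (one_sub_mono_ne_zero r hn hi)
  have hc : ∀ c : ℂ, A (algebraMap ℂ _ c) = algebraMap ℂ (FractionRing (LaurentAlg n)) c :=
    fun c => (IsScalarTower.algebraMap_apply ℂ (LaurentAlg n) _ c).symm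
  have hN : A (vNum k i (mono r)) = vNum k i (monoX r) := by
    unfold vNum
    split_ifs <;> simp only [map_mul, map_sub, map_add, map_one, hc] <;> rfl
  have hs : ∀ (c : ℂ) (g : LaurentAlg n), A (c • g) = c • A g := fun c g => by
    rw [Algebra.smul_def, map_mul, hc, Algebra.smul_def]
  have hD := congrArg A (one_sub_mul_divDiff n r i f)
  rw [map_mul, map_sub, map_one, map_sub] at hD
  have hv : A (sAct n r i f) - A f = -((1 - A (mono r (simpleRoot n i))) * A (divDiff n r i f)) := by
    rw [hD]; ring
  simp only [T, LinearMap.sub_apply, LinearMap.smul_apply, LinearMap.id_apply,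
    LinearMap.comp_apply, LinearMap.mulLeft_apply, map_sub, hs, map_mul]
  rw [hv, vRoot, hN, show monoX r (simpleRoot n i) = A (mono r (simpleRoot n i)) from rfl,
    sub_eq_add_neg, ← smul_neg]
  congr 2
  field_simp

theorem sAct_mono (n : ℕ) (r : ℂˣ) (i : ℕ) (β : AffWeight n) :
    sAct n r i (mono r β) = mono r (reflect n i β) := by
  have h1 : ∀ l : Weight n, ∀ c : ℤ, mono r ((l, c) : AffWeight n) =
      ((r ^ c : ℂˣ) : ℂ) • mono r (l, 0) := fun l c => by simp [mono]
  have h2 : reflect n i β = ((reflect n i (β.1, 0)).1, (reflect n i (β.1, 0)).2 + β.2) := by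
    ext <;> simp [reflect]; ring
  rw [show β = (β.1, β.2) from rfl, h1, map_smul, ← single_eq_mono, sAct_single, h2]
  simp [mono, zpow_add, mul_comm]

theorem reflect_root {n i : ℕ} (hn : 1 ≤ n) (hi : i ≤ n) :
    reflect n i (simpleRoot n i) = -simpleRoot n i := by
  rw [reflect, root_dot_coroot hn hi, two_smul]
  abel

theorem sAct_sAct {n i : ℕ} (r : ℂˣ) (hn : 1 ≤ n) (hi : i ≤ n) (f : LaurentAlg n) :
    sAct n r i (sAct n r i f) = f := by
  refine lin_ext (f := (sAct n r i).toLinearMap ∘ₗ (sAct n r i).toLinearMap)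
    (g := LinearMap.id) (fun l => ?_) f
  simp only [LinearMap.comp_apply, AlgHom.toLinearMap_apply, LinearMap.id_apply, sAct_single,
    sAct_mono]
  rw [single_eq_mono r]
  congr 1
  have : ∀ β : AffWeight n, reflect n i (reflect n i β) = β := by
    intro β
    simp only [reflect, Prod.fst_sub, Prod.smul_fst, sub_dotProduct, smul_dotProduct,
      root_dot_coroot hn hi, smul_eq_mul, sub_smul, mul_smul, two_smul]
    rw [smul_add]
    abel
  exact this _

theorem vNum_sub {n i : ℕ} (k : Multiplicity) (r : ℂˣ) (hn : 1 ≤ n) (hi : i ≤ n) :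
    vNum k i (mono r) - sAct n r i (vNum k i (mono r)) * mono r (simpleRoot n i) =
      algebraMap ℂ (LaurentAlg n) (1 + (k.root n i : ℂ) ^ 2) *
        (1 - mono r (simpleRoot n i)) := by
  unfold vNum
  split_ifs with h
  · have hy : mono r (simpleRoot n i) = mono r (simpleCoroot n i) * mono r (simpleCoroot n i) := by
      rw [← mono_add, root_eq_two_smul_coroot h, two_smul]
    have hp : (simpleCoroot n i).1 ⬝ᵥ (simpleCoroot n i).1 = 1 := by
      have := root_dot_coroot hn hi
      rw [root_eq_two_smul_coroot h] at this
      rw [Prod.smul_fst, smul_dotProduct, smul_eq_mul] at this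
      omega
    have hr : reflect n i (simpleCoroot n i) = -simpleCoroot n i := by
      rw [reflect, hp, root_eq_two_smul_coroot h, one_smul, two_smul]
      abel
    have hi1 : mono r (-simpleCoroot n i) * mono r (simpleCoroot n i) = 1 := by
      rw [← mono_add, neg_add_cancel, mono_zero]
    have hc : algebraMap ℂ (LaurentAlg n) (k.half n i) *
        algebraMap ℂ (LaurentAlg n) ((k.half n i : ℂ)⁻¹) = 1 := by
      rw [← map_mul, mul_inv_cancel₀ (Units.ne_zero _), map_one]
    simp only [map_mul, map_sub, map_add, map_one, AlgHom.commutes, sAct_mono, hr, hy, map_pow,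
      Units.val_inv_eq_inv_val]
    set y := mono r (simpleCoroot n i)
    set z := mono r (-simpleCoroot n i)
    set a := algebraMap ℂ (LaurentAlg n) (k.root n i)
    set b := algebraMap ℂ (LaurentAlg n) (k.half n i)
    set c := algebraMap ℂ (LaurentAlg n) ((k.half n i : ℂ)⁻¹)
    linear_combination (-a ^ 2 * y ^ 2 + a ^ 2 * (z * y) ^ 2) * hc +
      (a * b * y - a * c * y + a ^ 2 * (z * y + 1)) * hi1
  · have hi1 : mono r (-simpleRoot n i) * mono r (simpleRoot n i) = 1 := by
      rw [← mono_add, neg_add_cancel, mono_zero]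
    simp only [map_mul, map_sub, map_add, map_one, AlgHom.commutes, sAct_mono,
      reflect_root hn hi, map_pow]
    linear_combination (algebraMap ℂ (LaurentAlg n) (k.root n i)) ^ 2 * hi1

theorem divDiff_vNum_divDiff (n : ℕ) (k : Multiplicity) (r : ℂˣ) (i : ℕ) (f : LaurentAlg n) :
    divDiff n r i (vNum k i (mono r) * divDiff n r i f) =
      (1 + (k.root n i : ℂ) ^ 2) • divDiff n r i f := by
  by_cases h : 1 ≤ n ∧ i ≤ n
  · obtain ⟨hn, hi⟩ := h
    have hne := one_sub_mono_ne_zero r hn hi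
    have hD := one_sub_mul_divDiff n r i f
    have hs := congrArg (sAct n r i) hD
    rw [map_mul, map_sub, map_sub, map_one, sAct_sAct r hn hi, sAct_mono,
      reflect_root hn hi] at hs
    have hi1 : mono r (-simpleRoot n i) * mono r (simpleRoot n i) = 1 := by
      rw [← mono_add, neg_add_cancel, mono_zero]
    have hsD : sAct n r i (divDiff n r i f) = mono r (simpleRoot n i) * divDiff n r i f := by
      apply mul_left_cancel₀ hne
      linear_combination (-mono r (simpleRoot n i)) * hs - mono r (simpleRoot n i) * hD -
        sAct n r i (divDiff n r i f) * hi1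
    apply mul_left_cancel₀ hne
    rw [one_sub_mul_divDiff, map_mul, hsD, Algebra.smul_def]
    linear_combination divDiff n r i f * vNum_sub k r hn hi
  · have h0 : ∀ g, divDiff n r i g = 0 := fun g => by
      refine lin_ext (f := divDiff n r i) (g := 0) (fun l => ?_) g
      simp [divDiff_single, coroot_fst_eq_zero h]
    simp [h0]

/-- The quadratic relation of the Hecke algebra. -/
theorem T_quadratic (n : ℕ) (k : Multiplicity) (r : ℂˣ) (i : ℕ) :
    T n k r i * T n k r i =
      ((k.root n i : ℂ) - (k.root n i : ℂ)⁻¹) • T n k r i + 1 := by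
  have ht : (k.root n i : ℂ) ≠ 0 := Units.ne_zero _
  refine LinearMap.ext fun f => ?_
  have h := divDiff_vNum_divDiff n k r i f
  simp only [T, Module.End.mul_apply, LinearMap.sub_apply, LinearMap.smul_apply,
    LinearMap.id_apply, LinearMap.comp_apply, LinearMap.mulLeft_apply, map_sub, map_smul,
    LinearMap.add_apply, Module.End.one_apply, h, smul_sub, smul_smul]
  match_scalars <;> field_simp <;> ring

/-- `T_i` as an invertible operator. -/
def TUnit (n : ℕ) (k : Multiplicity) (r : ℂˣ) (i : ℕ) : (Module.End ℂ (LaurentAlg n))ˣ where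
  val := T n k r i
  inv := T n k r i - ((k.root n i : ℂ) - (k.root n i : ℂ)⁻¹) • 1
  val_inv := by
    rw [mul_sub, T_quadratic, mul_smul_comm, mul_one]
    abel
  inv_val := by
    rw [sub_mul, T_quadratic, smul_mul_assoc, one_mul]
    abel

/-- `Y_i = T_i ⋯ T_{n-1} T_n T_{n-1} ⋯ T_1 T_0 T_1⁻¹ ⋯ T_{i-1}⁻¹` for `1 ≤ i ≤ n`, the image in
the Noumi representation of the element of the affine Hecke algebra which belongs to the
translation `τ(ε_i)`. -/
def Y (n : ℕ) (k : Multiplicity) (r : ℂˣ) (i : ℕ) : (Module.End ℂ (LaurentAlg n))ˣ :=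
  ((List.range' i (n - i)).map (TUnit n k r)).prod * TUnit n k r n *
    ((List.range n).reverse.map (TUnit n k r)).prod *
    ((List.range' 1 (i - 1)).map fun j => (TUnit n k r j)⁻¹).prod

/-- `Y^λ = Y_1^{λ_1} ⋯ Y_n^{λ_n}`. -/
def Ypow (n : ℕ) (k : Multiplicity) (r : ℂˣ) (l : Weight n) : (Module.End ℂ (LaurentAlg n))ˣ :=
  ((List.finRange n).map fun j : Fin n => Y n k r (j + 1) ^ l j).prod

/-- `f(Y) = ∑ c_λ Y^λ` for `f = ∑ c_λ x^λ`. -/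
def evalY (n : ℕ) (k : Multiplicity) (r : ℂˣ) (f : LaurentAlg n) : Module.End ℂ (LaurentAlg n) :=
  f.coeff.sum fun l c => c • (Ypow n k r l : Module.End ℂ (LaurentAlg n))

/-! ### The partial order on weights -/

/-- The orbit relation of the Weyl group `W = S_n ⋉ (±1)^n` on `Λ`. -/
def SameOrbit {n : ℕ} (l m : Weight n) : Prop :=
  ∃ (σ : Equiv.Perm (Fin n)) (s : Fin n → ℤˣ), ∀ j, m j = (s j : ℤ) * l (σ j)

/-- Dominant weights: `⟨λ, a_i^∨⟩ ≥ 0` for `i = 1, …, n`. -/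
def IsDominant {n : ℕ} (l : Weight n) : Prop :=
  ∀ i, 1 ≤ i → i ≤ n → 0 ≤ l ⬝ᵥ (simpleCoroot n i).1

/-- `λ ≤ μ`: the difference `μ - λ` lies in the positive span of the simple co-roots `a_i^∨`,
`i = 1, …, n`. -/
def DomLE {n : ℕ} (l m : Weight n) : Prop :=
  ∃ c : ℕ → ℕ, m - l = ∑ i ∈ Finset.Icc 1 n, c i • (simpleCoroot n i).1

/-- `λ ⪯ μ`: either `λ⁺ < μ⁺`, or `λ⁺ = μ⁺` and `λ ≤ μ`, where `λ⁺` denotes the dominant weight in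
the orbit `W λ`. -/
def PrecEq {n : ℕ} (l m : Weight n) : Prop :=
  ∃ lp mp : Weight n, SameOrbit l lp ∧ IsDominant lp ∧ SameOrbit m mp ∧ IsDominant mp ∧
    ((DomLE lp mp ∧ lp ≠ mp) ∨ (lp = mp ∧ DomLE l m))

/-- `λ ≺ μ`. -/
def Prec {n : ℕ} (l m : Weight n) : Prop := PrecEq l m ∧ l ≠ m

/-! ### The spectral points and the non-symmetric Koornwinder polynomials -/

/-- The sign `ε(m)`, with `ε(m) = 1` for `m ≥ 0` and `ε(m) = -1` for `m < 0`. -/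
def sgn (m : ℤ) : ℤ := if 0 ≤ m then 1 else -1

/-- `ρ_m(λ) = ∑ ε(⟨λ, α⟩) α^∨` over the positive roots `α = ε_i ± ε_j` (`i < j`). -/
def rhoM {n : ℕ} (l : Weight n) : Weight n :=
  ∑ i ∈ Finset.Icc 1 n, ∑ j ∈ Finset.Ioc i n,
    (sgn (l ⬝ᵥ (eps n i - eps n j)) • (eps n i - eps n j) +
      sgn (l ⬝ᵥ (eps n i + eps n j)) • (eps n i + eps n j))

/-- `ρ_l(λ) = ∑ ε(⟨λ, α⟩) α^∨` over the positive roots `α = 2 ε_i`. -/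
def rhoL {n : ℕ} (l : Weight n) : Weight n :=
  ∑ i ∈ Finset.Icc 1 n, sgn (l ⬝ᵥ (2 * eps n i)) • eps n i

/-- `γ_λ = t_0^{ρ_l(λ)} t_n^{ρ_l(λ)} t^{ρ_m(λ)} q^λ` (componentwise), where `q = r²`. -/
def gamma {n : ℕ} (k : Multiplicity) (r : ℂˣ) (l : Weight n) : Fin n → ℂˣ := fun j =>
  k.t0 ^ rhoL l j * k.tn ^ rhoL l j * k.t ^ rhoM l j * (r ^ 2) ^ l j

/-- The value `(y)^{μ + cδ} = q^c y^μ` of the monomial `x^{μ + cδ}` at a point `y`. -/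
def monoAt {n : ℕ} (r : ℂˣ) (y : Fin n → ℂˣ) (β : AffWeight n) : ℂ :=
  ((r ^ β.2 * ∏ j, y j ^ β.1 j : ℂˣ) : ℂ)

/-- The value `f(y)` of a Laurent polynomial. -/
def evalAt {n : ℕ} (y : Fin n → ℂˣ) (f : LaurentAlg n) : ℂ :=
  f.coeff.sum fun l c => c * ((∏ j, y j ^ l j : ℂˣ) : ℂ)

/-- The basis `(P_λ)` of `𝒜` consists of the monic non-symmetric Koornwinder polynomials:
`P_λ = x^λ + ∑_{μ ≺ λ} c_{λ,μ} x^μ`, and `f(Y) P_λ = f(γ_λ) P_λ` for all `f`. -/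
structure IsNonsymmetricKoornwinder {n : ℕ} (k : Multiplicity) (r : ℂˣ)
    (P : Module.Basis (Weight n) ℂ (LaurentAlg n)) : Prop where
  monic : ∀ l, (P l).coeff l = 1
  triangular : ∀ l m, (P l).coeff m ≠ 0 → m = l ∨ Prec m l
  eigen : ∀ (f : LaurentAlg n) (l : Weight n),
    evalY n k r f (P l) = evalAt (gamma k r l) f • P l

/-- Genericity of the parameters, with `q = r²`: no relation `q^a t^b (t_0 t_n)^c = 1` with integers
`a ≠ 0`, `b`, `c` holds (in particular `q` is not a root of unity), and `t² ≠ 1`,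
`t_0² t_n² ≠ 1`. -/
structure IsGeneric (k : Multiplicity) (r : ℂˣ) : Prop where
  q_indep : ∀ a b c : ℤ, a ≠ 0 → (r ^ 2) ^ a * k.t ^ b * (k.t0 * k.tn) ^ c ≠ 1
  t_sq : k.t ^ 2 ≠ 1
  t0_tn_sq : (k.t0 * k.tn) ^ 2 ≠ 1

/-! ### The coefficients -/

/-- `ξ_i = t̃_i - t̃_i⁻¹ ṽ_{-a_i}`, as a function of the values `e β` of the monomials `x^β`. -/
def xi {n : ℕ} {K : Type*} [Field K] [Algebra ℂ K] (k : Multiplicity) (i : ℕ)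
    (e : AffWeight n → K) : K :=
  algebraMap ℂ K (k.dual.root n i) -
    algebraMap ℂ K ((k.dual.root n i)⁻¹ : ℂˣ) * vRoot k.dual i fun β => e (-β)

/-- The value `η_i(γ_λ)`: it is `t̃_i` if `⟨λ, a_i⟩ < 0`, and
`t̃_i⁻³ ṽ_{a_i}(γ_λ) ṽ_{-a_i}(γ_λ)` if `⟨λ, a_i⟩ ≥ 0`. -/
def etaAt {n : ℕ} (k : Multiplicity) (r : ℂˣ) (i : ℕ) (l : Weight n) : ℂ :=
  if l ⬝ᵥ (simpleRoot n i).1 < 0 then k.dual.root n i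
  else (k.dual.root n i : ℂ)⁻¹ ^ 3 * vRoot k.dual i (monoAt r (gamma k r l)) *
    vRoot k.dual i fun β => monoAt r (gamma k r l) (-β)

end Koornwinder

end

open Koornwinder

/-! The operators `Y_i` commute and are triangular with respect to `≺`, with diagonal entries the
components of `γ_λ`. Genericity separates the points `γ_λ`, so simultaneous diagonalisation gives
the basis and its uniqueness. The action of `T_i` then follows from intertwiners.

Commutativity. Written as `T_i = b + (t_i - b) s_i` on rational functions, the operators satisfy
braid relations because the coefficients `b` satisfy two rational identities of rank two
(`braid_three`, `braid_four`). In any group with the braid relations of affine type `C_n`, the words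
defining the `Y_i` commute (`transl_comm`).

Triangularity. `T_i x^μ` is a multiple of `x^{s_i μ}`, possibly a multiple of `x^μ`, and monomials
strictly inside the segment joining them (`T_single`); interior points have a smaller dominant
representative (`prec_between`). Reading the word of `Y_i` from left to right carries the letter
`ε_i` to position `n`, flips its sign, carries it to position 1, flips it back and returns it to its
place. The roots pulled back along the way are positive for the factors `T_j` and negative for the
factors `T_j⁻¹`, which is what makes the extra term `x^μ` harmless (`Tri.mul_T`, `Tri.mul_T_inv`).
The product of the leading coefficients is the component of `γ_λ` (`tri_Y`, `rhoM_eq`).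

Spectrum. A joint eigenvector has as eigenvalues some `γ_m` with `m` maximal in its support
(`IsEigen.exists_gamma`). The powers of `q` in `γ_λ` recover `λ`, so joint eigenspaces are lines
(`IsEigen.eq_smul`). Existence comes from multiplying `x^λ` by factors `(Y_i - γ_m)/(γ_λ - γ_m)`
that remove lower weights one at a time (`exists_isEigen_aux`).

Action of `T_i`. The relation `Y_i = T_i Y_{i+1} T_i`, or for `i = n` the fact that `T_n⁻¹ Y_n` is
conjugate to `T_0`, shows that `T_i - ξ_i(γ)` maps the eigenspace of `γ` to that of `s_i γ`
(`IsEigen.intertwine`). The second case is where the dual parameter `t_0` enters. If `⟨λ, a_i⟩ < 0`,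
the leading coefficient fixes the image as `t_i P_{s_i λ}`. If it is zero, `s_i γ_λ` is no spectral
point and the image vanishes. The positive case follows from the negative one by the quadratic
relation. -/

namespace Koornwinder

/-! ### Braid relations of operators `g ↦ b g + (t - b) s g` -/

section AbstractBraid

variable {K : Type*} [CommRing K]

/-- Compare the coefficients of `w g` for `w` in the group of type `A_2`. They agree for the
elements of length 2 and 3; for the identity, `s₁` and `s₂` the difference is a multiple of `key`.
Here `B` plays the coefficient at the sum of the two roots. -/
theorem braid_three {s₁ s₂ : K →+* K} {b₁ b₂ B t p : K}
    (h11 : ∀ g, s₁ (s₁ g) = g) (h22 : ∀ g, s₂ (s₂ g) = g)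
    (hbr : ∀ g, s₁ (s₂ (s₁ g)) = s₂ (s₁ (s₂ g)))
    (ht₁ : s₁ t = t) (ht₂ : s₂ t = t)
    (e11 : s₁ b₁ = p - b₁) (e12 : s₁ b₂ = B) (e1B : s₁ B = b₂)
    (e22 : s₂ b₂ = p - b₂) (e21 : s₂ b₁ = B) (e2B : s₂ B = b₁)
    (key : b₁ * b₂ = B * (b₁ + b₂ - p)) {T₁ T₂ : K → K}
    (hT₁ : ∀ g, T₁ g = b₁ * g + (t - b₁) * s₁ g) (hT₂ : ∀ g, T₂ g = b₂ * g + (t - b₂) * s₂ g)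
    (g : K) : T₁ (T₂ (T₁ g)) = T₂ (T₁ (T₂ g)) := by
  simp only [hT₁, hT₂, map_add, map_mul, map_sub, h11, h22, hbr, ht₁, ht₂, e11, e12, e1B, e22,
    e21, e2B]
  linear_combination (b₁ - b₂) * key * g + (t - b₁) * key * s₁ g - (t - b₂) * key * s₂ g

/-- The same comparison in type `C_2`: only the coefficients of `s₁`, `s₂`, `s₁ s₂` and `s₂ s₁` need
`key`. The coefficients `b₂'` and `B` belong to the remaining positive roots, each fixed by one of
the two reflections. -/
theorem braid_four {s₁ s₂ : K →+* K} {b₁ b₂ b₂' B t₁ t₂ p₁ p₂ : K}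
    (h11 : ∀ g, s₁ (s₁ g) = g) (h22 : ∀ g, s₂ (s₂ g) = g)
    (hbr : ∀ g, s₁ (s₂ (s₁ (s₂ g))) = s₂ (s₁ (s₂ (s₁ g))))
    (ht₁ : s₁ t₁ = t₁) (ht₂ : s₂ t₁ = t₁) (ht₁' : s₁ t₂ = t₂) (ht₂' : s₂ t₂ = t₂)
    (hp₂ : s₂ p₁ = p₁) (hp₁' : s₁ p₂ = p₂)
    (e11 : s₁ b₁ = p₁ - b₁) (e12 : s₁ b₂ = b₂') (e12' : s₁ b₂' = b₂) (e1B : s₁ B = B)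
    (e22 : s₂ b₂ = p₂ - b₂) (e22' : s₂ b₂' = b₂') (e21 : s₂ b₁ = B) (e2B : s₂ B = b₁)
    (key : (p₁ - b₁) * b₂' + b₁ * b₂ + B * (p₂ - b₂' - b₂) = 0) {T₁ T₂ : K → K}
    (hT₁ : ∀ g, T₁ g = b₁ * g + (t₁ - b₁) * s₁ g)
    (hT₂ : ∀ g, T₂ g = b₂ * g + (t₂ - b₂) * s₂ g)
    (g : K) : T₁ (T₂ (T₁ (T₂ g))) = T₂ (T₁ (T₂ (T₁ g))) := by
  simp only [hT₁, hT₂, map_add, map_mul, map_sub, h11, h22, hbr, ht₁, ht₂, ht₁', ht₂', e11, e12,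
    e12', e1B, e22, e22', e21, e2B, hp₂, hp₁']
  linear_combination (t₁ - b₁) * (b₂' - b₂) * key * s₁ g + (t₂ - b₂) * (b₁ - B) * key * s₂ g +
    (t₁ - b₁) * (t₂ - b₂') * key * s₁ (s₂ g) - (t₂ - b₂) * (t₁ - B) * key * s₂ (s₁ g)

end AbstractBraid

/-! ### Inner products of the simple roots and co-roots -/

theorem two_mul_eps (n j : ℕ) : (2 * eps n j : Weight n) = (2 : ℤ) • eps n j := by
  ext; simp

theorem neg_two_mul_eps (n j : ℕ) : (-2 * eps n j : Weight n) = (-2 : ℤ) • eps n j := by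
  ext; simp

theorem eps_eq_zero {n j : ℕ} (h : ¬ (1 ≤ j ∧ j ≤ n)) : eps n j = 0 := by
  ext x
  have := x.2
  simp only [eps, Pi.zero_apply]
  split_ifs
  · omega
  · rfl

theorem eps_dot' (n i j : ℕ) :
    eps n i ⬝ᵥ eps n j = if i = j ∧ 1 ≤ i ∧ i ≤ n then 1 else 0 := by
  by_cases h : 1 ≤ i ∧ i ≤ n
  · rw [eps_dot h.1 h.2]; simp [h]
  · rw [eps_eq_zero h]; simp [h]

theorem simpleRoot_zero (n : ℕ) : simpleRoot n 0 = ((-2 : ℤ) • eps n 1, 2) := by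
  rw [simpleRoot, if_pos rfl, neg_two_mul_eps]

theorem simpleRoot_last {n : ℕ} (hn : 1 ≤ n) : simpleRoot n n = ((2 : ℤ) • eps n n, 0) := by
  rw [simpleRoot, if_neg (by omega), if_pos rfl, two_mul_eps]

theorem simpleRoot_mid {n i : ℕ} (h1 : 1 ≤ i) (h2 : i < n) :
    simpleRoot n i = (eps n i - eps n (i + 1), 0) := by
  simp [simpleRoot, show i ≠ 0 by omega, show i ≠ n by omega]

theorem simpleCoroot_zero (n : ℕ) : simpleCoroot n 0 = (-eps n 1, 1) := by
  simp [simpleCoroot]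

theorem simpleCoroot_last {n : ℕ} (hn : 1 ≤ n) : simpleCoroot n n = (eps n n, 0) := by
  simp [simpleCoroot, show n ≠ 0 by omega]

theorem simpleCoroot_mid {n i : ℕ} (h1 : 1 ≤ i) (h2 : i < n) :
    simpleCoroot n i = (eps n i - eps n (i + 1), 0) := by
  simp [simpleCoroot, show i ≠ 0 by omega, show i ≠ n by omega]

theorem simpleCoroot_mid_eq {n i : ℕ} (h1 : 1 ≤ i) (h2 : i < n) :
    simpleCoroot n i = simpleRoot n i := by
  rw [simpleCoroot_mid h1 h2, simpleRoot_mid h1 h2]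

/-- The pairing of a simple root with a simple co-root. -/
def cartan (n i j : ℕ) : ℤ := (simpleRoot n i).1 ⬝ᵥ (simpleCoroot n j).1

theorem cartan_self {n i : ℕ} (hn : 1 ≤ n) (hi : i ≤ n) : cartan n i i = 2 :=
  root_dot_coroot hn hi

theorem cartan_far {n i j : ℕ} (hn : 2 ≤ n) (hij : i + 2 ≤ j) (hj : j ≤ n) :
    cartan n i j = 0 ∧ cartan n j i = 0 := by
  unfold cartan
  rcases Nat.eq_zero_or_pos i with rfl | hi <;> rcases hj.lt_or_eq with hj | rfl
  · rw [simpleRoot_zero, simpleCoroot_zero, simpleRoot_mid (by omega) hj,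
      simpleCoroot_mid (by omega) hj]
    constructor <;> simp [eps_dot', smul_dotProduct, -zsmul_eq_mul] <;> grind
  · rw [simpleRoot_zero, simpleCoroot_zero, simpleRoot_last (by omega),
      simpleCoroot_last (by omega)]
    constructor <;> simp [eps_dot', smul_dotProduct, -zsmul_eq_mul] <;> grind
  · rw [simpleRoot_mid hi (by omega), simpleCoroot_mid hi (by omega), simpleRoot_mid (by omega) hj,
      simpleCoroot_mid (by omega) hj]
    constructor <;> simp [eps_dot', smul_dotProduct, -zsmul_eq_mul] <;> grind
  · rw [simpleRoot_mid hi (by omega), simpleCoroot_mid hi (by omega), simpleRoot_last (by omega),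
      simpleCoroot_last (by omega)]
    constructor <;> simp [eps_dot', smul_dotProduct, -zsmul_eq_mul] <;> grind

theorem cartan_mid {n i : ℕ} (hi : 1 ≤ i) (hin : i + 1 < n) :
    cartan n i (i + 1) = -1 ∧ cartan n (i + 1) i = -1 := by
  unfold cartan
  rw [simpleRoot_mid hi (by omega), simpleCoroot_mid hi (by omega),
    simpleRoot_mid (by omega) hin, simpleCoroot_mid (by omega) hin]
  constructor <;> simp [eps_dot', smul_dotProduct, -zsmul_eq_mul] <;> grind

theorem cartan_zero_one {n : ℕ} (hn : 2 ≤ n) : cartan n 0 1 = -2 ∧ cartan n 1 0 = -1 := by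
  unfold cartan
  rw [simpleRoot_zero, simpleCoroot_zero, simpleRoot_mid le_rfl (by omega),
    simpleCoroot_mid le_rfl (by omega)]
  constructor <;> simp [eps_dot', smul_dotProduct, -zsmul_eq_mul] <;> grind

theorem cartan_last {n : ℕ} (hn : 2 ≤ n) :
    cartan n n (n - 1) = -2 ∧ cartan n (n - 1) n = -1 := by
  unfold cartan
  rw [simpleRoot_last (by omega), simpleCoroot_last (by omega),
    simpleRoot_mid (by omega) (by omega), simpleCoroot_mid (by omega) (by omega)]
  constructor <;> simp [eps_dot', smul_dotProduct, -zsmul_eq_mul] <;> grind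

theorem reflect_simpleRoot (n i j : ℕ) :
    reflect n i (simpleRoot n j) = simpleRoot n j - cartan n j i • simpleRoot n i := rfl

theorem reflect_smul (n i : ℕ) (c : ℤ) (β : AffWeight n) :
    reflect n i (c • β) = c • reflect n i β := by
  simp only [reflect, Prod.smul_fst, smul_dotProduct, smul_sub, smul_smul, smul_eq_mul]

theorem reflect_sub (n i : ℕ) (β β' : AffWeight n) :
    reflect n i (β - β') = reflect n i β - reflect n i β' := by
  simp only [reflect, Prod.fst_sub, sub_dotProduct, sub_smul]
  abel

theorem reflect_reflect {n i : ℕ} (hn : 1 ≤ n) (hi : i ≤ n) (β : AffWeight n) :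
    reflect n i (reflect n i β) = β := by
  nth_rw 2 [reflect]
  rw [reflect_sub, reflect_smul, reflect_root hn hi, reflect]
  simp

theorem reflect_dot (n i j : ℕ) (β : AffWeight n) :
    (reflect n i β).1 ⬝ᵥ (simpleCoroot n j).1 =
      β.1 ⬝ᵥ (simpleCoroot n j).1 - β.1 ⬝ᵥ (simpleCoroot n i).1 * cartan n i j := by
  simp only [reflect, cartan, Prod.fst_sub, Prod.smul_fst, sub_dotProduct, smul_dotProduct,
    smul_eq_mul]

theorem reflect_comm {n i j : ℕ} (h : cartan n i j = 0) (h' : cartan n j i = 0)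
    (β : AffWeight n) : reflect n i (reflect n j β) = reflect n j (reflect n i β) := by
  unfold cartan at h h'
  simp only [reflect, Prod.fst_sub, Prod.smul_fst, sub_dotProduct, smul_dotProduct, h, h']
  module

theorem reflect_braid_three {n i j : ℕ} (hn : 1 ≤ n) (hi : i ≤ n) (hj : j ≤ n)
    (h : cartan n i j = -1) (h' : cartan n j i = -1) (β : AffWeight n) :
    reflect n i (reflect n j (reflect n i β)) = reflect n j (reflect n i (reflect n j β)) := by
  unfold cartan at h h'
  simp only [reflect, Prod.fst_sub, Prod.smul_fst, sub_dotProduct, smul_dotProduct, h, h',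
    root_dot_coroot hn hi, root_dot_coroot hn hj, smul_eq_mul]
  module

theorem reflect_braid_four {n i j : ℕ} (hn : 1 ≤ n) (hi : i ≤ n) (hj : j ≤ n)
    (h : cartan n i j = -1) (h' : cartan n j i = -2) (β : AffWeight n) :
    reflect n i (reflect n j (reflect n i (reflect n j β))) =
      reflect n j (reflect n i (reflect n j (reflect n i β))) := by
  unfold cartan at h h'
  simp only [reflect, Prod.fst_sub, Prod.smul_fst, sub_dotProduct, smul_dotProduct, h, h',
    root_dot_coroot hn hi, root_dot_coroot hn hj, smul_eq_mul]
  module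

/-! ### Extension to the field of rational functions -/

/-- The field of rational functions. -/
abbrev RatFun (n : ℕ) := FractionRing (LaurentAlg n)

/-- The action on `𝒜` is an involution, hence injective, so it extends to fractions. Later lemmas
take any `σ` with this property as a hypothesis. -/
theorem exists_reflectionHom {n i : ℕ} (r : ℂˣ) (hn : 1 ≤ n) (hi : i ≤ n) :
    ∃ σ : RatFun n →ₐ[ℂ] RatFun n, ∀ f : LaurentAlg n,
      σ (algebraMap _ _ f) = algebraMap _ _ (sAct n r i f) := by
  have hinj : Function.Injective
      ((IsScalarTower.toAlgHom ℂ (LaurentAlg n) (RatFun n)).comp (sAct n r i)) := by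
    refine (IsFractionRing.injective (LaurentAlg n) (RatFun n)).comp ?_
    exact Function.LeftInverse.injective (sAct_sAct r hn hi)
  refine ⟨IsFractionRing.liftAlgHom hinj, fun f => ?_⟩
  exact IsFractionRing.lift_algebraMap hinj f

theorem ratFun_hom_ext {n : ℕ} (r : ℂˣ) {σ τ : RatFun n →ₐ[ℂ] RatFun n}
    (h : ∀ β : AffWeight n, σ (monoX r β) = τ (monoX r β)) : σ = τ := by
  apply AlgHom.coe_ringHom_injective
  apply IsLocalization.ringHom_ext (nonZeroDivisors (LaurentAlg n))
  apply RingHom.ext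
  intro f
  have e : ∀ (φ : RatFun n →ₐ[ℂ] RatFun n) (c : ℂ) (g : LaurentAlg n),
      φ (algebraMap (LaurentAlg n) (RatFun n) (c • g)) =
        algebraMap ℂ (RatFun n) c * φ (algebraMap _ _ g) := fun φ c g => by
    rw [Algebra.smul_def, map_mul, map_mul, ← IsScalarTower.algebraMap_apply, AlgHom.commutes]
  simp only [RingHom.comp_apply, RingHom.coe_coe]
  induction f using AddMonoidAlgebra.induction_linear with
  | zero => simp
  | add a b ha hb => simp only [map_add, ha, hb]
  | single l c =>
    have h1 : (AddMonoidAlgebra.single l c : LaurentAlg n) = c • mono r (l, 0) := by simp [mono]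
    have h2 := h (l, 0)
    rw [monoX] at h2
    rw [h1, e, e, h2]

theorem monoX_add {n : ℕ} (r : ℂˣ) (β β' : AffWeight n) :
    monoX r (β + β') = monoX r β * monoX r β' := by
  rw [monoX, mono_add, map_mul]; rfl

theorem monoX_zero {n : ℕ} (r : ℂˣ) : monoX r (0 : AffWeight n) = 1 := by
  rw [monoX, mono_zero, map_one]

theorem monoX_ne_zero {n : ℕ} (r : ℂˣ) (β : AffWeight n) : monoX r β ≠ 0 := by
  intro h
  have := monoX_add r β (-β)
  rw [h, add_neg_cancel, monoX_zero, zero_mul] at this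
  exact one_ne_zero this

theorem monoX_neg {n : ℕ} (r : ℂˣ) (β : AffWeight n) : monoX r (-β) = (monoX r β)⁻¹ := by
  refine eq_inv_of_mul_eq_one_left ?_
  rw [← monoX_add, neg_add_cancel, monoX_zero]

theorem monoX_ne_one {n : ℕ} (r : ℂˣ) {β : AffWeight n} (h : β.1 ≠ 0) : monoX r β ≠ 1 := by
  intro h1
  rw [← monoX_zero r] at h1
  have h2 := (IsFractionRing.injective (LaurentAlg n) (RatFun n)) h1
  rw [mono_zero] at h2
  have h3 := congrArg (fun f : LaurentAlg n => f.coeff 0) h2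
  simp [mono, AddMonoidAlgebra.one_def, h] at h3

theorem reflectionHom_monoX {n i : ℕ} {r : ℂˣ} {σ : RatFun n →ₐ[ℂ] RatFun n}
    (hσ : ∀ f : LaurentAlg n, σ (algebraMap _ _ f) = algebraMap _ _ (sAct n r i f))
    (β : AffWeight n) : σ (monoX r β) = monoX r (reflect n i β) := by
  rw [monoX, hσ, sAct_mono]; rfl

/-- The coefficient `b` of the identity in `T_i = b + (t_i - b) s_i`, for `1 ≤ i < n`. -/
noncomputable def midCoeff {n : ℕ} (r : ℂˣ) (p : ℂ) (β : AffWeight n) : RatFun n :=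
  algebraMap ℂ _ p / (1 - monoX r β)

/-- The coefficient `b` of the identity in `T_i = b + (t_i - b) s_i`, for `i = 0` and `i = n`. -/
noncomputable def endCoeff {n : ℕ} (r : ℂˣ) (p w : ℂ) (β : AffWeight n) : RatFun n :=
  (algebraMap ℂ _ p + algebraMap ℂ _ w * monoX r β) / (1 - monoX r β ^ 2)

section

variable {n i : ℕ} {r : ℂˣ} {σ : RatFun n →ₐ[ℂ] RatFun n}

theorem map_midCoeff
    (hσ : ∀ f : LaurentAlg n, σ (algebraMap _ _ f) = algebraMap _ _ (sAct n r i f))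
    (p : ℂ) (β : AffWeight n) : σ (midCoeff r p β) = midCoeff r p (reflect n i β) := by
  simp only [midCoeff, map_div₀, map_sub, map_one, AlgHom.commutes, reflectionHom_monoX hσ]

theorem map_endCoeff
    (hσ : ∀ f : LaurentAlg n, σ (algebraMap _ _ f) = algebraMap _ _ (sAct n r i f))
    (p w : ℂ) (β : AffWeight n) : σ (endCoeff r p w β) = endCoeff r p w (reflect n i β) := by
  simp only [endCoeff, map_div₀, map_sub, map_add, map_mul, map_pow, map_one, AlgHom.commutes,
    reflectionHom_monoX hσ]

theorem midCoeff_neg (p : ℂ) {β : AffWeight n} (h : β.1 ≠ 0) :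
    midCoeff r p (-β) = algebraMap ℂ _ p - midCoeff r p β := by
  have h1 : 1 - monoX r β ≠ 0 := sub_ne_zero.2 (monoX_ne_one r h).symm
  have h2 := monoX_ne_zero r β
  have h3 : 1 - (monoX r β)⁻¹ ≠ 0 := by
    rw [sub_ne_zero, ne_comm, inv_ne_one]; exact monoX_ne_one r h
  have h4 : monoX r β - 1 ≠ 0 := sub_ne_zero.2 (monoX_ne_one r h)
  rw [midCoeff, midCoeff, monoX_neg]
  field_simp
  ring

theorem sq_monoX_ne_one {β : AffWeight n} (h : β.1 ≠ 0) : monoX r β ^ 2 ≠ 1 := by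
  rw [sq, ← monoX_add, ← two_smul ℤ]
  apply monoX_ne_one
  rw [Prod.smul_fst]
  exact smul_ne_zero two_ne_zero h

theorem endCoeff_neg (p w : ℂ) {β : AffWeight n} (h : β.1 ≠ 0) :
    endCoeff r p w (-β) = algebraMap ℂ _ p - endCoeff r p w β := by
  have h1 : 1 - monoX r β ^ 2 ≠ 0 := sub_ne_zero.2 (sq_monoX_ne_one h).symm
  have h2 := monoX_ne_zero r β
  have h4 : monoX r β ^ 2 - 1 ≠ 0 := sub_ne_zero.2 (sq_monoX_ne_one h)
  rw [endCoeff, endCoeff, monoX_neg]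
  have h3 : 1 - (monoX r β)⁻¹ ^ 2 ≠ 0 := by
    rw [inv_pow, sub_ne_zero, ne_comm, inv_ne_one]; exact sq_monoX_ne_one h
  have h5 : 1 - (monoX r β)⁻¹ ^ 2 = (monoX r β ^ 2 - 1) / monoX r β ^ 2 := by field_simp
  rw [h5]
  field_simp
  ring

theorem midCoeff_key (p : ℂ) {β β' : AffWeight n} (h : β.1 ≠ 0) (h' : β'.1 ≠ 0)
    (h'' : (β + β').1 ≠ 0) :
    midCoeff r p β * midCoeff r p β' =
      midCoeff r p (β + β') * (midCoeff r p β + midCoeff r p β' - algebraMap ℂ _ p) := by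
  have h1 : 1 - monoX r β ≠ 0 := sub_ne_zero.2 (monoX_ne_one r h).symm
  have h2 : 1 - monoX r β' ≠ 0 := sub_ne_zero.2 (monoX_ne_one r h').symm
  have h3 : 1 - monoX r β * monoX r β' ≠ 0 := by
    rw [← monoX_add]; exact sub_ne_zero.2 (monoX_ne_one r h'').symm
  simp only [midCoeff, monoX_add]
  field_simp
  ring

/-- This is the `key` of `braid_four`, for the short vectors `β`, `β'` (halves of long roots) and
the middle roots `β ± β'`. After clearing denominators it is a polynomial identity in `x^β` and
`x^{β'}`. -/
theorem endCoeff_key (p₁ p₂ w : ℂ) {β β' : AffWeight n} (h : β.1 ≠ 0) (h' : β'.1 ≠ 0)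
    (h₁ : (β - β').1 ≠ 0) (h₂ : (β + β').1 ≠ 0) :
    (algebraMap ℂ _ p₁ - midCoeff r p₁ (β - β')) * endCoeff r p₂ w β +
      midCoeff r p₁ (β - β') * endCoeff r p₂ w β' +
      midCoeff r p₁ (β + β') * (algebraMap ℂ _ p₂ - endCoeff r p₂ w β - endCoeff r p₂ w β') = 0 := by
  have h1 : 1 - monoX r β ^ 2 ≠ 0 := sub_ne_zero.2 (sq_monoX_ne_one h).symm
  have h2 : 1 - monoX r β' ^ 2 ≠ 0 := sub_ne_zero.2 (sq_monoX_ne_one h').symm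
  have h3 : 1 - monoX r β * monoX r β' ≠ 0 := by
    rw [← monoX_add]; exact sub_ne_zero.2 (monoX_ne_one r h₂).symm
  have h0 := monoX_ne_zero r β'
  have e : monoX r (β - β') = monoX r β / monoX r β' := by
    rw [sub_eq_add_neg, monoX_add, monoX_neg, div_eq_mul_inv]
  have h4 : monoX r β' - monoX r β ≠ 0 := by
    intro h5
    apply monoX_ne_one r h₁
    rw [e, ← sub_eq_zero.1 h5, div_self h0]
  have e2 : midCoeff r p₁ (β - β') =
      algebraMap ℂ _ p₁ * monoX r β' / (monoX r β' - monoX r β) := by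
    rw [midCoeff, e]
    have : 1 - monoX r β / monoX r β' = (monoX r β' - monoX r β) / monoX r β' := by field_simp
    rw [this]
    field_simp
  rw [e2]
  simp only [midCoeff, endCoeff, monoX_add]
  generalize monoX r β = x at *
  generalize monoX r β' = y at *
  generalize algebraMap ℂ (RatFun n) p₁ = a at *
  generalize algebraMap ℂ (RatFun n) p₂ = b at *
  generalize algebraMap ℂ (RatFun n) w = c at *
  have h5 : 1 - y * x ≠ 0 := by rwa [mul_comm]
  field_simp
  ring

end

/-- The coefficient of the identity in `T_i`. -/
noncomputable def idCoeff (n : ℕ) (k : Multiplicity) (r : ℂˣ) (i : ℕ) : RatFun n :=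
  if i = 0 ∨ i = n then
    endCoeff r ((k.root n i : ℂ) - (k.root n i : ℂ)⁻¹) ((k.half n i : ℂ) - (k.half n i : ℂ)⁻¹)
      (simpleCoroot n i)
  else midCoeff r ((k.root n i : ℂ) - (k.root n i : ℂ)⁻¹) (simpleRoot n i)

theorem simpleCoroot_fst_ne_zero {n i : ℕ} (hn : 1 ≤ n) (hi : i ≤ n) :
    (simpleCoroot n i).1 ≠ 0 := by
  intro h
  have := root_dot_coroot hn hi
  simp [h] at this

theorem simpleRoot_fst_ne_zero {n i : ℕ} (hn : 1 ≤ n) (hi : i ≤ n) :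
    (simpleRoot n i).1 ≠ 0 := by
  intro h
  have := root_dot_coroot hn hi
  simp [h] at this

theorem idCoeff_eq {n i : ℕ} (k : Multiplicity) (r : ℂˣ) (hn : 1 ≤ n) (hi : i ≤ n) :
    algebraMap ℂ (RatFun n) (k.root n i) - idCoeff n k r i =
      algebraMap ℂ (RatFun n) (k.root n i : ℂ)⁻¹ * vRoot k i (monoX r) := by
  have ht : algebraMap ℂ (RatFun n) (k.root n i) ≠ 0 := by simp
  have hu : algebraMap ℂ (RatFun n) (k.half n i) ≠ 0 := by simp
  unfold idCoeff vRoot vNum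
  split_ifs with h
  · rw [root_eq_two_smul_coroot h, two_smul, monoX_add, endCoeff]
    have h1 : 1 - monoX r (simpleCoroot n i) ^ 2 ≠ 0 :=
      sub_ne_zero.2 (sq_monoX_ne_one (simpleCoroot_fst_ne_zero hn hi)).symm
    rw [← sq]
    simp only [map_sub, map_mul, map_inv₀, Units.val_inv_eq_inv_val]
    field_simp
    ring
  · have h1 : 1 - monoX r (simpleRoot n i) ≠ 0 :=
      sub_ne_zero.2 (monoX_ne_one r (simpleRoot_fst_ne_zero hn hi)).symm
    simp only [midCoeff, map_sub, map_pow, map_inv₀]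
    field_simp
    ring

theorem algebraMap_T' {n i : ℕ} (k : Multiplicity) {r : ℂˣ} (hn : 1 ≤ n) (hi : i ≤ n)
    {σ : RatFun n →ₐ[ℂ] RatFun n}
    (hσ : ∀ f : LaurentAlg n, σ (algebraMap _ _ f) = algebraMap _ _ (sAct n r i f))
    (f : LaurentAlg n) :
    algebraMap (LaurentAlg n) (RatFun n) (T n k r i f) =
      idCoeff n k r i * algebraMap _ _ f +
        (algebraMap ℂ (RatFun n) (k.root n i) - idCoeff n k r i) * σ (algebraMap _ _ f) := by
  rw [algebraMap_T k r hn hi f, hσ, idCoeff_eq k r hn hi, Algebra.smul_def, Algebra.smul_def]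
  linear_combination (algebraMap (LaurentAlg n) (RatFun n) f) * idCoeff_eq k r hn hi

/-! ### Braid relations of the operators `T_i` -/

/-- A relation between two words in the reflections passes from affine weights to rational
functions, because both words act by algebra homomorphisms and these are determined on monomials. In
the lists, `true` stands for `s_i` and `false` for `s_j`. -/
theorem reflectionHom_comp_apply {n i j : ℕ} {r : ℂˣ} {σ τ : RatFun n →ₐ[ℂ] RatFun n}
    (hσ : ∀ f : LaurentAlg n, σ (algebraMap _ _ f) = algebraMap _ _ (sAct n r i f))
    (hτ : ∀ f : LaurentAlg n, τ (algebraMap _ _ f) = algebraMap _ _ (sAct n r j f))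
    {l m : List (Bool)}
    (h : ∀ β, l.foldr (fun b => reflect n (bif b then i else j)) β =
      m.foldr (fun b => reflect n (bif b then i else j)) β) (g : RatFun n) :
    l.foldr (fun b => bif b then σ else τ) g = m.foldr (fun b => bif b then σ else τ) g := by
  have e : ∀ l : List Bool, ∃ φ : RatFun n →ₐ[ℂ] RatFun n,
      (∀ g, φ g = l.foldr (fun b => bif b then σ else τ) g) ∧
      ∀ β, φ (monoX r β) = monoX r (l.foldr (fun b => reflect n (bif b then i else j)) β) := by
    intro l
    induction l with
    | nil => exact ⟨AlgHom.id _ _, fun _ => rfl, fun _ => rfl⟩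
    | cons b l ih =>
      obtain ⟨φ, h1, h2⟩ := ih
      refine ⟨(bif b then σ else τ).comp φ, fun g => ?_, fun β => ?_⟩
      · rw [AlgHom.comp_apply, h1]; cases b <;> rfl
      · rw [AlgHom.comp_apply, h2]
        cases b
        · exact reflectionHom_monoX hτ _
        · exact reflectionHom_monoX hσ _
  obtain ⟨φ, h1, h2⟩ := e l
  obtain ⟨ψ, h3, h4⟩ := e m
  have : φ = ψ := ratFun_hom_ext r fun β => by rw [h2, h4, h]
  rw [← h1, ← h3, this]

theorem reflectionHom_self {n i : ℕ} {r : ℂˣ} (hn : 1 ≤ n) (hi : i ≤ n)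
    {σ : RatFun n →ₐ[ℂ] RatFun n}
    (hσ : ∀ f : LaurentAlg n, σ (algebraMap _ _ f) = algebraMap _ _ (sAct n r i f))
    (g : RatFun n) : σ (σ g) = g :=
  reflectionHom_comp_apply hσ hσ (l := [true, true]) (m := [])
    (fun β => reflect_reflect hn hi β) g

theorem T_ext {n : ℕ} {A B : Module.End ℂ (LaurentAlg n)}
    (h : ∀ f, algebraMap (LaurentAlg n) (RatFun n) (A f) = algebraMap _ _ (B f)) : A = B :=
  LinearMap.ext fun f => IsFractionRing.injective (LaurentAlg n) (RatFun n) (h f)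

theorem idCoeff_fixed {n i j : ℕ} {r : ℂˣ} (k : Multiplicity)
    {σ : RatFun n →ₐ[ℂ] RatFun n}
    (hσ : ∀ f : LaurentAlg n, σ (algebraMap _ _ f) = algebraMap _ _ (sAct n r i f))
    (h : cartan n j i = 0) : σ (idCoeff n k r j) = idCoeff n k r j := by
  have h1 : reflect n i (simpleRoot n j) = simpleRoot n j := by
    rw [reflect_simpleRoot, h, zero_smul, sub_zero]
  unfold idCoeff
  split_ifs with hj
  · have h2 : reflect n i (simpleCoroot n j) = simpleCoroot n j := by
      rw [root_eq_two_smul_coroot hj, reflect_smul] at h1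
      exact smul_right_injective _ (two_ne_zero (α := ℤ)) h1
    rw [map_endCoeff hσ, h2]
  · rw [map_midCoeff hσ, h1]

theorem T_comm {n i j : ℕ} (k : Multiplicity) (r : ℂˣ) (hn : 1 ≤ n) (hi : i ≤ n) (hj : j ≤ n)
    (h : cartan n i j = 0) (h' : cartan n j i = 0) :
    T n k r i * T n k r j = T n k r j * T n k r i := by
  obtain ⟨σ, hσ⟩ := exists_reflectionHom r hn hi
  obtain ⟨τ, hτ⟩ := exists_reflectionHom r hn hj
  refine T_ext fun f => ?_
  have hc : ∀ g, σ (τ g) = τ (σ g) :=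
    reflectionHom_comp_apply hσ hτ (l := [true, false]) (m := [false, true])
      (fun β => reflect_comm h h' β)
  simp only [Module.End.mul_apply, algebraMap_T' k hn hi hσ, algebraMap_T' k hn hj hτ, map_add,
    map_mul, map_sub, AlgHom.commutes, idCoeff_fixed k hσ h', idCoeff_fixed k hτ h, hc]
  ring

theorem idCoeff_mid {n i : ℕ} (k : Multiplicity) (r : ℂˣ) (h1 : 1 ≤ i) (h2 : i < n) :
    idCoeff n k r i = midCoeff r ((k.t : ℂ) - (k.t : ℂ)⁻¹) (simpleRoot n i) := by
  rw [idCoeff, if_neg (by omega), Multiplicity.root, if_neg (by omega), if_neg (by omega)]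

theorem root_mid {n i : ℕ} (k : Multiplicity) (h1 : 1 ≤ i) (h2 : i < n) : k.root n i = k.t := by
  rw [Multiplicity.root, if_neg (by omega), if_neg (by omega)]

theorem eq_zero_of_reflect {n i : ℕ} {β : AffWeight n} (hn : 1 ≤ n) (hi : i ≤ n)
    (h : (reflect n i β).1 = 0) : β.1 = 0 := by
  rw [← reflect_reflect hn hi β, reflect, h]
  simp [h]

theorem T_braid_three {n i : ℕ} (k : Multiplicity) (r : ℂˣ) (hi : 1 ≤ i) (hin : i + 1 < n) :
    T n k r i * T n k r (i + 1) * T n k r i = T n k r (i + 1) * T n k r i * T n k r (i + 1) := by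
  have hn : 1 ≤ n := by omega
  obtain ⟨σ, hσ⟩ := exists_reflectionHom r hn (show i ≤ n by omega)
  obtain ⟨τ, hτ⟩ := exists_reflectionHom r hn (show i + 1 ≤ n by omega)
  obtain ⟨c1, c2⟩ := cartan_mid hi hin
  refine T_ext fun f => ?_
  have e1 := fun g => algebraMap_T' k hn (show i ≤ n by omega) hσ g
  have e2 := fun g => algebraMap_T' k hn (show i + 1 ≤ n by omega) hτ g
  simp only [idCoeff_mid k r hi (show i < n by omega), idCoeff_mid k r (show 1 ≤ i + 1 by omega) hin,
    root_mid k hi (show i < n by omega), root_mid k (show 1 ≤ i + 1 by omega) hin] at e1 e2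
  set p : ℂ := (k.t : ℂ) - (k.t : ℂ)⁻¹
  set a := simpleRoot n i with ha
  set b := simpleRoot n (i + 1) with hb
  have ra : reflect n i a = -a := reflect_root hn (by omega)
  have rb : reflect n (i + 1) b = -b := reflect_root hn (by omega)
  have rab : reflect n i b = a + b := by rw [hb, reflect_simpleRoot, c2]; module
  have rba : reflect n (i + 1) a = a + b := by rw [ha, reflect_simpleRoot, c1]; module
  have ha0 : a.1 ≠ 0 := simpleRoot_fst_ne_zero hn (by omega)
  have hb0 : b.1 ≠ 0 := simpleRoot_fst_ne_zero hn (by omega)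
  have hab0 : (a + b).1 ≠ 0 := fun h =>
    hb0 (eq_zero_of_reflect hn (show i ≤ n by omega) (by rw [rab, h]))
  simp only [Module.End.mul_apply]
  -- The abstract relation holds for the operators on the whole field; it is then read on the image
  -- of `𝒜`. The operators themselves are inferred from their formulas through the two `rfl`.
  have := braid_three (s₁ := (σ : RatFun n →+* RatFun n)) (s₂ := (τ : RatFun n →+* RatFun n))
    (b₁ := midCoeff r p a) (b₂ := midCoeff r p b) (B := midCoeff r p (a + b))
    (t := algebraMap ℂ _ (k.t : ℂ)) (p := algebraMap ℂ _ p)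
    (reflectionHom_self hn (by omega) hσ) (reflectionHom_self hn (by omega) hτ)
    (reflectionHom_comp_apply hσ hτ (l := [true, false, true]) (m := [false, true, false])
      (fun β => reflect_braid_three hn (by omega) (by omega) c1 c2 β))
    (AlgHom.commutes _ _) (AlgHom.commutes _ _)
    ((map_midCoeff hσ _ _).trans (by rw [ra, midCoeff_neg p ha0]))
    ((map_midCoeff hσ _ _).trans (by rw [rab]))
    ((map_midCoeff hσ _ _).trans (by rw [reflect_add, ra, rab, neg_add_cancel_left]))
    ((map_midCoeff hτ _ _).trans (by rw [rb, midCoeff_neg p hb0]))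
    ((map_midCoeff hτ _ _).trans (by rw [rba]))
    ((map_midCoeff hτ _ _).trans (by rw [reflect_add, rb, rba, add_neg_cancel_right]))
    (midCoeff_key p ha0 hb0 hab0) (T₁ := fun g => _) (T₂ := fun g => _)
    (fun g => rfl) (fun g => rfl) (algebraMap _ _ f)
  simp only [RingHom.coe_coe] at this
  simp only [e1, e2]
  exact this

/-- Both double bonds of the affine diagram are treated at once: `j` is an end node, and `b` below
is half of `a_j`. The reflections of `b` are obtained from those of `2b = a_j` by cancelling the
factor 2. -/
theorem T_braid_four {n i j : ℕ} (k : Multiplicity) (r : ℂˣ) (hn : 2 ≤ n)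
    (hi : 1 ≤ i) (hin : i < n) (hj : j = 0 ∨ j = n)
    (c1 : cartan n i j = -1) (c2 : cartan n j i = -2) :
    T n k r i * T n k r j * T n k r i * T n k r j =
      T n k r j * T n k r i * T n k r j * T n k r i := by
  have hn1 : 1 ≤ n := by omega
  have hi' : i ≤ n := hin.le
  have hj' : j ≤ n := by omega
  obtain ⟨σ, hσ⟩ := exists_reflectionHom r hn1 hi'
  obtain ⟨τ, hτ⟩ := exists_reflectionHom r hn1 hj'
  refine T_ext fun f => ?_
  have e1 := fun g => algebraMap_T' k hn1 hi' hσ g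
  have e2 := fun g => algebraMap_T' k hn1 hj' hτ g
  simp only [idCoeff_mid k r hi hin, root_mid k hi hin] at e1
  rw [idCoeff, if_pos hj] at e2
  set p₁ : ℂ := (k.t : ℂ) - (k.t : ℂ)⁻¹
  set p₂ : ℂ := (k.root n j : ℂ) - (k.root n j : ℂ)⁻¹
  set w : ℂ := (k.half n j : ℂ) - (k.half n j : ℂ)⁻¹
  set b := simpleCoroot n j with hb
  have hjb : simpleRoot n j = (2 : ℤ) • b := root_eq_two_smul_coroot hj
  set a := simpleRoot n i with ha
  have ra : reflect n i a = -a := reflect_root hn1 hi'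
  have rb : reflect n j b = -b := by
    have := reflect_root hn1 hj'
    rw [hjb, reflect_smul, ← smul_neg] at this
    exact smul_right_injective _ (two_ne_zero (α := ℤ)) this
  have rab : reflect n i b = b + a := by
    have := reflect_simpleRoot n i j
    rw [hjb, reflect_smul, c2] at this
    refine smul_right_injective _ (two_ne_zero (α := ℤ)) (this.trans ?_)
    module
  have rba : reflect n j a = a + (2 : ℤ) • b := by
    rw [ha, reflect_simpleRoot, c1, hjb]; module
  have ha0 : a.1 ≠ 0 := simpleRoot_fst_ne_zero hn1 hi'
  have hb0 : b.1 ≠ 0 := simpleCoroot_fst_ne_zero hn1 hj'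
  have hba0 : (b + a).1 ≠ 0 := fun h => hb0 (eq_zero_of_reflect hn1 hi' (by rw [rab, h]))
  have ha2b0 : (a + (2 : ℤ) • b).1 ≠ 0 := fun h => ha0 (eq_zero_of_reflect hn1 hj' (by rw [rba, h]))
  have s1 : b + a - b = a := by abel
  have s2 : b + a + b = a + (2 : ℤ) • b := by module
  -- With `β = b + a` and `β' = b` the difference is `a_i` and the sum is `a_i + a_j`.
  have key := endCoeff_key (r := r) p₁ p₂ w hba0 hb0 (by rwa [s1]) (by rwa [s2])
  rw [s1, s2] at key
  simp only [Module.End.mul_apply]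
  have := braid_four (s₁ := (σ : RatFun n →+* RatFun n)) (s₂ := (τ : RatFun n →+* RatFun n))
    (b₁ := midCoeff r p₁ a) (b₂ := endCoeff r p₂ w b) (b₂' := endCoeff r p₂ w (b + a))
    (B := midCoeff r p₁ (a + (2 : ℤ) • b))
    (t₁ := algebraMap ℂ _ (k.t : ℂ)) (t₂ := algebraMap ℂ _ (k.root n j : ℂ))
    (p₁ := algebraMap ℂ _ p₁) (p₂ := algebraMap ℂ _ p₂)
    (reflectionHom_self hn1 hi' hσ) (reflectionHom_self hn1 hj' hτ)
    (reflectionHom_comp_apply hσ hτ (l := [true, false, true, false])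
      (m := [false, true, false, true])
      (fun β => reflect_braid_four hn1 hi' hj' c1 c2 β))
    (AlgHom.commutes _ _) (AlgHom.commutes _ _) (AlgHom.commutes _ _) (AlgHom.commutes _ _)
    (AlgHom.commutes _ _) (AlgHom.commutes _ _)
    ((map_midCoeff hσ _ _).trans (by rw [ra, midCoeff_neg p₁ ha0]))
    ((map_endCoeff hσ _ _ _).trans (by rw [rab]))
    ((map_endCoeff hσ _ _ _).trans (by rw [reflect_add, ra, rab, add_neg_cancel_right]))
    ((map_midCoeff hσ _ _).trans (by
      rw [reflect_add, reflect_smul, ra, rab]; congr 1; module))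
    ((map_endCoeff hτ _ _ _).trans (by rw [rb, endCoeff_neg p₂ w hb0]))
    ((map_endCoeff hτ _ _ _).trans (by rw [reflect_add, rb, rba]; congr 1; module))
    ((map_midCoeff hτ _ _).trans (by rw [rba]))
    ((map_midCoeff hτ _ _).trans (by rw [reflect_add, reflect_smul, rb, rba]; congr 1; module))
    (by linear_combination key) (T₁ := fun g => _) (T₂ := fun g => _)
    (fun g => rfl) (fun g => rfl) (algebraMap _ _ f)
  simp only [RingHom.coe_coe] at this
  simp only [e1, e2]
  exact this

/-! ### Commuting elements in groups with braid relations of type `C̃_n` -/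

section BraidGroup

variable {G : Type*} [Group G]

/-- The braid relations of affine type `C_n`. -/
structure IsBraid (n : ℕ) (t : ℕ → G) : Prop where
  far : ∀ i j, i + 2 ≤ j → j ≤ n → Commute (t i) (t j)
  mid : ∀ i, 1 ≤ i → i + 1 < n → t i * t (i + 1) * t i = t (i + 1) * t i * t (i + 1)
  zero : t 1 * t 0 * t 1 * t 0 = t 0 * t 1 * t 0 * t 1
  last : t (n - 1) * t n * t (n - 1) * t n = t n * t (n - 1) * t n * t (n - 1)

/-- `t_i ⋯ t_{n-1} t_n t_{n-1} ⋯ t_i`. -/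
def hook (n : ℕ) (t : ℕ → G) (i : ℕ) : G :=
  ((List.range' i (n - i)).map t).prod * t n * ((List.range' i (n - i)).reverse.map t).prod

/-- `t_i ⋯ t_n ⋯ t_0 t_1⁻¹ ⋯ t_{i-1}⁻¹`. -/
def transl (n : ℕ) (t : ℕ → G) (i : ℕ) : G :=
  ((List.range' i (n - i)).map t).prod * t n * ((List.range n).reverse.map t).prod *
    ((List.range' 1 (i - 1)).map fun j => (t j)⁻¹).prod

variable {n : ℕ} {t : ℕ → G}

theorem hook_last : hook n t n = t n := by simp [hook]

theorem hook_eq {i : ℕ} (hi : i < n) : hook n t i = t i * hook n t (i + 1) * t i := by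
  have : n - i = (n - (i + 1)) + 1 := by omega
  rw [hook, hook, this, List.range'_succ]
  simp [mul_assoc]

theorem transl_one (hn : 1 ≤ n) : transl n t 1 = hook n t 1 * t 0 := by
  have : List.range n = 0 :: List.range' 1 (n - 1) := by
    obtain ⟨m, rfl⟩ : ∃ m, n = m + 1 := ⟨n - 1, by omega⟩
    rw [List.range_eq_range', List.range'_succ]; rfl
  rw [transl, hook, this]
  simp [mul_assoc]

/-- Passing from `i + 1` to `i` adds a letter `t_i` on the left, and a `t_i` on the right cancels
the last inverse letter. This one relation drives the commutation proofs and the intertwiners for `i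
< n`. -/
theorem transl_eq {i : ℕ} (h1 : 1 ≤ i) (hi : i < n) :
    transl n t i = t i * transl n t (i + 1) * t i := by
  obtain ⟨m, rfl⟩ : ∃ m, i = m + 1 := ⟨i - 1, by omega⟩
  have : n - (m + 1) = (n - (m + 1 + 1)) + 1 := by omega
  have h2 : List.range' 1 (m + 1) = List.range' 1 m ++ [m + 1] := by
    rw [List.range'_concat]; simp [add_comm]
  rw [transl, transl, this, List.range'_succ, Nat.add_sub_cancel, Nat.add_sub_cancel, h2]
  simp [mul_assoc]

/-- Being conjugate to `t_0`, this element inherits the quadratic relation of `T_0`; the intertwiner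
at `i = n` depends on it. -/
theorem inv_mul_transl_last (hn : 1 ≤ n) :
    (t n)⁻¹ * transl n t n = ((List.range' 1 (n - 1)).reverse.map t).prod * t 0 *
      (((List.range' 1 (n - 1)).reverse.map t).prod)⁻¹ := by
  have : List.range n = 0 :: List.range' 1 (n - 1) := by
    obtain ⟨m, rfl⟩ : ∃ m, n = m + 1 := ⟨n - 1, by omega⟩
    rw [List.range_eq_range', List.range'_succ]; rfl
  rw [transl, this, List.prod_inv_reverse]
  simp [mul_assoc, Function.comp_def]

theorem hook_comm_far (hb : IsBraid n t) {i j : ℕ} (hij : j + 2 ≤ i) (hi : i ≤ n) :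
    Commute (t j) (hook n t i) := by
  induction hi using Nat.decreasingInduction with
  | self => rw [hook_last]; exact hb.far j n hij le_rfl
  | of_succ m hm ih =>
    have h := hb.far j m hij hm.le
    rw [hook_eq hm]
    exact (h.mul_right (ih (by omega))).mul_right h

/-- Descending induction on `i` from `j - 1`. At the start, the braid relation of `t_{j-1}` and
`t_j` does the work: the four-term one if `j = n`, otherwise the three-term one together with the
commutation of `t_{j-1}` with the hook from `j + 1`. Every further outer letter is far from `j`. -/
theorem hook_comm (hb : IsBraid n t) {i j : ℕ} (h1 : 1 ≤ i) (hij : i < j) (hj : j ≤ n) :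
    Commute (t j) (hook n t i) := by
  have hi : i ≤ j - 1 := by omega
  induction hi using Nat.decreasingInduction with
  | self =>
    obtain ⟨m, rfl⟩ : ∃ m, j = m + 1 := ⟨j - 1, by omega⟩
    rw [Nat.add_sub_cancel] at h1 hij ⊢
    rcases hj.eq_or_lt with h | h
    · rw [hook_eq (by omega), h, hook_last]
      have := hb.last
      rw [show n - 1 = m by omega] at this
      simp only [mul_assoc] at this
      simpa only [Commute, SemiconjBy, mul_assoc] using this.symm
    · rw [hook_eq (by omega), hook_eq h]
      have hm := hb.mid m h1 h
      have hc := hook_comm_far hb (i := m + 2) (j := m) le_rfl (by omega)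
      show _ * _ = _ * _
      calc t (m + 1) * (t m * (t (m + 1) * hook n t (m + 1 + 1) * t (m + 1)) * t m)
          = (t (m + 1) * t m * t (m + 1)) * hook n t (m + 2) * t (m + 1) * t m := by
            simp only [mul_assoc]
        _ = t m * t (m + 1) * (t m * hook n t (m + 2)) * t (m + 1) * t m := by
            rw [← hm]; simp only [mul_assoc]
        _ = t m * t (m + 1) * hook n t (m + 2) * (t m * t (m + 1) * t m) := by
            rw [hc.eq]; simp only [mul_assoc]
        _ = _ := by rw [hm]; simp only [mul_assoc]
  | of_succ m hm ih =>
    have h := (hb.far m j (by omega) hj).symm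
    rw [hook_eq (by omega)]
    exact (h.mul_right (ih (by omega) (by omega))).mul_right h

theorem transl_succ {i : ℕ} (h1 : 1 ≤ i) (hi : i < n) :
    transl n t (i + 1) = (t i)⁻¹ * transl n t i * (t i)⁻¹ := by
  rw [transl_eq h1 hi]
  simp [mul_assoc]

/-- Induction on `i` through `Y_{i+1} = t_i⁻¹ Y_i t_i⁻¹`; for `i = 1` it is the commutation of `t_j`
with the hook and with `t_0`. -/
theorem transl_comm_of_ne (hb : IsBraid n t) {i j : ℕ} (h1 : 1 ≤ i) (hi : i ≤ n)
    (hj : 1 ≤ j) (hjn : j ≤ n) (h : j ≠ i) (h' : j + 1 ≠ i) : Commute (t j) (transl n t i) := by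
  induction i using Nat.strong_induction_on generalizing j with
  | _ i ih =>
    rcases h1.eq_or_lt with rfl | h2
    · rw [transl_one (by omega)]
      exact (hook_comm hb le_rfl (by omega) hjn).mul_right (hb.far 0 j (by omega) hjn).symm
    obtain ⟨m, rfl⟩ : ∃ m, i = m + 1 := ⟨i - 1, by omega⟩
    rw [transl_succ (by omega) (by omega)]
    -- If `t_j` does not commute with `t_m`, unfold once more: `Y_{j+2} = t_{j+1}⁻¹ t_j⁻¹ Y_j t_j⁻¹
    -- t_{j+1}⁻¹`. Moving `t_j` past the left pair turns it into `t_{j+1}`, which commutes with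
    -- `Y_j`, and the right pair turns it back.
    by_cases hji : j + 1 = m
    · subst hji
      have hc : Commute (t (j + 1)) (transl n t j) :=
        ih j (by omega) hj (by omega) (by omega) (by omega) (by omega) (by omega)
      rw [transl_succ hj (by omega)]
      have hm := hb.mid j hj (by omega)
      have e1 : t j * ((t (j + 1))⁻¹ * (t j)⁻¹) = (t (j + 1))⁻¹ * ((t j)⁻¹ * t (j + 1)) := by
        rw [eq_inv_mul_iff_mul_eq, eq_inv_mul_iff_mul_eq, ← mul_assoc, ← mul_assoc,
          ← mul_assoc, mul_inv_eq_iff_eq_mul, mul_inv_eq_iff_eq_mul, hm]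
      have e2 : (t j)⁻¹ * ((t (j + 1))⁻¹ * t j) = t (j + 1) * ((t j)⁻¹ * (t (j + 1))⁻¹) := by
        rw [inv_mul_eq_iff_eq_mul, inv_mul_eq_iff_eq_mul, ← mul_assoc, ← mul_assoc,
          ← mul_assoc, eq_mul_inv_iff_mul_eq, eq_mul_inv_iff_mul_eq, hm]
      show _ * _ = _ * _
      calc t j * ((t (j + 1))⁻¹ * ((t j)⁻¹ * transl n t j * (t j)⁻¹) * (t (j + 1))⁻¹)
          = (t j * ((t (j + 1))⁻¹ * (t j)⁻¹)) * transl n t j * ((t j)⁻¹ * (t (j + 1))⁻¹) := by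
            simp only [mul_assoc]
        _ = (t (j + 1))⁻¹ * (t j)⁻¹ * (t (j + 1) * transl n t j) * ((t j)⁻¹ * (t (j + 1))⁻¹) := by
            rw [e1]; simp only [mul_assoc]
        _ = (t (j + 1))⁻¹ * (t j)⁻¹ * transl n t j * (t (j + 1) * ((t j)⁻¹ * (t (j + 1))⁻¹)) := by
            rw [hc.eq]; simp only [mul_assoc]
        _ = _ := by rw [← e2]; simp only [mul_assoc]
    · have hc : Commute (t j) (t m)⁻¹ := by
        apply Commute.inv_right
        rcases lt_or_gt_of_ne (show j ≠ m by omega) with hlt | hlt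
        · exact hb.far j m (by omega) (by omega)
        · exact (hb.far m j (by omega) (by omega)).symm
      exact (hc.mul_right
        (ih m (by omega) (by omega) (by omega) hj hjn (by omega) (by omega))).mul_right hc

/-- With `H` the hook from 2, `Y_1 = t_1 H t_1 t_0` and `Y_2 = H t_1 t_0 t_1⁻¹`. Three facts
suffice: `H` commutes with `t_0`, it commutes with `t_1 H t_1` (the hook from 1, which commutes with
all letters of `H`), and `t_1`, `t_0` satisfy the four-term relation. -/
theorem transl_one_comm_two (hn : 2 ≤ n) (hb : IsBraid n t) :
    Commute (transl n t 1) (transl n t 2) := by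
  have h1 : transl n t 1 = t 1 * hook n t 2 * t 1 * t 0 := by
    rw [transl_one (by omega), hook_eq (by omega)]
  have h2 : transl n t 2 = hook n t 2 * t 1 * t 0 * (t 1)⁻¹ := by
    rw [transl_succ le_rfl (by omega), h1]; group
  have hc0 : Commute (t 0) (hook n t 2) := hook_comm_far hb le_rfl hn
  have hcj : ∀ j, 2 ≤ j → j ≤ n → Commute (t j) (hook n t 1) := fun j h h' =>
    hook_comm hb le_rfl (by omega) h'
  have hc1 : Commute (hook n t 2) (hook n t 1) := by
    unfold hook
    refine Commute.mul_left (Commute.mul_left ?_ (hcj n hn le_rfl)) ?_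
    all_goals
      refine Commute.list_prod_left _ _ fun x hx => ?_
      simp only [List.mem_map, List.mem_reverse, List.mem_range'_1] at hx
      obtain ⟨j, hj, rfl⟩ := hx
      exact hcj j (by omega) (by omega)
  rw [hook_eq (t := t) (n := n) (i := 1) (by omega)] at hc1
  have hz : t 0 * t 1 * t 0 * (t 1)⁻¹ = (t 1)⁻¹ * (t 0 * t 1 * t 0) := by
    rw [eq_inv_mul_iff_mul_eq, ← mul_assoc, mul_inv_eq_iff_eq_mul, ← hb.zero]
    simp only [mul_assoc]
  have hq : t 1 * hook n t 2 * t 1 * hook n t 2 * (t 1)⁻¹ = hook n t 2 * t 1 * hook n t 2 := by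
    rw [mul_inv_eq_iff_eq_mul, ← hc1.eq]
    simp only [mul_assoc]
  rw [h1, h2]
  show _ * _ = _ * _
  calc t 1 * hook n t 2 * t 1 * t 0 * (hook n t 2 * t 1 * t 0 * (t 1)⁻¹)
      = t 1 * hook n t 2 * t 1 * (t 0 * hook n t 2) * t 1 * t 0 * (t 1)⁻¹ := by
        simp only [mul_assoc]
    _ = t 1 * hook n t 2 * t 1 * hook n t 2 * (t 0 * t 1 * t 0 * (t 1)⁻¹) := by
        rw [hc0.eq]; simp only [mul_assoc]
    _ = (t 1 * hook n t 2 * t 1 * hook n t 2 * (t 1)⁻¹) * (t 0 * t 1 * t 0) := by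
        rw [hz]; simp only [mul_assoc]
    _ = hook n t 2 * t 1 * (hook n t 2 * t 0) * t 1 * t 0 := by
        rw [hq]; simp only [mul_assoc]
    _ = _ := by rw [← hc0.eq]; simp [mul_assoc]

/-- Starting from the pair `(1, 2)`, raise the second index and then the first: the letters
conjugating one factor commute with the other. -/
theorem transl_comm_of_lt (hb : IsBraid n t) {i j : ℕ} (h1 : 1 ≤ i) (hij : i < j)
    (hj : j ≤ n) : Commute (transl n t i) (transl n t j) := by
  induction i, h1 using Nat.le_induction generalizing j with
  | base =>
    induction j, (show 2 ≤ j from hij) using Nat.le_induction with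
    | base => exact transl_one_comm_two hj hb
    | succ j h2 ih =>
      have h := (transl_comm_of_ne hb le_rfl (by omega) (show 1 ≤ j by omega) (by omega)
        (by omega) (by omega)).symm.inv_right
      rw [transl_succ (i := j) (by omega) (by omega)]
      exact (h.mul_right (ih (by omega) (by omega))).mul_right h
  | succ i h1 ih =>
    have h := (transl_comm_of_ne hb (show 1 ≤ j by omega) hj h1 (by omega)
        (by omega) (by omega)).inv_left
    rw [transl_succ (by omega) (by omega)]
    exact (h.mul_left (ih (by omega) hj)).mul_left h

theorem transl_comm (hb : IsBraid n t) {i j : ℕ} (hi : 1 ≤ i) (hin : i ≤ n) (hj : 1 ≤ j)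
    (hjn : j ≤ n) : Commute (transl n t i) (transl n t j) := by
  rcases lt_trichotomy i j with h | rfl | h
  · exact transl_comm_of_lt hb hi h hjn
  · exact Commute.refl _
  · exact (transl_comm_of_lt hb hj h hin).symm

end BraidGroup

theorem isBraid_TUnit {n : ℕ} (hn : 2 ≤ n) (k : Multiplicity) (r : ℂˣ) :
    IsBraid n (TUnit n k r) where
  far i j hij hj := Units.ext (T_comm k r (by omega) (by omega) hj (cartan_far hn hij hj).1
    (cartan_far hn hij hj).2)
  mid i hi hin := Units.ext (T_braid_three k r hi hin)
  zero := Units.ext (T_braid_four k r hn le_rfl (by omega) (Or.inl rfl) (cartan_zero_one hn).2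
    (cartan_zero_one hn).1)
  last := Units.ext (T_braid_four k r hn (by omega) (by omega) (Or.inr rfl) (cartan_last hn).2
    (cartan_last hn).1)

/-! ### The partial order on weights -/

/-- The sum of the first `i` coordinates. -/
def psum {n : ℕ} (l : Weight n) (i : ℕ) : ℤ := ∑ x ∈ Finset.univ.filter (fun x : Fin n => (x : ℕ) < i), l x

theorem psum_sub {n : ℕ} (l m : Weight n) (i : ℕ) : psum (m - l) i = psum m i - psum l i := by
  simp [psum]

theorem psum_eps {n j : ℕ} (h1 : 1 ≤ j) (hj : j ≤ n) (i : ℕ) :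
    psum (eps n j) i = if j ≤ i then 1 else 0 := by
  have : ∀ x : Fin n, eps n j x = if x = ⟨j - 1, by omega⟩ then 1 else 0 := by
    intro x
    simp only [eps, Fin.ext_iff]
    congr 1
    simp only [eq_iff_iff]
    omega
  simp only [psum, this, Finset.sum_ite_eq', Finset.mem_filter, Finset.mem_univ, true_and]
  congr 1
  simp only [eq_iff_iff]
  omega

theorem psum_simpleCoroot {n i j : ℕ} (h1 : 1 ≤ j) (hj : j ≤ n) (hi : i ≤ n) :
    psum (simpleCoroot n j).1 i = if j = i then 1 else 0 := by
  rcases hj.eq_or_lt with rfl | h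
  · rw [simpleCoroot_last h1, psum_eps h1 le_rfl]
    congr 1; simp only [eq_iff_iff]; omega
  · rw [simpleCoroot_mid h1 h, psum_sub, psum_eps h1 hj, psum_eps (by omega) h]
    split_ifs <;> omega

theorem psum_succ {n : ℕ} (l : Weight n) (x : Fin n) : psum l (x + 1) = psum l x + l x := by
  have : (Finset.univ.filter fun y : Fin n => (y : ℕ) < x + 1) =
      insert x (Finset.univ.filter fun y : Fin n => (y : ℕ) < x) := by
    ext y
    simp [Fin.ext_iff]
    omega
  rw [psum, this, Finset.sum_insert (by simp), add_comm]
  rfl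

theorem eq_of_psum_eq {n : ℕ} {l m : Weight n} (h : ∀ i, i ≤ n → psum l i = psum m i) :
    l = m := by
  ext x
  have h1 := h x x.2.le
  have h2 := h (x + 1) x.2
  rw [psum_succ, psum_succ] at h2
  omega

theorem psum_sum_coroot {n : ℕ} (c : ℕ → ℤ) {i : ℕ} (h2 : 1 ≤ i) (hi : i ≤ n) :
    psum (∑ j ∈ Finset.Icc 1 n, c j • (simpleCoroot n j).1) i = c i := by
  have : psum (∑ j ∈ Finset.Icc 1 n, c j • (simpleCoroot n j).1) i =
      ∑ j ∈ Finset.Icc 1 n, c j * psum (simpleCoroot n j).1 i := by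
    simp only [psum, Finset.mul_sum, Finset.sum_apply]
    rw [Finset.sum_comm]
    rfl
  rw [this, Finset.sum_congr rfl fun j hj => by
    rw [psum_simpleCoroot (Finset.mem_Icc.1 hj).1 (Finset.mem_Icc.1 hj).2 hi]]
  simp [h2, hi]

/-- Partial sums are the coordinates dual to the simple co-roots, so the coefficient of `a_i^∨` in
`m - l` is its `i`-th partial sum. -/
theorem domLE_iff {n : ℕ} {l m : Weight n} :
    DomLE l m ↔ ∀ i, i ≤ n → psum l i ≤ psum m i := by
  constructor
  · rintro ⟨c, hc⟩ i hi
    rcases Nat.eq_zero_or_pos i with rfl | h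
    · simp [psum]
    · have h1 := psum_sum_coroot (fun j => (c j : ℤ)) h hi
      simp only [natCast_zsmul] at h1
      rw [← hc, psum_sub] at h1
      omega
  · intro h
    refine ⟨fun i => (psum (m - l) i).toNat, eq_of_psum_eq fun i hi => ?_⟩
    have hnn : ∀ i, i ≤ n → ((psum (m - l) i).toNat : ℤ) = psum (m - l) i := fun i hi =>
      Int.toNat_of_nonneg (by rw [psum_sub]; linarith [h i hi])
    rcases Nat.eq_zero_or_pos i with rfl | h1
    · simp [psum]
    · have h2 := psum_sum_coroot (fun j => ((psum (m - l) j).toNat : ℤ)) h1 hi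
      simp only [natCast_zsmul] at h2
      rw [h2, hnn i hi]

theorem DomLE.trans {n : ℕ} {l m p : Weight n} (h : DomLE l m) (h' : DomLE m p) : DomLE l p :=
  domLE_iff.2 fun i hi => (domLE_iff.1 h i hi).trans (domLE_iff.1 h' i hi)

theorem DomLE.antisymm {n : ℕ} {l m : Weight n} (h : DomLE l m) (h' : DomLE m l) : l = m :=
  eq_of_psum_eq fun i hi => (domLE_iff.1 h i hi).antisymm (domLE_iff.1 h' i hi)

/-- The dominance preorder `l⁺ ≤ m⁺`, in terms of maximal sums of absolute values of
coordinates. -/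
def AbsLE {n : ℕ} (l m : Weight n) : Prop :=
  ∀ A : Finset (Fin n), ∃ B : Finset (Fin n), B.card = A.card ∧ ∑ x ∈ A, |l x| ≤ ∑ x ∈ B, |m x|

theorem AbsLE.trans {n : ℕ} {l m p : Weight n} (h : AbsLE l m) (h' : AbsLE m p) : AbsLE l p := by
  intro A
  obtain ⟨B, hB, hAB⟩ := h A
  obtain ⟨C, hC, hBC⟩ := h' B
  exact ⟨C, hC.trans hB, hAB.trans hBC⟩

theorem abs_units_mul (s : ℤˣ) (a : ℤ) : |(s : ℤ) * a| = |a| := by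
  rw [abs_mul, Int.isUnit_iff_abs_eq.1 s.isUnit, one_mul]

theorem SameOrbit.sum_abs {n : ℕ} {l m : Weight n} (h : SameOrbit l m) (A : Finset (Fin n)) :
    ∃ B : Finset (Fin n), B.card = A.card ∧ ∑ x ∈ A, |m x| = ∑ x ∈ B, |l x| := by
  obtain ⟨σ, s, h⟩ := h
  refine ⟨A.map σ.toEmbedding, Finset.card_map _, ?_⟩
  rw [Finset.sum_map]
  exact Finset.sum_congr rfl fun x _ => by rw [h, abs_units_mul]; rfl

theorem SameOrbit.symm {n : ℕ} {l m : Weight n} (h : SameOrbit l m) : SameOrbit m l := by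
  obtain ⟨σ, s, h⟩ := h
  refine ⟨σ⁻¹, fun j => s (σ⁻¹ j), fun j => ?_⟩
  rw [h, ← mul_assoc, ← Units.val_mul, Int.units_mul_self]
  simp

theorem SameOrbit.absLE {n : ℕ} {l m : Weight n} (h : SameOrbit l m) : AbsLE m l := fun A => by
  obtain ⟨B, hB, e⟩ := h.sum_abs A
  exact ⟨B, hB, e.le⟩

theorem SameOrbit.sum_sq {n : ℕ} {l m : Weight n} (h : SameOrbit l m) :
    ∑ x, m x ^ 2 = ∑ x, l x ^ 2 := by
  obtain ⟨σ, s, h⟩ := h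
  rw [← Equiv.sum_comp σ fun x => l x ^ 2]
  refine Finset.sum_congr rfl fun x _ => ?_
  rw [h, mul_pow, ← sq_abs (s x : ℤ), Int.isUnit_iff_abs_eq.1 (s x).isUnit, one_pow, one_mul]

theorem dot_eps {n j : ℕ} (l : Weight n) (h1 : 1 ≤ j) (hj : j ≤ n) :
    l ⬝ᵥ eps n j = l ⟨j - 1, by omega⟩ := by
  have : ∀ x : Fin n, l x * eps n j x = if x = ⟨j - 1, by omega⟩ then l x else 0 := by
    intro x
    simp only [eps, Fin.ext_iff]
    split_ifs <;> grind
  simp [dotProduct, this]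

theorem isDominant_iff {n : ℕ} {l : Weight n} :
    IsDominant l ↔ Antitone l ∧ ∀ x, 0 ≤ l x := by
  constructor
  · intro h
    have ha : Antitone fun k : ℕ => if h : k < n then l ⟨k, h⟩ else 0 := by
      refine antitone_nat_of_succ_le fun k => ?_
      rcases lt_trichotomy (k + 1) n with h1 | h1 | h1
      · have := h (k + 1) (by omega) (by omega)
        rw [simpleCoroot_mid (by omega) h1, dotProduct_sub, dot_eps l (by omega) (by omega),
          dot_eps l (by omega) (by omega)] at this
        simp only [Nat.add_sub_cancel] at this
        rw [dif_pos h1, dif_pos (by omega)]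
        omega
      · have := h (k + 1) (by omega) (by omega)
        rw [h1, simpleCoroot_last (by omega), dot_eps l (by omega) (by omega)] at this
        rw [dif_neg (by omega), dif_pos (by omega)]
        have e : n - 1 = k := by omega
        simpa [e] using this
      · rw [dif_neg (by omega), dif_neg (by omega)]
    constructor
    · intro x y hxy
      have := ha (show (x : ℕ) ≤ y from hxy)
      simpa using this
    · intro x
      have := ha x.2.le
      simpa using this
  · rintro ⟨ha, h0⟩ i h1 hi
    rcases hi.eq_or_lt with rfl | h
    · rw [simpleCoroot_last h1, dot_eps l h1 le_rfl]
      exact h0 _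
    · rw [simpleCoroot_mid h1 h, dotProduct_sub, dot_eps l h1 hi,
        dot_eps l (by omega) (by omega), sub_nonneg]
      exact ha (by simp [Fin.le_def])

theorem exists_dominant {n : ℕ} (l : Weight n) : ∃ m, SameOrbit l m ∧ IsDominant m := by
  let σ := Tuple.sort fun j => -|l j|
  have hσ := Tuple.monotone_sort fun j => -|l j|
  refine ⟨fun j => |l (σ j)|, ⟨σ, fun j => if 0 ≤ l (σ j) then 1 else -1, fun j => ?_⟩,
    isDominant_iff.2 ⟨fun x y hxy => ?_, fun x => abs_nonneg _⟩⟩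
  · dsimp only
    split_ifs with h
    · simp [abs_of_nonneg h]
    · simp [abs_of_neg (not_le.1 h)]
  · have := hσ hxy
    simpa using this

/-- For a dominant weight the first coordinates are the largest, so they maximise sums over subsets
of given size. -/
theorem sum_le_psum {n : ℕ} {l : Weight n} (h : IsDominant l) (B : Finset (Fin n)) :
    ∑ x ∈ B, |l x| ≤ psum l B.card := by
  obtain ⟨ha, h0⟩ := isDominant_iff.1 h
  have hB : B.card ≤ n := by simpa using B.card_le_univ
  set c := B.card with hc
  -- A threshold `v` separates the first `c` coordinates from the others (0 if there are no others).
  -- Subtracting it from each term changes both sums equally and makes the comparison termwise.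
  obtain ⟨v, hv1, hv2⟩ : ∃ v : ℤ, (∀ x : Fin n, (x : ℕ) < c → v ≤ l x) ∧
      ∀ x : Fin n, ¬ (x : ℕ) < c → l x ≤ v := by
    rcases hB.eq_or_lt with h | h
    · exact ⟨0, fun x _ => h0 x, fun x hx => absurd x.2 (by omega)⟩
    · exact ⟨l ⟨c, h⟩, fun x hx => ha (by simp [Fin.le_def]; omega),
        fun x hx => ha (by simp [Fin.le_def]; omega)⟩
  have hC : (Finset.univ.filter fun x : Fin n => (x : ℕ) < c).card = c := by
    rw [Fin.card_filter_val_lt]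
    exact min_eq_right hB
  have key : ∑ x ∈ B, (l x - v) ≤ ∑ x ∈ Finset.univ.filter (fun x : Fin n => (x : ℕ) < c), (l x - v) := by
    have hBf : B = Finset.univ.filter (fun x => x ∈ B) := by simp
    rw [hBf, Finset.sum_filter, Finset.sum_filter]
    refine Finset.sum_le_sum fun x _ => ?_
    by_cases hx : (x : ℕ) < c
    · have := hv1 x hx
      split_ifs <;> linarith
    · have := hv2 x hx
      split_ifs <;> linarith
  rw [Finset.sum_sub_distrib, Finset.sum_sub_distrib, Finset.sum_const, Finset.sum_const, hC,
    ← hc] at key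
  rw [Finset.sum_congr rfl fun x _ => abs_of_nonneg (h0 x), psum]
  linarith

theorem psum_le_of_absLE {n : ℕ} {l m : Weight n} (hm : IsDominant m) (h : AbsLE l m)
    {i : ℕ} (hi : i ≤ n) : psum l i ≤ psum m i := by
  obtain ⟨B, hB, hle⟩ := h (Finset.univ.filter fun x : Fin n => (x : ℕ) < i)
  rw [Fin.card_filter_val_lt, min_eq_right hi] at hB
  have h1 := sum_le_psum hm B
  rw [hB] at h1
  refine le_trans ?_ (hle.trans h1)
  exact Finset.sum_le_sum fun x _ => le_abs_self _

theorem absLE_of_psum_le {n : ℕ} {l m : Weight n} (hl : IsDominant l) (hm : IsDominant m)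
    (h : ∀ i, i ≤ n → psum l i ≤ psum m i) : AbsLE l m := by
  intro A
  have hA : A.card ≤ n := by simpa using A.card_le_univ
  refine ⟨Finset.univ.filter fun x : Fin n => (x : ℕ) < A.card, ?_, ?_⟩
  · rw [Fin.card_filter_val_lt, min_eq_right hA]
  · rw [Finset.sum_congr rfl fun x _ => abs_of_nonneg ((isDominant_iff.1 hm).2 x)]
    exact (sum_le_psum hl A).trans (h _ hA)

/-- Dominant representatives disappear from the order: `AbsLE` is invariant under the Weyl group in
both arguments and is dominance order on dominant weights. Transitivity and antisymmetry become
formal. -/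
theorem precEq_iff {n : ℕ} {l m : Weight n} :
    PrecEq l m ↔ AbsLE l m ∧ (AbsLE m l → DomLE l m) := by
  constructor
  · rintro ⟨lp, mp, hl, dl, hm, dm, h⟩
    rcases h with ⟨h, hne⟩ | ⟨rfl, h⟩
    · refine ⟨(hl.symm.absLE.trans (absLE_of_psum_le dl dm (domLE_iff.1 h))).trans hm.absLE,
        fun h' => absurd ?_ hne⟩
      refine h.antisymm (domLE_iff.2 fun i hi => psum_le_of_absLE dl ?_ hi)
      exact (hm.absLE.trans h').trans hl.symm.absLE
    · exact ⟨hl.symm.absLE.trans hm.absLE, fun _ => h⟩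
  · rintro ⟨h, h'⟩
    obtain ⟨lp, hl, dl⟩ := exists_dominant l
    obtain ⟨mp, hm, dm⟩ := exists_dominant m
    have h1 : DomLE lp mp := domLE_iff.2 fun i hi =>
      psum_le_of_absLE dm ((hl.absLE.trans h).trans hm.symm.absLE) hi
    refine ⟨lp, mp, hl, dl, hm, dm, ?_⟩
    by_cases he : lp = mp
    · subst he
      exact Or.inr ⟨rfl, h' (hm.symm.absLE.trans hl.absLE)⟩
    · exact Or.inl ⟨h1, he⟩

theorem PrecEq.trans {n : ℕ} {l m p : Weight n} (h : PrecEq l m) (h' : PrecEq m p) :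
    PrecEq l p := by
  rw [precEq_iff] at *
  exact ⟨h.1.trans h'.1, fun h2 => (h.2 (h'.1.trans h2)).trans (h'.2 (h2.trans h.1))⟩

theorem PrecEq.antisymm {n : ℕ} {l m : Weight n} (h : PrecEq l m) (h' : PrecEq m l) :
    l = m := by
  rw [precEq_iff] at *
  exact (h.2 h'.1).antisymm (h'.2 h.1)

theorem Prec.trans {n : ℕ} {l m p : Weight n} (h : Prec l m) (h' : Prec m p) : Prec l p :=
  ⟨h.1.trans h'.1, fun e => h.2 (h.1.antisymm (e ▸ h'.1))⟩

theorem Prec.asymm {n : ℕ} {l m : Weight n} (h : Prec l m) : ¬ Prec m l :=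
  fun h' => h.2 (h.1.antisymm h'.1)

/-- Mutual comparability means equal orbits, and the norm is an orbit invariant. Hence a strict drop
of the norm makes a comparison strict. -/
theorem sum_sq_eq_of_absLE {n : ℕ} {l m : Weight n} (h : AbsLE l m) (h' : AbsLE m l) :
    ∑ x, l x ^ 2 = ∑ x, m x ^ 2 := by
  obtain ⟨lp, hl, dl⟩ := exists_dominant l
  obtain ⟨mp, hm, dm⟩ := exists_dominant m
  have e : lp = mp := eq_of_psum_eq fun i hi =>
    (psum_le_of_absLE dm ((hl.absLE.trans h).trans hm.symm.absLE) hi).antisymm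
      (psum_le_of_absLE dl ((hm.absLE.trans h').trans hl.symm.absLE) hi)
  rw [← hl.sum_sq, ← hm.sum_sq, e]

/-- Sums of absolute values are convex, so an interior point of a segment with both ends in one
orbit is bounded by that orbit. The norm is strictly convex, so the interior point lies in a
different, hence smaller, orbit. -/
theorem prec_between_pos {n : ℕ} {l α : Weight n} {N j : ℤ} (hα : α ≠ 0)
    (hN : SameOrbit l (l - N • α)) (h0 : 0 < j) (hj : j < N) : Prec (l - j • α) l := by
  have hsq : ∑ x, (l - j • α) x ^ 2 < ∑ x, l x ^ 2 := by
    have e : ∀ i : ℤ, ∑ x, (l - i • α) x ^ 2 =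
        ∑ x, l x ^ 2 - 2 * i * ∑ x, l x * α x + i ^ 2 * ∑ x, α x ^ 2 := by
      intro i
      rw [Finset.mul_sum, Finset.mul_sum, ← Finset.sum_sub_distrib, ← Finset.sum_add_distrib]
      refine Finset.sum_congr rfl fun x _ => ?_
      simp only [Pi.sub_apply, Pi.smul_apply, smul_eq_mul]
      ring
    have hpos : 0 < ∑ x, α x ^ 2 := by
      obtain ⟨x, hx⟩ := Function.ne_iff.1 hα
      exact Finset.sum_pos' (fun x _ => sq_nonneg _) ⟨x, Finset.mem_univ x, sq_pos_of_ne_zero hx⟩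
    have h1 := hN.sum_sq
    rw [e] at h1
    rw [e]
    -- Equal norms at the two ends give `2⟨l, α⟩ = N ⟨α, α⟩`, so the norm at parameter `j` falls by
    -- `j (N - j) ⟨α, α⟩`.
    have h2 : N * (2 * ∑ x, l x * α x) = N * (N * ∑ x, α x ^ 2) := by linarith
    have h3 := mul_left_cancel₀ (by omega : N ≠ 0) h2
    have h4 : 0 < j * (N - j) * ∑ x, α x ^ 2 :=
      mul_pos (mul_pos h0 (by omega)) hpos
    nlinarith
  have hle : AbsLE (l - j • α) l := by
    intro A
    have h1 : N * ∑ x ∈ A, |(l - j • α) x| ≤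
        (N - j) * ∑ x ∈ A, |l x| + j * ∑ x ∈ A, |(l - N • α) x| := by
      rw [Finset.mul_sum, Finset.mul_sum, Finset.mul_sum, ← Finset.sum_add_distrib]
      refine Finset.sum_le_sum fun x _ => ?_
      have e : N * (l - j • α) x = (N - j) * l x + j * (l - N • α) x := by
        simp only [Pi.sub_apply, Pi.smul_apply, smul_eq_mul]
        ring
      calc N * |(l - j • α) x| = |N * (l - j • α) x| := by
            rw [abs_mul, abs_of_pos (by omega : 0 < N)]
        _ ≤ |(N - j) * l x| + |j * (l - N • α) x| := by rw [e]; exact abs_add_le _ _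
        _ = _ := by rw [abs_mul, abs_mul, abs_of_pos h0, abs_of_pos (by omega : 0 < N - j)]
    obtain ⟨B, hB, e⟩ := hN.sum_abs A
    -- A weighted mean is at most one of its two terms. If the term at `l` does not bound it, the
    -- term at the other end does, and that one is a sum of `|l x|` over the set `B`.
    by_cases h2 : ∑ x ∈ A, |(l - j • α) x| ≤ ∑ x ∈ A, |l x|
    · exact ⟨A, rfl, h2⟩
    · refine ⟨B, hB, ?_⟩
      rw [← e]
      by_contra h3
      rw [not_le] at h2 h3
      have h4 := mul_lt_mul_of_pos_left h2 (by omega : 0 < N - j)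
      have h5 := mul_lt_mul_of_pos_left h3 h0
      linarith
  refine ⟨precEq_iff.2 ⟨hle, fun h => absurd (sum_sq_eq_of_absLE hle h) hsq.ne⟩, fun h => ?_⟩
  rw [h] at hsq
  exact lt_irrefl _ hsq

theorem prec_between {n : ℕ} {l α : Weight n} {N j : ℤ} (hα : α ≠ 0)
    (hN : SameOrbit l (l - N • α)) (h : (0 < j ∧ j < N) ∨ (N < j ∧ j < 0)) :
    Prec (l - j • α) l := by
  rcases h with ⟨h0, h1⟩ | ⟨h1, h0⟩
  · exact prec_between_pos hα hN h0 h1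
  · have := prec_between_pos (l := l) (α := -α) (N := -N) (j := -j) (neg_ne_zero.2 hα)
      (by simpa using hN) (by omega) (by omega)
    simpa using this

/-- Inside one orbit the order is `DomLE`, so subtracting a positive multiple of a positive vector
goes down. -/
theorem prec_reflection {n : ℕ} {l α : Weight n} {N : ℤ} (hα : α ≠ 0) (hα' : DomLE 0 α)
    (hN : SameOrbit l (l - N • α)) (h : 0 < N) : Prec (l - N • α) l := by
  refine ⟨precEq_iff.2 ⟨hN.absLE, fun _ => domLE_iff.2 fun i hi => ?_⟩, fun e => ?_⟩
  · have h1 := domLE_iff.1 hα' i hi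
    have h2 : psum (N • α) i = N * psum α i := by simp [psum, Finset.mul_sum]
    rw [psum_sub, h2]
    have h3 : psum (0 : Weight n) i = 0 := by simp [psum]
    rw [h3] at h1
    nlinarith
  · apply hα
    have : N • α = 0 := by simpa using e
    exact (smul_eq_zero.1 this).resolve_left (by omega)

theorem finite_prec {n : ℕ} (l : Weight n) : {m | Prec m l}.Finite := by
  refine (Set.finite_Icc (fun _ => -∑ x, |l x| : Weight n) (fun _ => ∑ x, |l x|)).subset ?_
  intro m hm
  have : ∀ x, |m x| ≤ ∑ x, |l x| := fun x => by
    obtain ⟨B, _, hB⟩ := (precEq_iff.1 hm.1).1 {x}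
    rw [Finset.sum_singleton] at hB
    exact hB.trans (Finset.sum_le_sum_of_subset_of_nonneg (Finset.subset_univ _)
      fun _ _ _ => abs_nonneg _)
  exact ⟨fun x => (abs_le.1 (this x)).1, fun x => (abs_le.1 (this x)).2⟩

/-! ### The operators `T_i` on monomials -/

/-- The multiple of the co-root by which `s_i` shifts a weight. -/
def shift (n i : ℕ) (l : Weight n) : ℤ :=
  (if i = 0 ∨ i = n then 2 else 1) * (l ⬝ᵥ (simpleCoroot n i).1)

theorem simpleRoot_eq_smul (n i : ℕ) :
    simpleRoot n i = (if i = 0 ∨ i = n then 2 else 1 : ℤ) • simpleCoroot n i := by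
  split_ifs with h
  · exact root_eq_two_smul_coroot h
  · push Not at h
    rw [one_smul, simpleRoot, simpleCoroot, if_neg h.1, if_neg h.2, if_neg h.1, if_neg h.2]

/-- The action of `s_i` on the weight lattice. -/
def refl (n i : ℕ) (l : Weight n) : Weight n := (reflect n i (l, 0)).1

theorem refl_eq (n i : ℕ) (l : Weight n) :
    refl n i l = l - shift n i l • (simpleCoroot n i).1 := by
  rw [refl, reflect, shift, simpleRoot_eq_smul, smul_smul, mul_comm]
  rfl

theorem refl_dot {n i : ℕ} (hn : 1 ≤ n) (hi : i ≤ n) (l : Weight n) :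
    refl n i l ⬝ᵥ (simpleCoroot n i).1 = -(l ⬝ᵥ (simpleCoroot n i).1) := by
  rw [refl, reflect_dot, cartan_self hn hi]
  ring

theorem shift_refl {n i : ℕ} (hn : 1 ≤ n) (hi : i ≤ n) (l : Weight n) :
    shift n i (refl n i l) = -shift n i l := by
  rw [shift, refl_dot hn hi, shift, mul_neg]

theorem refl_refl {n i : ℕ} (hn : 1 ≤ n) (hi : i ≤ n) (l : Weight n) :
    refl n i (refl n i l) = l := by
  rw [refl_eq, shift_refl hn hi, refl_eq]
  module

theorem shift_pos_iff {n i : ℕ} {l : Weight n} :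
    0 < shift n i l ↔ 0 < l ⬝ᵥ (simpleCoroot n i).1 := by
  rw [shift]; split_ifs <;> omega

theorem shift_neg_iff {n i : ℕ} {l : Weight n} :
    shift n i l < 0 ↔ l ⬝ᵥ (simpleCoroot n i).1 < 0 := by
  rw [shift]; split_ifs <;> omega

/-- `j` lies strictly between `0` and `N`. -/
def StrictBtw (N j : ℤ) : Prop := (0 < j ∧ j < N) ∨ (N < j ∧ j < 0)

/-- The span of the monomials strictly between `x^l` and `x^{s_i l}`. -/
noncomputable def between (n i : ℕ) (l : Weight n) : Submodule ℂ (LaurentAlg n) :=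
  Submodule.span ℂ {f | ∃ j : ℤ, StrictBtw (shift n i l) j ∧
    f = AddMonoidAlgebra.single (l - j • (simpleCoroot n i).1) 1}

theorem mono_eq_smul {n : ℕ} (r : ℂˣ) (β : AffWeight n) :
    mono r β = ((r ^ β.2 : ℂˣ) : ℂ) • (AddMonoidAlgebra.single β.1 1 : LaurentAlg n) := by
  simp [mono]

theorem mono_mem_between {n i : ℕ} (r : ℂˣ) {l : Weight n} {β : AffWeight n} {j : ℤ}
    (hj : StrictBtw (shift n i l) j) (h : β.1 = l - j • (simpleCoroot n i).1) :
    mono r β ∈ between n i l := by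
  rw [mono_eq_smul, h]
  exact Submodule.smul_mem _ _ (Submodule.subset_span ⟨j, hj, rfl⟩)

/-- Multiplied out, the numerator has a middle term at `x^{a_i / 2}` only at the end nodes; `κ = 0`
records its absence for `1 ≤ i < n`. -/
theorem vNum_eq {n : ℕ} (k : Multiplicity) (r : ℂˣ) (i : ℕ) :
    ∃ κ : ℂ, (¬ (i = 0 ∨ i = n) → κ = 0) ∧ vNum k i (mono (n := n) r) =
      1 + κ • mono r (simpleCoroot n i) - (k.root n i : ℂ) ^ 2 • mono r (simpleRoot n i) := by
  unfold vNum
  split_ifs with h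
  · refine ⟨k.root n i * ((k.half n i : ℂ)⁻¹ - k.half n i), fun h' => absurd h h', ?_⟩
    rw [root_eq_two_smul_coroot h, two_smul, mono_add]
    have hu : algebraMap ℂ (LaurentAlg n) (k.half n i) *
        algebraMap ℂ (LaurentAlg n) (k.half n i : ℂ)⁻¹ = 1 := by
      rw [← map_mul, mul_inv_cancel₀ (Units.ne_zero _), map_one]
    simp only [Algebra.smul_def, map_mul, map_sub, map_pow, Units.val_inv_eq_inv_val]
    linear_combination (-algebraMap ℂ (LaurentAlg n) (k.root n i) ^ 2 *
      mono r (simpleCoroot n i) ^ 2) * hu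
  · exact ⟨0, fun _ => rfl, by simp [Algebra.smul_def]⟩

/-- The leading coefficient of `T_i x^l`. -/
noncomputable def leadT (n : ℕ) (k : Multiplicity) (r : ℂˣ) (i : ℕ) (l : Weight n) : ℂˣ :=
  k.root n i ^ (if l ⬝ᵥ (simpleCoroot n i).1 ≤ 0 then 1 else -1 : ℤ) *
    r ^ (-(l ⬝ᵥ (simpleCoroot n i).1 * (simpleRoot n i).2))

theorem mono_reflect {n : ℕ} (r : ℂˣ) (i : ℕ) (l : Weight n) :
    mono r ((l, 0) - (l ⬝ᵥ (simpleCoroot n i).1) • simpleRoot n i) =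
      ((r ^ (-(l ⬝ᵥ (simpleCoroot n i).1 * (simpleRoot n i).2)) : ℂˣ) : ℂ) •
        AddMonoidAlgebra.single (refl n i l) 1 := by
  rw [mono_eq_smul, refl, reflect]
  simp

/-- The divided difference is a string of monomials with step `a_i`. In its product with the
numerator, the terms with step `a_i` give the two end points and interior ones, and the middle term
gives half-steps, all interior. -/
theorem T_single {n : ℕ} (k : Multiplicity) (r : ℂˣ) (i : ℕ) (l : Weight n) :
    ∃ B ∈ between n i l, T n k r i (AddMonoidAlgebra.single l 1) =
      (if l ⬝ᵥ (simpleCoroot n i).1 < 0 then (k.root n i : ℂ) - (k.root n i : ℂ)⁻¹ else 0) •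
        AddMonoidAlgebra.single l 1 +
      (leadT n k r i l : ℂ) • AddMonoidAlgebra.single (refl n i l) 1 + B := by
  obtain ⟨κ, hκ, hv⟩ := vNum_eq (n := n) k r i
  have ht : (k.root n i : ℂ) ≠ 0 := Units.ne_zero _
  set t : ℂ := (k.root n i : ℂ) with htdef
  set m := l ⬝ᵥ (simpleCoroot n i).1 with hm
  set a := simpleRoot n i with ha
  set h := simpleCoroot n i with hh
  set c : ℤ := if i = 0 ∨ i = n then 2 else 1 with hc
  have hsh : shift n i l = c * m := rfl
  have hac : a = c • h := simpleRoot_eq_smul n i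
  have hmul : ∀ γ : AffWeight n, vNum k i (mono r) * mono r γ =
      mono r γ + κ • mono r (h + γ) - t ^ 2 • mono r (a + γ) := by
    intro γ
    rw [hv, mono_add, mono_add, sub_mul, add_mul, one_mul, smul_mul_assoc, smul_mul_assoc]
  have hT : T n k r i (AddMonoidAlgebra.single l 1) = t • mono r (l, 0) -
      t⁻¹ • (vNum k i (mono r) * divDiff n r i (AddMonoidAlgebra.single l 1)) := by
    simp [T, single_eq_mono r, htdef]
  have hlead : (leadT n k r i l : ℂ) • AddMonoidAlgebra.single (refl n i l) (1 : ℂ) =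
      (if m ≤ 0 then t else t⁻¹) • mono r ((l, 0) - m • a) := by
    rw [mono_reflect, smul_smul, leadT]
    congr 1
    push_cast
    split_ifs <;> simp [htdef]
  rw [hlead, hT, divDiff_single, single_eq_mono r]
  have hcs : c = 1 ∨ c = 2 := by rw [hc]; split_ifs <;> simp
  -- Half-steps occur only when `a_i = 2 a_i^∨` as stored here, that is `c = 2`; for `c = 1` the
  -- coefficient `κ` is zero and no position has to be checked.
  have hκm : ∀ (β : AffWeight n) (j : ℤ), (c = 2 → StrictBtw (shift n i l) j) →
      β.1 = l - j • h.1 → κ • mono r β ∈ between n i l := by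
    intro β j hj hβ
    by_cases hi : i = 0 ∨ i = n
    · exact Submodule.smul_mem _ _ (mono_mem_between r (hj (by rw [hc, if_pos hi])) hβ)
    · rw [hκ hi, zero_smul]; exact Submodule.zero_mem _
  rcases lt_trichotomy m 0 with h0 | h0 | h0
  · obtain ⟨M, hM⟩ : ∃ M : ℕ, m = -(M + 1 : ℕ) := ⟨(-m - 1).toNat, by omega⟩
    set R := ∑ j ∈ Finset.range M, mono r ((l, 0) + ((j + 1 : ℕ) : ℤ) • a) with hR
    set S := ∑ j ∈ Finset.range (M + 1), κ • mono r (h + ((l, 0) + (j : ℤ) • a)) with hS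
    have hRm : R ∈ between n i l := by
      refine Submodule.sum_mem _ fun j hj => ?_
      have hj' := Finset.mem_range.1 hj
      refine mono_mem_between r (j := -((j + 1 : ℕ) : ℤ) * c) ?_ ?_
      · right
        rw [hsh, hM]
        rcases hcs with h1 | h1 <;> rw [h1] <;> constructor <;> push_cast <;> omega
      · rw [hac]
        simp only [Prod.fst_add, Prod.smul_fst]
        module
    have hSm : S ∈ between n i l := by
      refine Submodule.sum_mem _ fun j hj => ?_
      have hj' := Finset.mem_range.1 hj
      refine hκm _ (-((j : ℤ) * c + 1)) (fun h1 => Or.inr ?_) ?_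
      · rw [hsh, hM, h1]
        constructor <;> push_cast <;> omega
      · rw [hac]
        simp only [Prod.fst_add, Prod.smul_fst]
        module
    refine ⟨(t - t⁻¹) • R - t⁻¹ • S, Submodule.sub_mem _ (Submodule.smul_mem _ _ hRm)
      (Submodule.smul_mem _ _ hSm), ?_⟩
    have hnat : (-m).toNat = M + 1 := by omega
    rw [if_neg (by omega), if_pos h0, if_pos h0.le, hnat, Finset.mul_sum]
    simp only [hmul]
    rw [Finset.sum_sub_distrib, Finset.sum_add_distrib, ← hS]
    -- `R` collects the common interior terms: the string itself adds the end point `x^l`, and the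
    -- string shifted by `a_i` adds the other end point.
    have e1 : ∑ j ∈ Finset.range (M + 1), mono r ((l, 0) + (j : ℤ) • a) =
        R + mono r (l, 0) := by
      rw [Finset.sum_range_succ']; simp [hR]
    have e2 : ∑ j ∈ Finset.range (M + 1), t ^ 2 • mono r (a + ((l, 0) + (j : ℤ) • a)) =
        t ^ 2 • (R + mono r ((l, 0) - m • a)) := by
      rw [← Finset.smul_sum, hR, hM, neg_smul, sub_neg_eq_add, ← Finset.sum_range_succ
        (fun j : ℕ => mono r ((l, 0) + ((j + 1 : ℕ) : ℤ) • a))]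
      congr 1
      refine Finset.sum_congr rfl fun j _ => ?_
      congr 1
      push_cast
      module
    rw [e1, e2]
    match_scalars <;> field_simp <;> ring
  · refine ⟨0, Submodule.zero_mem _, ?_⟩
    rw [if_neg (by omega), if_neg (by omega), if_pos (by omega), show (-m).toNat = 0 by omega, h0]
    simp
  · obtain ⟨M, hM⟩ : ∃ M : ℕ, m = (M + 1 : ℕ) := ⟨(m - 1).toNat, by omega⟩
    set R := ∑ j ∈ Finset.range M, mono r ((l, 0) - ((j : ℤ) + 1) • a) with hR
    set S := ∑ j ∈ Finset.range (M + 1), κ • mono r (h + ((l, 0) - ((j : ℤ) + 1) • a)) with hS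
    have hRm : R ∈ between n i l := by
      refine Submodule.sum_mem _ fun j hj => ?_
      have hj' := Finset.mem_range.1 hj
      refine mono_mem_between r (j := ((j + 1 : ℕ) : ℤ) * c) ?_ ?_
      · left
        rw [hsh, hM]
        rcases hcs with h1 | h1 <;> rw [h1] <;> constructor <;> push_cast <;> omega
      · rw [hac]
        simp only [Prod.fst_sub, Prod.smul_fst]
        push_cast
        module
    have hSm : S ∈ between n i l := by
      refine Submodule.sum_mem _ fun j hj => ?_
      have hj' := Finset.mem_range.1 hj
      refine hκm _ (((j : ℤ) + 1) * c - 1) (fun h1 => Or.inl ?_) ?_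
      · rw [hsh, hM, h1]
        constructor <;> push_cast <;> omega
      · rw [hac]
        simp only [Prod.fst_add, Prod.fst_sub, Prod.smul_fst]
        module
    refine ⟨(t⁻¹ - t) • R + t⁻¹ • S, Submodule.add_mem _ (Submodule.smul_mem _ _ hRm)
      (Submodule.smul_mem _ _ hSm), ?_⟩
    have hnat : m.toNat = M + 1 := by omega
    rw [if_pos h0, if_neg (by omega), if_neg (by omega), hnat, mul_neg, Finset.mul_sum]
    simp only [hmul]
    rw [Finset.sum_sub_distrib, Finset.sum_add_distrib, ← hS]
    have e1 : ∑ j ∈ Finset.range (M + 1), mono r ((l, 0) - ((j : ℤ) + 1) • a) =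
        R + mono r ((l, 0) - m • a) := by
      rw [Finset.sum_range_succ, hM]; simp [hR]
    have e2 : ∑ j ∈ Finset.range (M + 1), t ^ 2 • mono r (a + ((l, 0) - ((j : ℤ) + 1) • a)) =
        t ^ 2 • (R + mono r (l, 0)) := by
      rw [← Finset.smul_sum, hR, Finset.sum_range_succ']
      congr 2
      · refine Finset.sum_congr rfl fun j _ => ?_
        congr 1
        push_cast
        module
      · congr 1
        push_cast
        module
    rw [e1, e2]
    match_scalars <;> field_simp <;> ring

/-! ### Coordinates of reflected weights -/

/-- The `x`-th coordinate, `1 ≤ x ≤ n`. -/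
def crd {n : ℕ} (l : Weight n) (x : ℕ) : ℤ := l ⬝ᵥ eps n x

theorem crd_succ {n : ℕ} (l : Weight n) (y : Fin n) : crd l (y + 1) = l y := by
  rw [crd, dot_eps l (by omega) (by omega)]
  rfl

theorem crd_ext {n : ℕ} {l m : Weight n} (h : ∀ x, 1 ≤ x → x ≤ n → crd l x = crd m x) :
    l = m := by
  ext y
  rw [← crd_succ l y, ← crd_succ m y]
  exact h _ (by omega) (by omega)

theorem crd_add {n : ℕ} (l m : Weight n) (x : ℕ) : crd (l + m) x = crd l x + crd m x :=
  add_dotProduct _ _ _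

theorem crd_sub {n : ℕ} (l m : Weight n) (x : ℕ) : crd (l - m) x = crd l x - crd m x :=
  sub_dotProduct _ _ _

theorem crd_neg {n : ℕ} (l : Weight n) (x : ℕ) : crd (-l) x = -crd l x :=
  neg_dotProduct _ _

theorem crd_smul {n : ℕ} (c : ℤ) (l : Weight n) (x : ℕ) : crd (c • l) x = c * crd l x :=
  smul_dotProduct _ _ _

theorem crd_eps {n j x : ℕ} : crd (eps n j) x = if j = x ∧ 1 ≤ j ∧ j ≤ n then 1 else 0 :=
  eps_dot' n j x

theorem dot_coroot_zero {n : ℕ} (l : Weight n) :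
    l ⬝ᵥ (simpleCoroot n 0).1 = -crd l 1 := by
  rw [simpleCoroot_zero, dotProduct_neg]; rfl

theorem dot_coroot_last {n : ℕ} (hn : 1 ≤ n) (l : Weight n) :
    l ⬝ᵥ (simpleCoroot n n).1 = crd l n := by
  rw [simpleCoroot_last hn]; rfl

theorem dot_coroot_mid {n i : ℕ} (h1 : 1 ≤ i) (h2 : i < n) (l : Weight n) :
    l ⬝ᵥ (simpleCoroot n i).1 = crd l i - crd l (i + 1) := by
  rw [simpleCoroot_mid h1 h2, dotProduct_sub]; rfl

theorem crd_refl_zero {n x : ℕ} (hn : 1 ≤ n) (l : Weight n) :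
    crd (refl n 0 l) x = if x = 1 then -crd l x else crd l x := by
  rw [refl_eq, shift, if_pos (Or.inl rfl), dot_coroot_zero, simpleCoroot_zero, crd_sub, crd_smul,
    crd_neg, crd_eps]
  split_ifs <;> first | omega | (subst_vars; ring)

theorem crd_refl_last {n x : ℕ} (hn : 1 ≤ n) (l : Weight n) :
    crd (refl n n l) x = if x = n then -crd l x else crd l x := by
  rw [refl_eq, shift, if_pos (Or.inr rfl), dot_coroot_last hn, simpleCoroot_last hn, crd_sub,
    crd_smul, crd_eps]
  split_ifs <;> first | omega | (subst_vars; ring)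

theorem crd_refl_mid {n i x : ℕ} (h1 : 1 ≤ i) (h2 : i < n) (l : Weight n) :
    crd (refl n i l) x =
      if x = i then crd l (i + 1) else if x = i + 1 then crd l i else crd l x := by
  rw [refl_eq, shift, if_neg (by omega), dot_coroot_mid h1 h2, simpleCoroot_mid h1 h2, crd_sub,
    crd_smul, crd_sub, crd_eps, crd_eps]
  split_ifs <;> first | omega | (subst_vars; ring)

theorem SameOrbit.refl {n : ℕ} (l : Weight n) : SameOrbit l l := ⟨1, fun _ => 1, by simp⟩

theorem SameOrbit.trans {n : ℕ} {l m p : Weight n} (h : SameOrbit l m) (h' : SameOrbit m p) :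
    SameOrbit l p := by
  obtain ⟨σ, s, h⟩ := h
  obtain ⟨τ, s', h'⟩ := h'
  refine ⟨τ.trans σ, fun j => s' j * s (τ j), fun j => ?_⟩
  rw [h', h, Units.val_mul, mul_assoc]
  rfl

theorem sameOrbit_refl {n i : ℕ} (hn : 1 ≤ n) (hi : i ≤ n) (l : Weight n) :
    SameOrbit l (refl n i l) := by
  rcases Nat.eq_zero_or_pos i with rfl | h0
  · refine ⟨1, fun y => if (y : ℕ) + 1 = 1 then -1 else 1, fun y => ?_⟩
    rw [← crd_succ (refl n 0 l) y, crd_refl_zero hn, crd_succ]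
    dsimp only
    split_ifs <;> simp
  rcases hi.eq_or_lt with rfl | h
  · refine ⟨1, fun y => if (y : ℕ) + 1 = i then -1 else 1, fun y => ?_⟩
    rw [← crd_succ (refl i i l) y, crd_refl_last hn, crd_succ]
    dsimp only
    split_ifs <;> simp
  · refine ⟨Equiv.swap ⟨i - 1, by omega⟩ ⟨i, h⟩, fun _ => 1, fun y => ?_⟩
    have e1 : crd l (i + 1) = l ⟨i, h⟩ := crd_succ l ⟨i, h⟩
    have e2 : crd l i = l ⟨i - 1, by omega⟩ := by
      rw [← crd_succ l ⟨i - 1, _⟩]; congr 1; simp only; omega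
    rw [← crd_succ (refl n i l) y, crd_refl_mid h0 h, crd_succ, e1, e2, Equiv.swap_apply_def]
    simp only [Fin.ext_iff, Units.val_one, one_mul]
    split_ifs <;> first | rfl | omega

/-- Here `α` is the pull-back of `a_i^∨` under `v`: reflecting after `v` amounts to translating
along `α` before it. -/
theorem smul_dotCoroot_shift {n i : ℕ} (l α : Weight n) (v : Weight n → Weight n)
    (hα : ∀ (l : Weight n) (j : ℤ), v (l - j • α) = v l - j • (simpleCoroot n i).1) :
    refl n i (v l) = v (l - shift n i (v l) • α) := by
  rw [hα, refl_eq]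

/-! ### Triangular operators -/

/-- The span of the monomials below `x^l`. -/
noncomputable def lower {n : ℕ} (l : Weight n) : Submodule ℂ (LaurentAlg n) :=
  Submodule.span ℂ {f | ∃ m, Prec m l ∧ f = AddMonoidAlgebra.single m 1}

theorem single_mem_lower {n : ℕ} {l m : Weight n} (h : Prec m l) :
    (AddMonoidAlgebra.single m 1 : LaurentAlg n) ∈ lower l :=
  Submodule.subset_span ⟨m, h, rfl⟩

theorem lower_mono {n : ℕ} {l m : Weight n} (h : Prec m l) : lower m ≤ lower l := by
  refine Submodule.span_le.2 ?_
  rintro _ ⟨p, hp, rfl⟩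
  exact single_mem_lower (hp.trans h)

/-- The operator `A` sends `x^{v l}` to `D l x^l` plus lower terms, where `v` permutes the orbits
of the Weyl group. -/
structure Tri {n : ℕ} (A : (Module.End ℂ (LaurentAlg n))ˣ) (v : Weight n → Weight n)
    (D : Weight n → ℂˣ) : Prop where
  orbit : ∀ l, SameOrbit l (v l)
  lead : ∀ l, (A : Module.End ℂ (LaurentAlg n)) (AddMonoidAlgebra.single (v l) 1) -
    (D l : ℂ) • AddMonoidAlgebra.single l 1 ∈ lower l

section Tri

variable {n : ℕ} {A : (Module.End ℂ (LaurentAlg n))ˣ} {v : Weight n → Weight n}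
  {D : Weight n → ℂˣ}

theorem Tri.apply_mem (h : Tri A v D) {l m : Weight n} (hm : Prec m l) :
    (A : Module.End ℂ (LaurentAlg n)) (AddMonoidAlgebra.single (v m) 1) ∈ lower l := by
  have h1 := lower_mono hm (h.lead m)
  have h2 := Submodule.add_mem _ h1 (Submodule.smul_mem _ (D m : ℂ) (single_mem_lower hm))
  rwa [sub_add_cancel] at h2

variable {i : ℕ} {α : Weight n}

theorem Tri.sameOrbit (h : Tri A v D) (hn : 1 ≤ n) (hi : i ≤ n)
    (hα : ∀ (l : Weight n) (j : ℤ), v (l - j • α) = v l - j • (simpleCoroot n i).1)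
    (l : Weight n) : SameOrbit l (l - shift n i (v l) • α) := by
  refine ((h.orbit l).trans (sameOrbit_refl hn hi (v l))).trans ?_
  rw [smul_dotCoroot_shift l α v hα]
  exact (h.orbit _).symm

theorem ne_zero_of_shift (hn : 1 ≤ n) (hi : i ≤ n)
    (hα : ∀ (l : Weight n) (j : ℤ), v (l - j • α) = v l - j • (simpleCoroot n i).1) : α ≠ 0 := by
  rintro rfl
  have h := hα 0 1
  simp only [smul_zero, sub_zero, one_smul] at h
  apply simpleCoroot_fst_ne_zero hn hi
  simpa using h.symm

/-- Since `s_i (v l) - j a_i^∨ = v (l - (N + j) α)` with `N` the shift of `v l`, the monomials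
strictly between pull back to points strictly between `l` and `l - N α`, which are lower. -/
theorem Tri.apply_between (h : Tri A v D) (hn : 1 ≤ n) (hi : i ≤ n)
    (hα : ∀ (l : Weight n) (j : ℤ), v (l - j • α) = v l - j • (simpleCoroot n i).1)
    {l : Weight n} {B : LaurentAlg n} (hB : B ∈ between n i (refl n i (v l))) :
    (A : Module.End ℂ (LaurentAlg n)) B ∈ lower l := by
  have : between n i (refl n i (v l)) ≤
      (lower l).comap (A : Module.End ℂ (LaurentAlg n)) := by
    refine Submodule.span_le.2 ?_
    rintro _ ⟨j, hj, rfl⟩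
    have e : refl n i (v l) - j • (simpleCoroot n i).1 = v (l - (shift n i (v l) + j) • α) := by
      rw [hα, refl_eq]; module
    rw [e]
    refine h.apply_mem (prec_between (ne_zero_of_shift hn hi hα) (h.sameOrbit hn hi hα l) ?_)
    rw [StrictBtw, shift_refl hn hi] at hj
    omega
  exact this hB

theorem Tri.apply_refl (h : Tri A v D) (hn : 1 ≤ n) (hi : i ≤ n)
    (hα : ∀ (l : Weight n) (j : ℤ), v (l - j • α) = v l - j • (simpleCoroot n i).1)
    {l : Weight n} (hp : (DomLE 0 α ∧ 0 < shift n i (v l)) ∨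
      (DomLE 0 (-α) ∧ shift n i (v l) < 0)) :
    (A : Module.End ℂ (LaurentAlg n)) (AddMonoidAlgebra.single (refl n i (v l)) 1) ∈ lower l := by
  have h0 := ne_zero_of_shift hn hi hα
  have ho := h.sameOrbit hn hi hα l
  rw [smul_dotCoroot_shift l α v hα]
  refine h.apply_mem ?_
  rcases hp with ⟨h1, h2⟩ | ⟨h1, h2⟩
  · exact prec_reflection h0 h1 ho h2
  · have := prec_reflection (l := l) (N := -shift n i (v l)) (neg_ne_zero.2 h0) h1 (by simpa using ho)
      (by omega)
    simpa using this

/-- Apply `A` to `T_i x^{s_i (v l)}`. The term at `x^{v l}` gives the diagonal entry. The term at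
`x^{s_i (v l)}` is present only when the shift `N` of `v l` is positive, and it then pulls back to
`l - N α`, below `l` because `α` is positive. -/
theorem Tri.mul_T (h : Tri A v D) (k : Multiplicity) (r : ℂˣ) (hn : 1 ≤ n) (hi : i ≤ n)
    (hα : ∀ (l : Weight n) (j : ℤ), v (l - j • α) = v l - j • (simpleCoroot n i).1)
    (hpos : DomLE 0 α) :
    Tri (A * TUnit n k r i) (fun l => refl n i (v l)) (fun l => D l *
      (k.root n i ^ sgn (v l ⬝ᵥ (simpleCoroot n i).1) *
        r ^ (v l ⬝ᵥ (simpleCoroot n i).1 * (simpleRoot n i).2))) where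
  orbit l := (h.orbit l).trans (sameOrbit_refl hn hi _)
  lead l := by
    obtain ⟨B, hB, e⟩ := T_single k r i (refl n i (v l))
    have hL : leadT n k r i (refl n i (v l)) =
        k.root n i ^ sgn (v l ⬝ᵥ (simpleCoroot n i).1) *
        r ^ (v l ⬝ᵥ (simpleCoroot n i).1 * (simpleRoot n i).2) := by
      rw [leadT, refl_dot hn hi, sgn]
      congr 2
      · simp
      · ring
    rw [← hL, Units.val_mul, Module.End.mul_apply]
    show (A : Module.End ℂ (LaurentAlg n)) (T n k r i _) - _ ∈ _
    rw [e, refl_refl hn hi, map_add, map_add, map_smul, map_smul, refl_dot hn hi]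
    have h1 := h.apply_between hn hi hα hB
    have h2 := Submodule.smul_mem _ (leadT n k r i (refl n i (v l)) : ℂ) (h.lead l)
    have h3 : (if -(v l ⬝ᵥ (simpleCoroot n i).1) < 0 then
        (k.root n i : ℂ) - (k.root n i : ℂ)⁻¹ else 0) •
        (A : Module.End ℂ (LaurentAlg n)) (AddMonoidAlgebra.single (refl n i (v l)) 1) ∈
          lower l := by
      split_ifs with hneg
      · refine Submodule.smul_mem _ _ (h.apply_refl hn hi hα (Or.inl ⟨hpos, ?_⟩))
        rw [shift_pos_iff]; omega
      · rw [zero_smul]; exact Submodule.zero_mem _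
    convert Submodule.add_mem _ (Submodule.add_mem _ h1 h2) h3 using 1
    rw [Units.val_mul]
    module

/-- From `T_i⁻¹ = T_i - (t_i - t_i⁻¹)`, the term at `x^{s_i (v l)}` cancels for positive pairing `M`
and remains for negative `M`. Hence `α` must now be negative. The sign function is taken at `-M`
because at `M = 0` the exponent is `-1`. -/
theorem Tri.mul_T_inv (h : Tri A v D) (k : Multiplicity) (r : ℂˣ) (hn : 1 ≤ n) (hi : i ≤ n)
    (hα : ∀ (l : Weight n) (j : ℤ), v (l - j • α) = v l - j • (simpleCoroot n i).1)
    (hpos : DomLE 0 (-α)) :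
    Tri (A * (TUnit n k r i)⁻¹) (fun l => refl n i (v l)) (fun l => D l *
      (k.root n i ^ (-sgn (-(v l ⬝ᵥ (simpleCoroot n i).1))) *
        r ^ (v l ⬝ᵥ (simpleCoroot n i).1 * (simpleRoot n i).2))) where
  orbit l := (h.orbit l).trans (sameOrbit_refl hn hi _)
  lead l := by
    obtain ⟨B, hB, e⟩ := T_single k r i (refl n i (v l))
    set M := v l ⬝ᵥ (simpleCoroot n i).1 with hM
    set c := (k.root n i ^ (-sgn (-M)) * r ^ (M * (simpleRoot n i).2)) with hc
    set p := (k.root n i : ℂ) - (k.root n i : ℂ)⁻¹ with hp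
    rw [Units.val_mul, Module.End.mul_apply]
    show (A : Module.End ℂ (LaurentAlg n)) ((T n k r i - p • 1) _) - _ ∈ _
    rw [LinearMap.sub_apply, e, refl_refl hn hi, refl_dot hn hi, ← hM, LinearMap.smul_apply,
      Module.End.one_apply]
    have h1 := h.apply_between hn hi hα hB
    have h2 := Submodule.smul_mem _ (c : ℂ) (h.lead l)
    have hL : leadT n k r i (refl n i (v l)) =
        k.root n i ^ (if 0 ≤ M then 1 else -1 : ℤ) * r ^ (M * (simpleRoot n i).2) := by
      rw [leadT, refl_dot hn hi, ← hM]
      congr 2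
      · simp
      · ring
    rw [hL]
    rcases lt_trichotomy M 0 with h0 | h0 | h0
    · have h3 := Submodule.smul_mem _ (-p) (h.apply_refl hn hi hα (l := l) (Or.inr ⟨hpos,
        by rw [shift_neg_iff]; omega⟩))
      have hcL : k.root n i ^ (if 0 ≤ M then 1 else -1 : ℤ) * r ^ (M * (simpleRoot n i).2) = c := by
        rw [hc, if_neg (by omega), sgn, if_pos (by omega)]
      rw [hcL, if_neg (by omega)]
      convert Submodule.add_mem _ (Submodule.add_mem _ h1 h2) h3 using 1
      simp only [map_add, map_sub, map_smul, Units.val_mul]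
      module
    -- On the wall the two monomials coincide, and the subtracted multiple changes the diagonal
    -- entry from `t_i` to `t_i⁻¹`.
    · have hs : refl n i (v l) = v l := by
        rw [refl_eq, shift, ← hM, h0, mul_zero, zero_smul, sub_zero]
      have hcL : ((k.root n i ^ (if 0 ≤ M then 1 else -1 : ℤ) *
          r ^ (M * (simpleRoot n i).2) : ℂˣ) : ℂ) = c + p := by
        rw [hc, h0, sgn]; simp [hp]
      rw [hcL, hs, if_neg (by omega)]
      convert Submodule.add_mem _ h1 h2 using 1
      simp only [map_add, map_sub, map_smul, Units.val_mul]
      module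
    · have hcL : k.root n i ^ (if 0 ≤ M then 1 else -1 : ℤ) * r ^ (M * (simpleRoot n i).2) = c := by
        rw [hc, if_pos (by omega), sgn, if_neg (by omega), neg_neg]
      rw [hcL, if_pos (by omega)]
      convert Submodule.add_mem _ h1 h2 using 1
      simp only [map_add, map_sub, map_smul, Units.val_mul]
      module

end Tri

/-! ### Triangularity of the operators `Y_i` -/

/-- The position in the original word of the `x`-th letter of the word in which the `i`-th letter
was moved to position `p`. -/
def srcIdx (i p x : ℕ) : ℕ :=
  if x = p then i else if i ≤ x ∧ x < p then x + 1 else if p < x ∧ x ≤ i then x - 1 else x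

/-- The weight obtained by moving the `i`-th coordinate to position `p` and multiplying it
by `s`. -/
def moveLetter {n : ℕ} (i p : ℕ) (s : ℤ) (l : Weight n) : Weight n :=
  fun y => (if (y : ℕ) + 1 = p then s else 1) * crd l (srcIdx i p (y + 1))

theorem crd_moveLetter {n i p x : ℕ} {s : ℤ} {l : Weight n} (h1 : 1 ≤ x) (hx : x ≤ n) :
    crd (moveLetter i p s l) x = (if x = p then s else 1) * crd l (srcIdx i p x) := by
  obtain ⟨m, rfl⟩ : ∃ m, x = m + 1 := ⟨x - 1, by omega⟩
  exact crd_succ (moveLetter i p s l) ⟨m, hx⟩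

theorem moveLetter_self {n i : ℕ} (l : Weight n) : moveLetter i i 1 l = l := by
  refine crd_ext fun x h1 hx => ?_
  rw [crd_moveLetter h1 hx, srcIdx]
  split_ifs <;> first | omega | simp_all

/-- This supplies the hypothesis on `v` in the product lemmas: with `β = a_p^∨`, the vector `α` is
the positive or negative root that the next factor of the word sees. -/
theorem moveLetter_sub_smul {n i p : ℕ} {s : ℤ} {α β : Weight n}
    (h : ∀ x, 1 ≤ x → x ≤ n →
      (if x = p then s else 1) * crd α (srcIdx i p x) = crd β x) (l : Weight n) (j : ℤ) :
    moveLetter i p s (l - j • α) = moveLetter i p s l - j • β := by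
  refine crd_ext fun x h1 hx => ?_
  rw [crd_moveLetter h1 hx, crd_sub, crd_smul, crd_sub, crd_smul, crd_moveLetter h1 hx,
    ← h x h1 hx]
  ring

theorem refl_moveLetter_up {n i p : ℕ} {s : ℤ} (h1 : 1 ≤ p) (hp : p < n) (l : Weight n) :
    refl n p (moveLetter i p s l) = moveLetter i (p + 1) s l := by
  refine crd_ext fun x hx hxn => ?_
  rw [crd_refl_mid h1 hp, crd_moveLetter (by omega) (by omega), crd_moveLetter h1 (by omega),
    crd_moveLetter hx hxn, crd_moveLetter hx hxn]
  simp only [srcIdx]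
  split_ifs <;> grind

theorem refl_moveLetter_down {n i p : ℕ} {s : ℤ} (h1 : 1 ≤ p) (hp : p < n) (l : Weight n) :
    refl n p (moveLetter i (p + 1) s l) = moveLetter i p s l := by
  rw [← refl_moveLetter_up h1 hp, refl_refl (by omega) hp.le]

theorem refl_moveLetter_last {n i : ℕ} {s : ℤ} (hn : 1 ≤ n) (l : Weight n) :
    refl n n (moveLetter i n s l) = moveLetter i n (-s) l := by
  refine crd_ext fun x hx hxn => ?_
  rw [crd_refl_last hn, crd_moveLetter hx hxn, crd_moveLetter hx hxn]
  split_ifs <;> ring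

theorem refl_moveLetter_zero {n i : ℕ} {s : ℤ} (hn : 1 ≤ n) (l : Weight n) :
    refl n 0 (moveLetter i 1 s l) = moveLetter i 1 (-s) l := by
  refine crd_ext fun x hx hxn => ?_
  rw [crd_refl_zero hn, crd_moveLetter hx hxn, crd_moveLetter hx hxn]
  split_ifs <;> ring

theorem psum_eps_nonneg {n j i : ℕ} : 0 ≤ psum (eps n j) i :=
  Finset.sum_nonneg fun x _ => by simp only [eps]; split_ifs <;> simp

theorem psum_zero {n : ℕ} (i : ℕ) : psum (0 : Weight n) i = 0 := by simp [psum]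

theorem domLE_zero_eps (n i : ℕ) : DomLE 0 (eps n i) :=
  domLE_iff.2 fun x _ => by rw [psum_zero]; exact psum_eps_nonneg

theorem domLE_zero_eps_add (n i j : ℕ) : DomLE 0 (eps n i + eps n j) :=
  domLE_iff.2 fun x _ => by
    have h : psum (eps n i + eps n j) x = psum (eps n i) x + psum (eps n j) x := by
      simp [psum, Finset.sum_add_distrib]
    rw [psum_zero, h]
    exact add_nonneg psum_eps_nonneg psum_eps_nonneg

theorem domLE_zero_eps_sub {n i j : ℕ} (h1 : 1 ≤ i) (hij : i < j) (hj : j ≤ n) :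
    DomLE 0 (eps n i - eps n j) :=
  domLE_iff.2 fun x _ => by
    rw [psum_zero, psum_sub, psum_eps h1 (by omega), psum_eps (by omega) hj]
    split_ifs <;> omega

theorem crd_coroot_mid {n i x : ℕ} (h1 : 1 ≤ i) (h2 : i < n) :
    crd (simpleCoroot n i).1 x = (if x = i then 1 else 0) - (if x = i + 1 then 1 else 0) := by
  rw [simpleCoroot_mid h1 h2, crd_sub, crd_eps, crd_eps]
  split_ifs <;> omega

theorem simpleRoot_mid_snd {n i : ℕ} (h1 : 1 ≤ i) (h2 : i < n) : (simpleRoot n i).2 = 0 := by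
  rw [simpleRoot_mid h1 h2]

theorem root_last {n : ℕ} (hn : 1 ≤ n) (k : Multiplicity) : k.root n n = k.tn := by
  rw [Multiplicity.root, if_neg (by omega), if_pos rfl]

section

variable {n : ℕ} (k : Multiplicity) (r : ℂˣ) {i : ℕ}

theorem Tri.congr {A A' : (Module.End ℂ (LaurentAlg n))ˣ} {v v' : Weight n → Weight n}
    {D D' : Weight n → ℂˣ} (h : Tri A v D) (hA : A = A') (hv : ∀ l, v l = v' l)
    (hD : ∀ l, D l = D' l) : Tri A' v' D' := by
  obtain rfl := hA
  obtain rfl := funext hv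
  obtain rfl := funext hD
  exact h

/-- The letter passes its right neighbours one by one; the roots met are `ε_i - ε_j` with `j > i`,
all positive. -/
theorem tri_up (hi : 1 ≤ i) (d : ℕ) (hd : i + d ≤ n) :
    Tri ((List.range' i d).map (TUnit n k r)).prod (moveLetter i (i + d) 1)
      (fun l => k.t ^ ∑ x ∈ Finset.range d, sgn (crd l i - crd l (i + x + 1))) := by
  induction d with
  | zero =>
    refine ⟨fun l => ?_, fun l => ?_⟩
    · rw [add_zero, moveLetter_self]; exact SameOrbit.refl l
    · simp [moveLetter_self]
  | succ d ih =>
    refine ((ih (by omega)).mul_T k r (i := i + d) (α := eps n i - eps n (i + d + 1)) (by omega)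
      (by omega) (moveLetter_sub_smul fun x hx hxn => ?_)
      (domLE_zero_eps_sub hi (by omega) (by omega))).congr ?_ (fun l => ?_) (fun l => ?_)
    · rw [crd_coroot_mid (by omega) (by omega), crd_sub, crd_eps, crd_eps]
      simp only [srcIdx]
      split_ifs <;> grind
    · rw [List.range'_concat]; simp
    · rw [refl_moveLetter_up (by omega) (by omega)]; rfl
    · rw [simpleRoot_mid_snd (by omega) (by omega), mul_zero, zpow_zero, mul_one,
        root_mid k (by omega) (by omega), ← zpow_add, Finset.sum_range_succ,
        dot_coroot_mid (by omega) (by omega), crd_moveLetter (by omega) (by omega),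
        crd_moveLetter (by omega) (by omega)]
      simp [srcIdx]

theorem tri_last (hn : 1 ≤ n) {A : (Module.End ℂ (LaurentAlg n))ˣ} {D : Weight n → ℂˣ}
    (hi : 1 ≤ i) (hin : i ≤ n) (h : Tri A (moveLetter i n 1) D) :
    Tri (A * TUnit n k r n) (moveLetter i n (-1)) (fun l => D l * k.tn ^ sgn (crd l i)) := by
  refine (h.mul_T k r (i := n) (α := eps n i) hn le_rfl
    (moveLetter_sub_smul fun x hx hxn => ?_) (domLE_zero_eps n i)).congr rfl (fun l => ?_)
    (fun l => ?_)
  · rw [simpleCoroot_last hn, crd_eps, crd_eps]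
    simp only [srcIdx]
    split_ifs <;> grind
  · rw [refl_moveLetter_last hn]
  · rw [simpleRoot_last hn, mul_zero, zpow_zero, mul_one, root_last hn, dot_coroot_last hn,
      crd_moveLetter hn le_rfl]
    simp [srcIdx]

/-- With its sign reversed the letter passes all other letters on the way to position 1, meeting
`ε_i + ε_j` for each `j ≠ i`; at positions from `i` on, the index `j` is one larger than the
position because the letter was removed. The final `T_0` restores the sign and contributes the power
of `q`. -/
theorem tri_down (hn : 1 ≤ n) (hi : 1 ≤ i) (hin : i ≤ n) (j : ℕ) (hj : j + 1 ≤ n)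
    {A : (Module.End ℂ (LaurentAlg n))ˣ} {D : Weight n → ℂˣ}
    (h : Tri A (moveLetter i (j + 1) (-1)) D) :
    Tri (A * ((List.range (j + 1)).reverse.map (TUnit n k r)).prod) (moveLetter i 1 1)
      (fun l => D l * (k.t ^ (∑ x ∈ Finset.range j,
        sgn (crd l i + crd l (if i ≤ x + 1 then x + 2 else x + 1))) *
          (k.t0 ^ sgn (crd l i) * (r ^ 2) ^ crd l i))) := by
  induction j generalizing A D with
  | zero =>
    refine (h.mul_T k r (i := 0) (α := eps n i) hn (by omega)
      (moveLetter_sub_smul fun x hx hxn => ?_) (domLE_zero_eps n i)).congr ?_ (fun l => ?_)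
      (fun l => ?_)
    · rw [simpleCoroot_zero, crd_neg, crd_eps, crd_eps]
      simp only [srcIdx]
      split_ifs <;> grind
    · simp
    · rw [zero_add, refl_moveLetter_zero hn, neg_neg]
    · have e : moveLetter i (0 + 1) (-1) l ⬝ᵥ (simpleCoroot n 0).1 = crd l i := by
        rw [dot_coroot_zero, crd_moveLetter le_rfl hn]
        simp [srcIdx]
      rw [e, simpleRoot_zero, zpow_mul', Multiplicity.root, if_pos rfl, Finset.range_zero,
        Finset.sum_empty, zpow_zero, one_mul]
      rfl
  | succ j ih =>
    have h1 := h.mul_T k r (i := j + 1)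
      (α := eps n i + eps n (if i ≤ j + 1 then j + 2 else j + 1)) hn
      (by omega) (moveLetter_sub_smul fun x hx hxn => by
        rw [crd_coroot_mid (by omega) (by omega), crd_add, crd_eps, crd_eps]
        simp only [srcIdx]
        split_ifs <;> grind) (domLE_zero_eps_add _ _ _)
    have h2 := h1.congr (v' := moveLetter i (j + 1) (-1)) rfl
      (fun l => refl_moveLetter_down (by omega) (by omega) l) (fun l => rfl)
    refine (ih (by omega) h2).congr ?_ (fun l => rfl) (fun l => ?_)
    · rw [List.range_succ (n := j + 1)]; simp [mul_assoc]
    · have e : moveLetter i (j + 1 + 1) (-1) l ⬝ᵥ (simpleCoroot n (j + 1)).1 =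
          crd l i + crd l (if i ≤ j + 1 then j + 2 else j + 1) := by
        rw [dot_coroot_mid (by omega) (by omega), crd_moveLetter (by omega) (by omega),
          crd_moveLetter (by omega) (by omega)]
        simp only [srcIdx]
        split_ifs <;> grind
      rw [simpleRoot_mid_snd (by omega) (by omega), mul_zero, zpow_zero, mul_one,
        root_mid k (by omega) (by omega), Finset.sum_range_succ, zpow_add, e]
      ac_rfl

/-- Returning to place `i`, the letter meets `ε_i - ε_j` with `j < i`. These are negative, which is
why the word of `Y_i` ends in inverses. -/
theorem tri_inv (hin : i ≤ n) (d : ℕ) (hd : d + 1 ≤ i)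
    {A : (Module.End ℂ (LaurentAlg n))ˣ} {D : Weight n → ℂˣ}
    (h : Tri A (moveLetter i 1 1) D) :
    Tri (A * ((List.range' 1 d).map fun j => (TUnit n k r j)⁻¹).prod) (moveLetter i (d + 1) 1)
      (fun l => D l * k.t ^ (∑ x ∈ Finset.range d, -sgn (crd l (x + 1) - crd l i))) := by
  induction d with
  | zero => exact h.congr (by simp) (fun l => rfl) (fun l => by simp)
  | succ d ih =>
    refine ((ih (by omega)).mul_T_inv k r (i := d + 1) (α := eps n i - eps n (d + 1)) (by omega)
      (by omega) (moveLetter_sub_smul fun x hx hxn => ?_)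
      (by rw [neg_sub]; exact domLE_zero_eps_sub (by omega) (by omega) hin)).congr
      ?_ (fun l => ?_) (fun l => ?_)
    · rw [crd_coroot_mid (by omega) (by omega), crd_sub, crd_eps, crd_eps]
      simp only [srcIdx]
      split_ifs <;> grind
    · rw [List.range'_concat]; simp [mul_assoc, add_comm]
    · rw [refl_moveLetter_up (by omega) (by omega)]
    · have e : moveLetter i (d + 1) 1 l ⬝ᵥ (simpleCoroot n (d + 1)).1 =
          crd l i - crd l (d + 1) := by
        rw [dot_coroot_mid (by omega) (by omega), crd_moveLetter (by omega) (by omega),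
          crd_moveLetter (by omega) (by omega)]
        simp only [srcIdx]
        split_ifs <;> grind
      rw [simpleRoot_mid_snd (by omega) (by omega), mul_zero, zpow_zero, mul_one,
        root_mid k (by omega) (by omega), Finset.sum_range_succ, zpow_add, e, neg_sub, mul_assoc]

/-- The exponent of `t` in the `i`-th component of the spectral point. -/
def rhoRow (n : ℕ) (l : Weight n) (i : ℕ) : ℤ :=
  ∑ x ∈ Finset.range (n - i), sgn (crd l i - crd l (i + x + 1)) +
    ∑ x ∈ Finset.range (n - 1), sgn (crd l i + crd l (if i ≤ x + 1 then x + 2 else x + 1)) +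
    ∑ x ∈ Finset.range (i - 1), -sgn (crd l (x + 1) - crd l i)

/-- After the full tour the permutation of weights is the identity, so `Y_i` is triangular in the
strict sense with the displayed diagonal. -/
theorem tri_Y (hi : 1 ≤ i) (hin : i ≤ n) :
    Tri (Y n k r i) id (fun l => (k.t0 * k.tn) ^ sgn (crd l i) * k.t ^ rhoRow n l i *
      (r ^ 2) ^ crd l i) := by
  have hn : 1 ≤ n := by omega
  have h1 := tri_up (n := n) k r hi (n - i) (by omega)
  rw [Nat.add_sub_cancel' hin] at h1
  have h2 := tri_last k r hn hi hin h1
  have h3 := tri_down k r hn hi hin (n - 1) (by omega) (by rwa [Nat.sub_add_cancel hn])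
  have h4 := tri_inv k r hin (i - 1) (by omega) h3
  refine h4.congr ?_ (fun l => ?_) (fun l => ?_)
  · rw [Nat.sub_add_cancel hn]; rfl
  · rw [Nat.sub_add_cancel hi, moveLetter_self]; rfl
  · rw [rhoRow, zpow_add, zpow_add, mul_zpow]
    have h : ∀ a b c d e f : ℂˣ, d * b * (e * (a * c)) * f = a * b * (d * e * f) * c := by
      intros; ac_rfl
    exact h _ _ _ _ _ _

end

/-! ### The spectral points -/

theorem sgn_two_mul (m : ℤ) : sgn (2 * m) = sgn m := by
  unfold sgn; split_ifs <;> omega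

theorem rhoL_eq {n : ℕ} (l : Weight n) (j : Fin n) : rhoL l j = sgn (crd l (j + 1)) := by
  rw [rhoL, Finset.sum_apply, Finset.sum_eq_single ((j : ℕ) + 1)]
  · rw [two_mul_eps, dotProduct_smul, smul_eq_mul, sgn_two_mul]
    simp [eps, crd]
  · intro b _ hb
    simp [eps, hb.symm]
  · intro h
    simp at h

/-- A positive root `ε_a ± ε_b` contributes to row `i` only if `a = i` or `b = i`. The first kind
gives the roots met with larger indices; the second kind gives those with smaller indices, where
`ε_a - ε_i` enters with a minus sign. -/
theorem rhoM_eq {n : ℕ} (l : Weight n) (j : Fin n) : rhoM l j = rhoRow n l (j + 1) := by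
  set i := (j : ℕ) + 1 with hi
  have hin : i ≤ n := by omega
  have e : rhoM l j = ∑ a ∈ Finset.Icc 1 n, ((if i = a then ∑ b ∈ Finset.Ioc a n,
      (sgn (crd l a - crd l b) + sgn (crd l a + crd l b)) else 0) +
      (if a < i then sgn (crd l a + crd l i) - sgn (crd l a - crd l i) else 0)) := by
    rw [rhoM, Finset.sum_apply]
    refine Finset.sum_congr rfl fun a ha => ?_
    rw [Finset.sum_apply]
    have h1 : ∀ b, (sgn (l ⬝ᵥ (eps n a - eps n b)) • (eps n a - eps n b) +
        sgn (l ⬝ᵥ (eps n a + eps n b)) • (eps n a + eps n b)) j =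
        (if i = a then sgn (crd l a - crd l b) + sgn (crd l a + crd l b) else 0) +
        (if i = b then sgn (crd l a + crd l b) - sgn (crd l a - crd l b) else 0) := by
      intro b
      rw [dotProduct_sub, dotProduct_add]
      simp only [Pi.add_apply, Pi.sub_apply, Pi.smul_apply, smul_eq_mul, eps, ← hi]
      change sgn (crd l a - crd l b) * _ + sgn (crd l a + crd l b) * _ = _
      split_ifs <;> ring
    rw [Finset.sum_congr rfl fun b _ => h1 b, Finset.sum_add_distrib, Finset.sum_ite_eq]
    congr 1
    · split_ifs <;> simp
    · simp only [Finset.mem_Ioc, hin, and_true]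
  rw [e, Finset.sum_add_distrib, Finset.sum_ite_eq, if_pos (Finset.mem_Icc.2 ⟨by omega, hin⟩),
    ← Finset.sum_filter]
  have e2 : (Finset.Icc 1 n).filter (fun a => a < i) = Finset.Ico 1 i := by
    ext a; simp only [Finset.mem_filter, Finset.mem_Icc, Finset.mem_Ico]; omega
  have e3 : Finset.Ioc i n = Finset.Ico (i + 1) (n + 1) := by
    ext a; simp only [Finset.mem_Ioc, Finset.mem_Ico]; omega
  rw [e2, e3, Finset.sum_Ico_eq_sum_range, Finset.sum_Ico_eq_sum_range, rhoRow,
    show n - 1 = (i - 1) + (n - i) by omega, Finset.sum_range_add,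
    show n + 1 - (i + 1) = n - i by omega, Finset.sum_add_distrib, Finset.sum_sub_distrib,
    Finset.sum_neg_distrib]
  have e4 : ∑ x ∈ Finset.range (n - i), sgn (crd l i - crd l (i + 1 + x)) =
      ∑ x ∈ Finset.range (n - i), sgn (crd l i - crd l (i + x + 1)) :=
    Finset.sum_congr rfl fun x _ => by rw [add_right_comm]
  have e5 : ∑ x ∈ Finset.range (n - i), sgn (crd l i + crd l (i + 1 + x)) =
      ∑ x ∈ Finset.range (n - i), sgn (crd l i + crd l (if i ≤ i - 1 + x + 1 then i - 1 + x + 2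
        else i - 1 + x + 1)) :=
    Finset.sum_congr rfl fun x _ => by
      rw [if_pos (by omega), show i - 1 + x + 2 = i + 1 + x by omega]
  have e6 : ∑ x ∈ Finset.range (i - 1), sgn (crd l (1 + x) + crd l i) =
      ∑ x ∈ Finset.range (i - 1), sgn (crd l i + crd l (if i ≤ x + 1 then x + 2 else x + 1)) :=
    Finset.sum_congr rfl fun x hx => by
      have := Finset.mem_range.1 hx
      rw [if_neg (by omega), add_comm, add_comm 1 x]
  have e7 : ∑ x ∈ Finset.range (i - 1), sgn (crd l (1 + x) - crd l i) =
      ∑ x ∈ Finset.range (i - 1), sgn (crd l (x + 1) - crd l i) :=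
    Finset.sum_congr rfl fun x _ => by rw [add_comm]
  rw [e4, e5, e6, e7]
  ring

theorem gamma_eq {n : ℕ} (k : Multiplicity) (r : ℂˣ) (l : Weight n) (j : Fin n) :
    gamma k r l j = (k.t0 * k.tn) ^ sgn (crd l (j + 1)) * k.t ^ rhoRow n l (j + 1) *
      (r ^ 2) ^ crd l (j + 1) := by
  rw [gamma, rhoL_eq, rhoM_eq, mul_zpow, crd_succ]

theorem Y_sub_mem_lower {n : ℕ} (k : Multiplicity) (r : ℂˣ) (l : Weight n) (j : Fin n) :
    (Y n k r (j + 1) : Module.End ℂ (LaurentAlg n)) (AddMonoidAlgebra.single l 1) -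
      (gamma k r l j : ℂ) • AddMonoidAlgebra.single l 1 ∈ lower l := by
  rw [gamma_eq]
  exact (tri_Y k r (i := j + 1) (by omega) (by omega)).lead l

/-- For equal neighbouring coordinates all contributions to the two rows match except that of `ε_i -
ε_{i+1}` itself. It enters with opposite signs, and `ε(0) = 1`. -/
theorem rhoRow_sub {n i : ℕ} (h1 : 1 ≤ i) (h2 : i < n) (l : Weight n)
    (h : crd l i = crd l (i + 1)) : rhoRow n l i - rhoRow n l (i + 1) = 2 := by
  have e1 : ∑ x ∈ Finset.range (n - i), sgn (crd l i - crd l (i + x + 1)) =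
      ∑ x ∈ Finset.range (n - (i + 1)), sgn (crd l (i + 1) - crd l (i + 1 + x + 1)) + 1 := by
    rw [show n - i = n - (i + 1) + 1 by omega, Finset.sum_range_succ', add_zero, h, sub_self]
    congr 1
    refine Finset.sum_congr rfl fun x _ => ?_
    rw [show i + (x + 1) + 1 = i + 1 + x + 1 by omega]
  have e2 : ∑ x ∈ Finset.range (i + 1 - 1), -sgn (crd l (x + 1) - crd l (i + 1)) =
      ∑ x ∈ Finset.range (i - 1), -sgn (crd l (x + 1) - crd l i) - 1 := by
    rw [show i + 1 - 1 = i - 1 + 1 by omega, Finset.sum_range_succ, Nat.sub_add_cancel h1, h,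
      sub_self]
    rfl
  have e3 : ∑ x ∈ Finset.range (n - 1),
        sgn (crd l i + crd l (if i ≤ x + 1 then x + 2 else x + 1)) =
      ∑ x ∈ Finset.range (n - 1),
        sgn (crd l (i + 1) + crd l (if i + 1 ≤ x + 1 then x + 2 else x + 1)) := by
    refine Finset.sum_congr rfl fun x _ => ?_
    rw [h]
    by_cases hx : x + 1 = i
    · rw [if_pos hx.ge, if_neg (by omega), hx, h, show x + 2 = i + 1 by omega]
    · rw [if_congr (show i ≤ x + 1 ↔ i + 1 ≤ x + 1 by omega) rfl rfl]
  rw [rhoRow, rhoRow, e1, e2, e3]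
  ring

/-- When the last coordinate is 0, the contributions of `ε_x + ε_n` and `ε_x - ε_n` cancel. -/
theorem rhoRow_last {n : ℕ} (hn : 1 ≤ n) (l : Weight n) (h : crd l n = 0) :
    rhoRow n l n = 0 := by
  rw [rhoRow, h, Nat.sub_self, Finset.sum_range_zero, zero_add, ← Finset.sum_add_distrib]
  refine Finset.sum_eq_zero fun x hx => ?_
  have := Finset.mem_range.1 hx
  rw [if_neg (by omega), zero_add, sub_zero, add_neg_cancel]

/-! ### Joint eigenvectors of the operators `Y_i` -/

section

variable {n : ℕ}

/-- The coefficient of `x^m` as a linear functional. -/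
noncomputable def coeffAt (m : Weight n) : LaurentAlg n →ₗ[ℂ] ℂ :=
  Finsupp.lapply m ∘ₗ (AddMonoidAlgebra.coeffLinearEquiv ℂ).toLinearMap

theorem coeffAt_apply (m : Weight n) (f : LaurentAlg n) : coeffAt m f = f.coeff m := rfl

theorem coeffAt_single (m l : Weight n) :
    coeffAt m (AddMonoidAlgebra.single l 1) = if l = m then 1 else 0 := by
  rw [coeffAt_apply, AddMonoidAlgebra.coeff_single, Finsupp.single_apply]

theorem sum_coeff_smul (f : LaurentAlg n) :
    ∑ m ∈ f.coeff.support, f.coeff m • (AddMonoidAlgebra.single m 1 : LaurentAlg n) = f := by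
  conv_rhs => rw [← AddMonoidAlgebra.sum_coeff_single f]
  rw [Finsupp.sum]
  exact Finset.sum_congr rfl fun m _ => by simp

theorem coeffAt_eq_zero_of_mem_lower {l m : Weight n} (h : ¬ Prec m l) {f : LaurentAlg n}
    (hf : f ∈ lower l) : coeffAt m f = 0 := by
  have : lower l ≤ LinearMap.ker (coeffAt m) := by
    refine Submodule.span_le.2 ?_
    rintro _ ⟨p, hp, rfl⟩
    rw [SetLike.mem_coe, LinearMap.mem_ker, coeffAt_single, if_neg]
    rintro rfl
    exact h hp
  exact this hf

theorem not_prec_self (l : Weight n) : ¬ Prec l l := fun h => h.2 rfl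

theorem exists_prec_maximal {s : Finset (Weight n)} (hs : s.Nonempty) :
    ∃ m ∈ s, ∀ p ∈ s, ¬ Prec m p := by
  have : IsStrictOrder (Weight n) (fun a b => Prec b a) :=
    { irrefl := not_prec_self
      trans := fun a b c h h' => h'.trans h }
  have hw := s.finite_toSet.wellFoundedOn (r := fun a b : Weight n => Prec b a)
  obtain ⟨⟨m, hm⟩, _, h⟩ := WellFounded.has_min hw Set.univ
    ⟨⟨hs.choose, hs.choose_spec⟩, Set.mem_univ _⟩
  exact ⟨m, hm, fun p hp h' => h ⟨p, hp⟩ (Set.mem_univ _) h'⟩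

/-- `f` is a joint eigenvector with the eigenvalues `g`. -/
def IsEigen (k : Multiplicity) (r : ℂˣ) (g : Fin n → ℂˣ) (f : LaurentAlg n) : Prop :=
  ∀ j : Fin n, (Y n k r (j + 1) : Module.End ℂ (LaurentAlg n)) f = (g j : ℂ) • f

variable {k : Multiplicity} {r : ℂˣ}

/-- No other monomial of `f` lies above `m`, so by triangularity only the diagonal term of `x^m`
contributes. -/
theorem coeffAt_Y {f : LaurentAlg n} {m : Weight n} (h : ∀ p ∈ f.coeff.support, ¬ Prec m p)
    (j : Fin n) : coeffAt m ((Y n k r (j + 1) : Module.End ℂ (LaurentAlg n)) f) =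
      gamma k r m j * coeffAt m f := by
  rw [← sub_eq_zero]
  conv_lhs => rw [← sum_coeff_smul f]
  simp only [map_sum, map_smul, Finset.mul_sum, ← Finset.sum_sub_distrib]
  refine Finset.sum_eq_zero fun p hp => ?_
  have h1 := coeffAt_eq_zero_of_mem_lower (h p hp) (Y_sub_mem_lower k r p j)
  rw [map_sub, map_smul, coeffAt_single] at h1
  rw [coeffAt_single]
  split_ifs at h1 ⊢ with hpm
  · subst hpm
    simp only [smul_eq_mul] at h1 ⊢
    linear_combination f.coeff p * h1
  · simp only [smul_eq_mul, mul_zero, sub_zero] at h1 ⊢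
    rw [h1, mul_zero]

theorem IsEigen.exists_gamma {g : Fin n → ℂˣ} {f : LaurentAlg n} (h : IsEigen k r g f)
    (hf : f ≠ 0) : ∃ m, coeffAt m f ≠ 0 ∧ g = gamma k r m := by
  have hs : f.coeff.support.Nonempty := by
    by_contra h0
    rw [Finset.not_nonempty_iff_eq_empty, Finsupp.support_eq_empty] at h0
    exact hf (AddMonoidAlgebra.ext h0)
  obtain ⟨m, hm, hmax⟩ := exists_prec_maximal hs
  have hm0 : coeffAt m f ≠ 0 := Finsupp.mem_support_iff.1 hm
  refine ⟨m, hm0, funext fun j => Units.ext ?_⟩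
  have h1 := coeffAt_Y (k := k) (r := r) hmax j
  rw [h j, map_smul, smul_eq_mul] at h1
  exact mul_right_cancel₀ hm0 h1

/-- Only the multiplicative independence of `q` from `t` and `t_0 t_n` is needed; `t` and `t_0 t_n`
may be dependent on each other. -/
theorem q_exponent_eq (hg : IsGeneric k r) {a b c a' b' c' : ℤ}
    (h : (k.t0 * k.tn) ^ a * k.t ^ b * (r ^ 2) ^ c = (k.t0 * k.tn) ^ a' * k.t ^ b' * (r ^ 2) ^ c') :
    c = c' := by
  by_contra hne
  refine hg.q_indep (c - c') (b - b') (a - a') (sub_ne_zero.2 hne) ?_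
  rw [zpow_sub, zpow_sub, zpow_sub]
  have e : ∀ A B C A' B' C' : ℂˣ, A * B * C = A' * B' * C' →
      C * C'⁻¹ * (B * B'⁻¹) * (A * A'⁻¹) = 1 := by
    intro A B C A' B' C' h
    calc C * C'⁻¹ * (B * B'⁻¹) * (A * A'⁻¹) = (A * B * C) * (A'⁻¹ * B'⁻¹ * C'⁻¹) := by ac_rfl
      _ = 1 := by rw [h, ← mul_inv, ← mul_inv, mul_inv_cancel]
  exact e _ _ _ _ _ _ h

theorem gamma_injective (hg : IsGeneric k r) {l m : Weight n}
    (h : gamma k r l = gamma k r m) : l = m := by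
  ext j
  have hj := congrFun h j
  rw [gamma_eq, gamma_eq] at hj
  rw [← crd_succ l j, ← crd_succ m j]
  exact q_exponent_eq hg hj

/-- `S` is a down-closed set of weights carrying the defects `(Y_j - γ_{l,j}) f`. For `m` maximal in
`S`, choose a component `i` separating `γ_l` from `γ_m`. The operator `(Y_i - γ_{m,i}) / (γ_{l,i} -
γ_{m,i})` keeps the leading term and removes `m` from `S`. When `S` is empty, `f` is a joint
eigenvector. -/
theorem exists_isEigen_aux (hn : 2 ≤ n) (hg : IsGeneric k r) (l : Weight n)
    (S : Finset (Weight n)) (hS : ∀ m ∈ S, Prec m l) (hd : ∀ m ∈ S, ∀ p, Prec p m → p ∈ S)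
    (f : LaurentAlg n) (hf : f - AddMonoidAlgebra.single l 1 ∈ lower l)
    (hY : ∀ j : Fin n, (Y n k r (j + 1) : Module.End ℂ (LaurentAlg n)) f - (gamma k r l j : ℂ) • f ∈
      Submodule.span ℂ {f | ∃ m ∈ S, f = AddMonoidAlgebra.single m 1}) :
    ∃ P : LaurentAlg n, P - AddMonoidAlgebra.single l 1 ∈ lower l ∧
      IsEigen k r (gamma k r l) P := by
  induction hc : S.card generalizing S f with
  | zero =>
    rw [Finset.card_eq_zero] at hc
    subst hc
    refine ⟨f, hf, fun j => ?_⟩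
    simpa [sub_eq_zero] using hY j
  | succ c ih =>
    obtain ⟨m, hm, hmax⟩ := exists_prec_maximal (Finset.card_pos.1 (by omega : 0 < S.card))
    obtain ⟨i, hi⟩ : ∃ i, gamma k r l i ≠ gamma k r m i := by
      by_contra! h
      exact (hS m hm).2 (gamma_injective hg (funext h)).symm
    set d : ℂ := (gamma k r l i : ℂ) - gamma k r m i with hd'
    have hd0 : d ≠ 0 := sub_ne_zero.2 fun h => hi (Units.ext h)
    set B : Module.End ℂ (LaurentAlg n) := (Y n k r (i + 1) : Module.End ℂ (LaurentAlg n)) with hB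
    set V := Submodule.span ℂ {f : LaurentAlg n | ∃ m ∈ S, f = AddMonoidAlgebra.single m 1}
    set W := Submodule.span ℂ
      {f : LaurentAlg n | ∃ p ∈ S.erase m, f = AddMonoidAlgebra.single p 1} with hW
    have hsW : ∀ p ∈ S, p ≠ m → (AddMonoidAlgebra.single p 1 : LaurentAlg n) ∈ W := fun p hp hne =>
      Submodule.subset_span ⟨p, Finset.mem_erase.2 ⟨hne, hp⟩, rfl⟩
    have hlow : ∀ p ∈ S, lower p ≤ W := by
      intro p hp
      refine Submodule.span_le.2 ?_
      rintro _ ⟨u, hu, rfl⟩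
      refine hsW u (hd p hp u hu) ?_
      rintro rfl
      exact hmax p hp hu
    have hVl : V ≤ lower l := by
      refine Submodule.span_le.2 ?_
      rintro _ ⟨p, hp, rfl⟩
      exact single_mem_lower (hS p hp)
    -- On `x^m` the diagonal entry cancels and only lower terms are left; on the other monomials of
    -- `S` maximality of `m` prevents `x^m` from reappearing.
    have hBV : ∀ w ∈ V, B w - (gamma k r m i : ℂ) • w ∈ W := by
      have : V ≤ W.comap (B - (gamma k r m i : ℂ) • 1) := by
        refine Submodule.span_le.2 ?_
        rintro _ ⟨p, hp, rfl⟩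
        have h1 := hlow p hp (Y_sub_mem_lower k r p i)
        rw [SetLike.mem_coe, Submodule.mem_comap, LinearMap.sub_apply, LinearMap.smul_apply,
          Module.End.one_apply]
        by_cases hpm : p = m
        · subst hpm; exact h1
        · have h2 := Submodule.smul_mem _ ((gamma k r p i : ℂ) - gamma k r m i) (hsW p hp hpm)
          convert Submodule.add_mem _ h1 h2 using 1
          module
      exact fun w hw => this hw
    refine ih (S.erase m) (fun p hp => hS p (Finset.mem_of_mem_erase hp)) (fun p hp u hu => ?_)
      (d⁻¹ • (B f - (gamma k r m i : ℂ) • f)) ?_ (fun j => ?_) ?_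
    · have hp' := Finset.mem_of_mem_erase hp
      refine Finset.mem_erase.2 ⟨?_, hd p hp' u hu⟩
      rintro rfl
      exact hmax p hp' hu
    · have h1 := Submodule.smul_mem _ d⁻¹ (hVl (hY i))
      convert Submodule.add_mem _ hf h1 using 1
      have h2 : d⁻¹ • (B f - (gamma k r m i : ℂ) • f) =
          d⁻¹ • (B f - (gamma k r l i : ℂ) • f) + (d⁻¹ * d) • f := by
        rw [hd']; module
      rw [h2, inv_mul_cancel₀ hd0]
      module
    · have h1 := Submodule.smul_mem _ d⁻¹ (hBV _ (hY j))
      convert h1 using 1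
      -- Commutativity lets the correction chosen for component `i` act on the defects of every
      -- component `j` at once.
      have hcomm : (Y n k r (j + 1) : Module.End ℂ (LaurentAlg n)) (B f) =
          B ((Y n k r (j + 1) : Module.End ℂ (LaurentAlg n)) f) := by
        have := transl_comm (isBraid_TUnit hn k r) (i := j + 1) (j := i + 1) (by omega) (by omega)
          (by omega) (by omega)
        have h2 := congrArg (fun u : (Module.End ℂ (LaurentAlg n))ˣ => (u : Module.End ℂ _) f) this.eq
        exact h2
      simp only [map_smul, map_sub, hcomm]
      module
    · rw [Finset.card_erase_of_mem hm, hc]; rfl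

theorem exists_isEigen (hn : 2 ≤ n) (hg : IsGeneric k r) (l : Weight n) :
    ∃ P : LaurentAlg n, P - AddMonoidAlgebra.single l 1 ∈ lower l ∧
      IsEigen k r (gamma k r l) P := by
  refine exists_isEigen_aux hn hg l (finite_prec l).toFinset (fun m hm => by simpa using hm)
    (fun m hm p hp => ?_) (AddMonoidAlgebra.single l 1) (by simp) (fun j => ?_)
  · simp only [Set.Finite.mem_toFinset, Set.mem_ofPred_eq] at hm ⊢
    exact hp.trans hm
  · simpa [lower] using Y_sub_mem_lower k r l j

/-- A family of the form `x^l + lower terms` is linearly independent. -/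
theorem linearIndependent_of_lower {P : Weight n → LaurentAlg n}
    (hP : ∀ l, P l - AddMonoidAlgebra.single l 1 ∈ lower l) : LinearIndependent ℂ P := by
  rw [linearIndependent_iff]
  intro c hc
  by_contra hne
  obtain ⟨m, hm, hmax⟩ := exists_prec_maximal (Finsupp.support_nonempty_iff.2 hne)
  have h1 := congrArg (coeffAt m) hc
  rw [Finsupp.linearCombination_apply, Finsupp.sum, map_sum, map_zero,
    Finset.sum_eq_single_of_mem m hm] at h1
  · have h2 := coeffAt_eq_zero_of_mem_lower (not_prec_self m) (hP m)
    rw [map_sub, coeffAt_single, if_pos rfl, sub_eq_zero] at h2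
    rw [map_smul, h2, smul_eq_mul, mul_one] at h1
    exact Finsupp.mem_support_iff.1 hm h1
  · intro p hp hpm
    have h2 := coeffAt_eq_zero_of_mem_lower (hmax p hp) (hP p)
    rw [map_sub, coeffAt_single, if_neg hpm, sub_zero] at h2
    rw [map_smul, h2, smul_zero]

/-- Induction on the number of weights below `l`, which is finite: `x^l` is `P_l` minus monomials
with fewer weights below them. -/
theorem span_of_lower {P : Weight n → LaurentAlg n}
    (hP : ∀ l, P l - AddMonoidAlgebra.single l 1 ∈ lower l) :
    ⊤ ≤ Submodule.span ℂ (Set.range P) := by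
  have key : ∀ l, (AddMonoidAlgebra.single l 1 : LaurentAlg n) ∈
      Submodule.span ℂ (Set.range P) := by
    intro l
    induction hc : (finite_prec l).toFinset.card using Nat.strong_induction_on generalizing l with
    | _ c ih =>
      have h1 : lower l ≤ Submodule.span ℂ (Set.range P) := by
        refine Submodule.span_le.2 ?_
        rintro _ ⟨p, hp, rfl⟩
        refine ih _ ?_ p rfl
        rw [← hc]
        refine Finset.card_lt_card (Finset.ssubset_iff_of_subset ?_ |>.2 ⟨p, ?_, ?_⟩)
        · intro u hu
          simp only [Set.Finite.mem_toFinset, Set.mem_ofPred_eq] at hu ⊢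
          exact hu.trans hp
        · simpa using hp
        · simpa using not_prec_self p
      have h2 := Submodule.sub_mem _ (Submodule.subset_span (Set.mem_range_self l)) (h1 (hP l))
      rwa [sub_sub_cancel] at h2
  intro f _
  rw [← sum_coeff_smul f]
  exact Submodule.sum_mem _ fun m _ => Submodule.smul_mem _ _ (key m)

theorem zpow_apply_eigen {V : Type*} [AddCommGroup V] [Module ℂ V] {U : (Module.End ℂ V)ˣ}
    {g : ℂˣ} {f : V} (h : (U : Module.End ℂ V) f = (g : ℂ) • f) (z : ℤ) :
    ((U ^ z : (Module.End ℂ V)ˣ) : Module.End ℂ V) f = ((g ^ z : ℂˣ) : ℂ) • f := by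
  have hinv : ((U⁻¹ : (Module.End ℂ V)ˣ) : Module.End ℂ V) f = ((g⁻¹ : ℂˣ) : ℂ) • f := by
    have h1 := congrArg ((U⁻¹ : (Module.End ℂ V)ˣ) : Module.End ℂ V) h
    rw [← Module.End.mul_apply, Units.inv_mul, Module.End.one_apply, map_smul] at h1
    rw [h1, smul_smul, Units.inv_mul, one_smul]
    rw [← h1]
  have hpow : ∀ (U : (Module.End ℂ V)ˣ) (g : ℂˣ), (U : Module.End ℂ V) f = (g : ℂ) • f →
      ∀ m : ℕ, ((U ^ m : (Module.End ℂ V)ˣ) : Module.End ℂ V) f = ((g ^ m : ℂˣ) : ℂ) • f := by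
    intro U g h m
    induction m with
    | zero => simp
    | succ m ih =>
      rw [pow_succ', Units.val_mul, Module.End.mul_apply, ih, map_smul, h, smul_smul, pow_succ,
        Units.val_mul]
  cases z with
  | ofNat m => simpa using hpow U g h m
  | negSucc m =>
    rw [zpow_negSucc, zpow_negSucc, ← inv_pow, ← inv_pow]
    exact hpow _ _ hinv _

theorem IsEigen.Ypow {g : Fin n → ℂˣ} {f : LaurentAlg n} (h : IsEigen k r g f) (l : Weight n) :
    (Ypow n k r l : Module.End ℂ (LaurentAlg n)) f = ((∏ j, g j ^ l j : ℂˣ) : ℂ) • f := by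
  rw [Koornwinder.Ypow, Fin.prod_univ_def]
  induction List.finRange n with
  | nil => simp
  | cons j L ih =>
    rw [List.map_cons, List.prod_cons, Units.val_mul, Module.End.mul_apply, ih, map_smul,
      zpow_apply_eigen (h j), smul_smul, List.map_cons, List.prod_cons, Units.val_mul, mul_comm]

theorem IsEigen.evalY {g : Fin n → ℂˣ} {f : LaurentAlg n} (h : IsEigen k r g f)
    (p : LaurentAlg n) : evalY n k r p f = evalAt g p • f := by
  rw [Koornwinder.evalY, evalAt, Finsupp.sum, Finsupp.sum, LinearMap.sum_apply, Finset.sum_smul]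
  refine Finset.sum_congr rfl fun l _ => ?_
  rw [LinearMap.smul_apply, h.Ypow, smul_smul]

theorem Ypow_single (j : Fin n) : Ypow n k r (Pi.single j 1) = Y n k r (j + 1) := by
  rw [Ypow, List.prod_map_eq_pow_single j]
  · rw [List.count_eq_one_of_mem (List.nodup_finRange n) (List.mem_finRange j)]
    simp
  · intro i hi _
    simp [hi]

/-- Specialise the eigenvalue equation to `f = x_j`. -/
theorem IsNonsymmetricKoornwinder.isEigen {P : Module.Basis (Weight n) ℂ (LaurentAlg n)}
    (h : IsNonsymmetricKoornwinder k r P) (l : Weight n) : IsEigen k r (gamma k r l) (P l) := by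
  intro j
  have h1 := h.eigen (AddMonoidAlgebra.single (Pi.single j 1) 1) l
  have h2 : evalY n k r (AddMonoidAlgebra.single (Pi.single j 1) 1) =
      (Y n k r (j + 1) : Module.End ℂ (LaurentAlg n)) := by
    rw [evalY, AddMonoidAlgebra.coeff_single, Finsupp.sum_single_index (by simp), one_smul,
      Ypow_single]
  have h3 : evalAt (gamma k r l) (AddMonoidAlgebra.single (Pi.single j 1) 1) = gamma k r l j := by
    rw [evalAt, AddMonoidAlgebra.coeff_single, Finsupp.sum_single_index (by simp), one_mul,
      Finset.prod_eq_single_of_mem j (Finset.mem_univ j)]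
    · simp
    · intro i _ hi; simp [hi]
  rwa [h2, h3] at h1

/-- Subtract the multiple of `P` that kills the coefficient at `l`. A nonzero difference would have
a nonzero coefficient at some `m` with `γ_m = γ_l`, hence at `l`. -/
theorem IsEigen.eq_smul (hg : IsGeneric k r) {l : Weight n} {P f : LaurentAlg n}
    (hP : P - AddMonoidAlgebra.single l 1 ∈ lower l) (hPe : IsEigen k r (gamma k r l) P)
    (hf : IsEigen k r (gamma k r l) f) : f = coeffAt l f • P := by
  have hPl : coeffAt l P = 1 := by
    have h2 := coeffAt_eq_zero_of_mem_lower (not_prec_self l) hP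
    rwa [map_sub, coeffAt_single, if_pos rfl, sub_eq_zero] at h2
  rw [← sub_eq_zero]
  by_contra hne
  have he : IsEigen k r (gamma k r l) (f - coeffAt l f • P) := fun j => by
    rw [map_sub, map_smul, hPe j, hf j]
    module
  obtain ⟨m, hm, h⟩ := he.exists_gamma hne
  obtain rfl := gamma_injective hg h
  apply hm
  rw [map_sub, map_smul, hPl, smul_eq_mul, mul_one, sub_self]

end

/-! ### The intertwiners -/

section

variable {n : ℕ} {k : Multiplicity} {r : ℂˣ}

/-- The `x`-th component of a point, `1 ≤ x ≤ n`. -/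
def comp (g : Fin n → ℂˣ) (x : ℕ) : ℂˣ :=
  if h : 1 ≤ x ∧ x ≤ n then g ⟨x - 1, by omega⟩ else 1

theorem comp_succ (g : Fin n → ℂˣ) (j : Fin n) : comp g (j + 1) = g j := by
  rw [comp, dif_pos (by omega)]
  rfl

theorem comp_mk {g : Fin n → ℂˣ} {x : ℕ} (h1 : 1 ≤ x) (hx : x ≤ n) :
    comp g x = g ⟨x - 1, by omega⟩ := by
  rw [comp, dif_pos ⟨h1, hx⟩]

/-- The action of `s_i` on points. -/
def reflSpec (i : ℕ) (g : Fin n → ℂˣ) : Fin n → ℂˣ := fun j =>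
  if i = n then (if (j : ℕ) + 1 = n then (g j)⁻¹ else g j)
  else if (j : ℕ) + 1 = i then comp g (i + 1)
  else if (j : ℕ) = i then comp g i
  else g j

theorem comp_reflSpec {i x : ℕ} (g : Fin n → ℂˣ) (h1 : 1 ≤ x) (hx : x ≤ n) :
    comp (reflSpec i g) x = if i = n then (if x = n then (comp g x)⁻¹ else comp g x)
      else if x = i then comp g (i + 1) else if x = i + 1 then comp g i else comp g x := by
  obtain ⟨y, rfl⟩ : ∃ y, x = y + 1 := ⟨x - 1, by omega⟩
  have e := comp_succ (reflSpec i g) ⟨y, hx⟩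
  have e' := comp_succ g ⟨y, hx⟩
  simp only at e e'
  rw [e, e', reflSpec]
  simp only [Nat.add_right_cancel_iff]

theorem comp_gamma {x : ℕ} (l : Weight n) (h1 : 1 ≤ x) (hx : x ≤ n) :
    comp (gamma k r l) x = (k.t0 * k.tn) ^ sgn (crd l x) * k.t ^ rhoRow n l x *
      (r ^ 2) ^ crd l x := by
  obtain ⟨y, rfl⟩ : ∃ y, x = y + 1 := ⟨x - 1, by omega⟩
  rw [comp_mk h1 hx]
  exact gamma_eq k r l ⟨y, hx⟩

/-- Comparing powers of `q` is enough to identify the weight; the exponents of `t` and `t_0 t_n`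
play no part. -/
theorem eq_refl_of_reflSpec_gamma (hg : IsGeneric k r) {i : ℕ} (h1 : 1 ≤ i) (hi : i ≤ n)
    {l m : Weight n} (h : reflSpec i (gamma k r l) = gamma k r m) : m = refl n i l := by
  refine crd_ext fun x hx hxn => ?_
  have h2 := congrArg (fun g => comp g x) h
  rw [comp_reflSpec _ hx hxn, comp_gamma m hx hxn] at h2
  rcases hi.eq_or_lt with rfl | hi
  · rw [crd_refl_last h1]
    rw [if_pos rfl, comp_gamma l hx hxn] at h2
    split_ifs at h2 ⊢
    · rw [mul_inv, mul_inv, ← zpow_neg, ← zpow_neg, ← zpow_neg] at h2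
      exact (q_exponent_eq hg h2).symm
    · exact (q_exponent_eq hg h2).symm
  · rw [crd_refl_mid h1 hi]
    rw [if_neg hi.ne, comp_gamma l hx hxn, comp_gamma l h1 hi.le,
      comp_gamma l (by omega) hi] at h2
    split_ifs at h2 ⊢ <;> exact (q_exponent_eq hg h2).symm

theorem monoAt_neg (g : Fin n → ℂˣ) (β : AffWeight n) :
    monoAt r g (-β) = (monoAt r g β)⁻¹ := by
  simp [monoAt, mul_comm]

theorem monoAt_add (g : Fin n → ℂˣ) (β β' : AffWeight n) :
    monoAt r g (β + β') = monoAt r g β * monoAt r g β' := by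
  rw [monoAt, monoAt, monoAt, ← Units.val_mul]
  congr 1
  simp only [Prod.fst_add, Prod.snd_add, Pi.add_apply, zpow_add, Finset.prod_mul_distrib]
  exact mul_mul_mul_comm _ _ _ _

theorem monoAt_ne_zero (g : Fin n → ℂˣ) (β : AffWeight n) : monoAt r g β ≠ 0 :=
  Units.ne_zero _

theorem monoAt_eps {x : ℕ} (g : Fin n → ℂˣ) (h1 : 1 ≤ x) (hx : x ≤ n) :
    monoAt r g (eps n x, 0) = comp g x := by
  rw [comp_mk h1 hx, monoAt, Finset.prod_eq_single_of_mem ⟨x - 1, by omega⟩ (Finset.mem_univ _)]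
  · simp [eps, Nat.sub_add_cancel h1]
  · intro j _ hj
    have : (j : ℕ) + 1 ≠ x := fun h => hj (Fin.ext (by simp only; omega))
    simp [eps, this]

theorem monoAt_coroot_last (hn : 1 ≤ n) (g : Fin n → ℂˣ) :
    monoAt r g (simpleCoroot n n) = comp g n := by
  rw [simpleCoroot_last hn, monoAt_eps g hn le_rfl]

theorem monoAt_root_last (hn : 1 ≤ n) (g : Fin n → ℂˣ) :
    monoAt r g (simpleRoot n n) = (comp g n : ℂ) ^ 2 := by
  rw [root_eq_two_smul_coroot (Or.inr rfl), two_smul, monoAt_add, monoAt_coroot_last hn, sq]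

theorem monoAt_root_mid {i : ℕ} (h1 : 1 ≤ i) (hi : i < n) (g : Fin n → ℂˣ) :
    monoAt r g (simpleRoot n i) = (comp g i : ℂ) / comp g (i + 1) := by
  have : simpleRoot n i = (eps n i, 0) + -(eps n (i + 1), 0) := by
    rw [simpleRoot_mid h1 hi]; ext <;> simp [sub_eq_add_neg]
  rw [this, monoAt_add, monoAt_neg, monoAt_eps g h1 hi.le, monoAt_eps g (by omega) hi,
    div_eq_mul_inv]

theorem monoAt_reflSpec_root {i : ℕ} (h1 : 1 ≤ i) (hi : i ≤ n) (g : Fin n → ℂˣ) :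
    monoAt r (reflSpec i g) (simpleRoot n i) = (monoAt r g (simpleRoot n i))⁻¹ := by
  rcases hi.eq_or_lt with rfl | hi
  · rw [monoAt_root_last h1, monoAt_root_last h1, comp_reflSpec g h1 le_rfl]
    simp
  · rw [monoAt_root_mid h1 hi, monoAt_root_mid h1 hi, comp_reflSpec g h1 hi.le,
      comp_reflSpec g (by omega) hi]
    simp [hi.ne]

theorem monoAt_reflSpec_coroot {i : ℕ} (h1 : 1 ≤ i) (hi : i ≤ n) (g : Fin n → ℂˣ) :
    monoAt r (reflSpec i g) (simpleCoroot n i) = (monoAt r g (simpleCoroot n i))⁻¹ := by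
  rcases hi.eq_or_lt with rfl | hi
  · rw [monoAt_coroot_last h1, monoAt_coroot_last h1, comp_reflSpec g h1 le_rfl]
    simp
  · rw [simpleCoroot_mid_eq h1 hi]
    exact monoAt_reflSpec_root h1 hi.le g

theorem monoAt_root_eq_one_of_reflSpec {i : ℕ} (h1 : 1 ≤ i) (hi : i ≤ n) {g : Fin n → ℂˣ}
    (h : reflSpec i g = g) : monoAt r g (simpleRoot n i) = 1 := by
  have h2 := congrArg (fun g => comp g i) h
  rw [comp_reflSpec g h1 hi] at h2
  rcases hi.eq_or_lt with rfl | hi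
  · rw [if_pos rfl, if_pos rfl] at h2
    rw [monoAt_root_last h1, sq]
    nth_rw 1 [← h2]
    exact Units.inv_mul _
  · rw [if_neg hi.ne, if_pos rfl] at h2
    rw [monoAt_root_mid h1 hi, h2]
    exact div_self (Units.ne_zero _)

/-- The value 1 forces the power of `q` to vanish, so `l` lies on the wall of `s_i`. There the value
is `t²` for `i < n` and `(t_0 t_n)²` for `i = n`, both excluded by genericity. -/
theorem monoAt_gamma_ne_one (hg : IsGeneric k r) {i : ℕ} (h1 : 1 ≤ i) (hi : i ≤ n)
    (l : Weight n) : monoAt r (gamma k r l) (simpleRoot n i) ≠ 1 := by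
  intro h
  rcases hi.eq_or_lt with rfl | hi
  · rw [monoAt_root_last h1, ← Units.val_pow_eq_pow_val, Units.val_eq_one,
      comp_gamma l h1 le_rfl] at h
    have h2 : (k.t0 * k.tn) ^ (sgn (crd l i) * 2) * k.t ^ (rhoRow i l i * 2) *
        (r ^ 2) ^ (crd l i * 2) =
        (k.t0 * k.tn) ^ (0 : ℤ) * k.t ^ (0 : ℤ) * (r ^ 2) ^ (0 : ℤ) := by
      rw [mul_pow, mul_pow] at h
      simp only [zpow_mul, zpow_ofNat, mul_one, pow_zero]
      exact h
    have h3 : crd l i = 0 := by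
      have := q_exponent_eq hg h2
      omega
    rw [h3, rhoRow_last h1 l h3] at h
    apply hg.t0_tn_sq
    simpa [sgn] using h
  · rw [monoAt_root_mid h1 hi, div_eq_one_iff_eq (Units.ne_zero _), Units.val_inj,
      comp_gamma l h1 hi.le, comp_gamma l (by omega) hi] at h
    have h3 := q_exponent_eq hg h
    have h4 := rhoRow_sub h1 hi l h3
    rw [h3] at h
    have h5 := mul_left_cancel (mul_right_cancel h)
    apply hg.t_sq
    rw [show rhoRow n l i = rhoRow n l (i + 1) + 2 by omega, zpow_add] at h5
    exact mul_eq_left.1 h5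

/-! ### The functions `ξ_i` -/

theorem dual_root {i : ℕ} (h1 : 1 ≤ i) : k.dual.root n i = k.root n i := by
  have h0 : i ≠ 0 := by omega
  simp [Multiplicity.root, Multiplicity.dual, h0]

theorem dual_half_mid {i : ℕ} (h1 : 1 ≤ i) (hi : i < n) : k.dual.half n i = 1 := by
  rw [Multiplicity.half, if_neg (by omega), if_neg (by omega)]

theorem dual_half_last (hn : 1 ≤ n) : k.dual.half n n = k.t0 := by
  rw [Multiplicity.half, if_neg (by omega), if_pos rfl]
  rfl

theorem xi_eq {K : Type*} [Field K] [Algebra ℂ K] {i : ℕ} (h1 : 1 ≤ i) (hi : i ≤ n)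
    {e : AffWeight n → K} (hneg : ∀ β, e (-β) = (e β)⁻¹) (h0 : ∀ β, e β ≠ 0)
    (ha : i = n → e (simpleRoot n i) = e (simpleCoroot n i) ^ 2)
    (hne : e (simpleRoot n i) ≠ 1) :
    xi k i e = (algebraMap ℂ K ((k.dual.root n i : ℂ)⁻¹ - k.dual.root n i) * e (simpleRoot n i) +
      algebraMap ℂ K ((k.dual.half n i : ℂ)⁻¹ - k.dual.half n i) * e (simpleCoroot n i)) /
        (1 - e (simpleRoot n i)) := by
  have ht : algebraMap ℂ K (k.dual.root n i) ≠ 0 := by simp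
  have hu : algebraMap ℂ K (k.dual.half n i) ≠ 0 := by simp
  have hz := h0 (simpleCoroot n i)
  have hx := h0 (simpleRoot n i)
  have hd : 1 - e (simpleRoot n i) ≠ 0 := sub_ne_zero.2 hne.symm
  have hd' : e (simpleRoot n i) - 1 ≠ 0 := sub_ne_zero.2 hne
  unfold xi vRoot vNum
  simp only [hneg]
  have hden : 1 - (e (simpleRoot n i))⁻¹ = (e (simpleRoot n i) - 1) / e (simpleRoot n i) := by
    field_simp
  rw [hden]
  rcases hi.eq_or_lt with rfl | hi
  · rw [if_pos (Or.inr rfl)]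
    simp only [map_mul, map_sub, map_inv₀, Units.val_inv_eq_inv_val]
    rw [ha rfl] at hd hd' ⊢
    generalize e (simpleCoroot i i) = z at *
    generalize algebraMap ℂ K (k.dual.root i i) = t at *
    generalize algebraMap ℂ K (k.dual.half i i) = u at *
    field_simp
    ring
  · rw [if_neg (by omega), dual_half_mid h1 hi]
    rw [Units.val_one, inv_one, sub_self, map_zero, zero_mul, add_zero]
    simp only [map_sub, map_inv₀, map_pow, Units.val_inv_eq_inv_val]
    generalize e (simpleRoot n i) = z at *
    generalize algebraMap ℂ K (k.dual.root n i) = t at *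
    field_simp
    ring

theorem xi_monoX {i : ℕ} (h1 : 1 ≤ i) (hi : i ≤ n) :
    xi k i (monoX (n := n) r) =
      (algebraMap ℂ _ ((k.dual.root n i : ℂ)⁻¹ - k.dual.root n i) * monoX r (simpleRoot n i) +
        algebraMap ℂ _ ((k.dual.half n i : ℂ)⁻¹ - k.dual.half n i) *
          monoX r (simpleCoroot n i)) / (1 - monoX r (simpleRoot n i)) := by
  refine xi_eq h1 hi (monoX_neg r) (monoX_ne_zero r) (fun h => ?_)
    (monoX_ne_one r (simpleRoot_fst_ne_zero (by omega) hi))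
  rw [root_eq_two_smul_coroot (Or.inr h), two_smul, monoX_add, sq]

theorem xi_monoAt {i : ℕ} (h1 : 1 ≤ i) (hi : i ≤ n) {g : Fin n → ℂˣ}
    (hne : monoAt r g (simpleRoot n i) ≠ 1) :
    xi k i (monoAt r g) =
      (((k.root n i : ℂ)⁻¹ - k.root n i) * monoAt r g (simpleRoot n i) +
        ((k.dual.half n i : ℂ)⁻¹ - k.dual.half n i) *
          monoAt r g (simpleCoroot n i)) / (1 - monoAt r g (simpleRoot n i)) := by
  rw [xi_eq h1 hi (monoAt_neg g) (monoAt_ne_zero g) (fun h => ?_) hne, dual_root h1]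
  · rfl
  · rw [root_eq_two_smul_coroot (Or.inr h), two_smul, monoAt_add, sq]

/-- The two values are meant as the diagonal entries of `T_i` on a pair of eigenvectors exchanged by
`s_i`. Their sum is the trace of an operator with eigenvalues `t_i` and `-t_i⁻¹`. -/
theorem xi_add_xi_reflSpec {i : ℕ} (h1 : 1 ≤ i) (hi : i ≤ n) {g : Fin n → ℂˣ}
    (hne : monoAt r g (simpleRoot n i) ≠ 1) :
    xi k i (monoAt r g) + xi k i (monoAt r (reflSpec i g)) =
      (k.root n i : ℂ) - (k.root n i : ℂ)⁻¹ := by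
  have hne' : monoAt r (reflSpec i g) (simpleRoot n i) ≠ 1 := by
    rw [monoAt_reflSpec_root h1 hi]; simpa using hne
  rw [xi_monoAt h1 hi hne, xi_monoAt h1 hi hne', monoAt_reflSpec_root h1 hi,
    monoAt_reflSpec_coroot h1 hi]
  have hd : 1 - monoAt r g (simpleRoot n i) ≠ 0 := sub_ne_zero.2 hne.symm
  have hd' : monoAt r g (simpleRoot n i) - 1 ≠ 0 := sub_ne_zero.2 hne
  have hx := monoAt_ne_zero (r := r) g (simpleRoot n i)
  have hz := monoAt_ne_zero (r := r) g (simpleCoroot n i)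
  have hden : 1 - (monoAt r g (simpleRoot n i))⁻¹ =
      (monoAt r g (simpleRoot n i) - 1) / monoAt r g (simpleRoot n i) := by
    field_simp
  rw [hden]
  rcases hi.eq_or_lt with rfl | hi
  · have ha : monoAt r g (simpleRoot i i) = monoAt r g (simpleCoroot i i) ^ 2 := by
      rw [root_eq_two_smul_coroot (Or.inr rfl), two_smul, monoAt_add, sq]
    rw [ha] at hd hd' ⊢
    generalize monoAt r g (simpleCoroot i i) = z at *
    generalize (k.dual.half i i : ℂ)⁻¹ - (k.dual.half i i : ℂ) = w at *
    rw [← neg_sub ((k.root i i : ℂ)⁻¹)]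
    generalize (k.root i i : ℂ)⁻¹ - (k.root i i : ℂ) = p at *
    rw [← neg_sub, div_neg, neg_add_eq_sub, div_div_eq_mul_div, ← sub_div, div_eq_iff hd']
    field_simp
    ring
  · rw [dual_half_mid h1 hi, Units.val_one, inv_one, sub_self, zero_mul, add_zero, zero_mul,
      add_zero, ← neg_sub ((k.root n i : ℂ)⁻¹)]
    generalize monoAt r g (simpleRoot n i) = z at *
    generalize (k.root n i : ℂ)⁻¹ - (k.root n i : ℂ) = p at *
    rw [← neg_sub, div_neg, neg_add_eq_sub, div_div_eq_mul_div, ← sub_div, div_eq_iff hd']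
    field_simp
    ring

end

/-! ### Intertwining relations from quadratic relations alone -/

section Abstract

variable {V : Type*} [AddCommGroup V] [Module ℂ V]

/-- Applying `T` to `T B T f = a f` gives `B T f = a (T f - p f)`, and directly `A T f = p a f + b T
f`. On the span of `f` and `T f` the stated `ξ` makes `T f - ξ f` an eigenvector with `a` and `b`
exchanged. -/
theorem intertwiner_mid {T A B : Module.End ℂ V} {p a b ξ : ℂ} {f : V}
    (hT : T * T = p • T + 1) (hA : A = T * B * T) (ha : A f = a • f) (hb : B f = b • f)
    (hξ : ξ * (a - b) = p * a) :
    A (T f - ξ • f) = b • (T f - ξ • f) ∧ B (T f - ξ • f) = a • (T f - ξ • f) := by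
  have hT' : ∀ v, T (T v) = p • T v + v := fun v => congrArg (fun S : Module.End ℂ V => S v) hT
  have hA' : ∀ v, A v = T (B (T v)) := fun v => congrArg (fun S : Module.End ℂ V => S v) hA
  have h1 : B (T f) = a • (T f - p • f) := by
    have h2 := hT' (B (T f))
    rw [← hA', ha, map_smul] at h2
    rw [smul_sub, h2, smul_comm a p]
    abel
  have h3 : A (T f) = (p * a) • f + b • T f := by
    rw [hA', hT', map_add, map_smul, map_add, map_smul, ← hA', ha, hb, map_smul, mul_smul]
  constructor
  · rw [map_sub, map_smul, h3, ha, ← hξ]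
    module
  · rw [map_sub, map_smul, h1, hb, smul_sub, smul_smul a p, mul_comm a p, ← hξ]
    module

/-- Here both factors of `A = T B` satisfy quadratic relations. Applying `T` to `T B f = g f` gives
`T f = g⁻¹ B f + p f`, and the quadratic relation of `B` then evaluates `A T f`, bringing in its
parameter `p'`. -/
theorem intertwiner_last {T A B : Module.End ℂ V} {p p' g g' ξ : ℂ} {f : V}
    (hT : T * T = p • T + 1) (hB : B * B = p' • B + 1) (hA : A = T * B) (hg : A f = g • f)
    (hgg : g' * g = 1) (hξ : ξ * (g - g') = p' + p * g) :
    A (T f - ξ • f) = g' • (T f - ξ • f) := by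
  have hT' : ∀ v, T (T v) = p • T v + v := fun v => congrArg (fun S : Module.End ℂ V => S v) hT
  have hB' : ∀ v, B (B v) = p' • B v + v := fun v => congrArg (fun S : Module.End ℂ V => S v) hB
  have hA' : ∀ v, A v = T (B v) := fun v => congrArg (fun S : Module.End ℂ V => S v) hA
  have h1 : T f = g' • B f + p • f := by
    have h2 := hT' (B f)
    rw [← hA', hg, map_smul, smul_smul] at h2
    have h3 := congrArg (fun v => g' • v) h2
    simp only [smul_add, smul_smul] at h3
    rw [hgg, one_smul, mul_comm p g, ← mul_assoc, hgg, one_mul] at h3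
    rw [h3]
    abel
  have h4 : A (T f) = p' • f + g' • T f + (p * g) • f := by
    rw [hA']
    nth_rw 1 [h1]
    rw [map_add, map_smul, map_smul, hB', map_add, map_smul, map_smul, map_add, map_smul, ← hA',
      hg]
    rw [smul_add, smul_smul, smul_smul, smul_smul, mul_right_comm, hgg, one_mul]
  rw [map_sub, map_smul, h4, hg, smul_smul, smul_sub, smul_smul, mul_comm g' ξ,
    show ξ * g = p' + p * g + ξ * g' by rw [← hξ]; ring]
  module

theorem quadratic_conj {C C' T : Module.End ℂ V} {p : ℂ} (h : C' * C = 1) (h' : C * C' = 1)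
    (hT : T * T = p • T + 1) : C * T * C' * (C * T * C') = p • (C * T * C') + 1 := by
  calc C * T * C' * (C * T * C') = C * (T * (C' * C) * T) * C' := by simp only [mul_assoc]
    _ = _ := by
      rw [h, mul_one, hT, mul_add, add_mul, mul_one, h', mul_smul_comm, smul_mul_assoc]

end Abstract

/-! ### The intertwiners on joint eigenvectors -/

section

variable {n : ℕ} {k : Multiplicity} {r : ℂˣ}

theorem isEigen_iff {g : Fin n → ℂˣ} {f : LaurentAlg n} :
    IsEigen k r g f ↔ ∀ x, 1 ≤ x → x ≤ n →
      (Y n k r x : Module.End ℂ (LaurentAlg n)) f = (comp g x : ℂ) • f := by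
  constructor
  · intro h x h1 hx
    obtain ⟨y, rfl⟩ : ∃ y, x = y + 1 := ⟨x - 1, by omega⟩
    rw [comp_mk h1 hx]
    exact h ⟨y, hx⟩
  · intro h j
    rw [← comp_succ g j]
    exact h (j + 1) (by omega) (by omega)

theorem apply_of_commute {i x : ℕ} (h : Commute (TUnit n k r i) (Y n k r x))
    {f : LaurentAlg n} {c : ℂ} (ξ : ℂ)
    (hf : (Y n k r x : Module.End ℂ (LaurentAlg n)) f = c • f) :
    (Y n k r x : Module.End ℂ (LaurentAlg n)) (T n k r i f - ξ • f) =
      c • (T n k r i f - ξ • f) := by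
  have h2 : T n k r i ((Y n k r x : Module.End ℂ (LaurentAlg n)) f) =
      (Y n k r x : Module.End ℂ (LaurentAlg n)) (T n k r i f) :=
    congrArg (fun u : (Module.End ℂ (LaurentAlg n))ˣ => (u : Module.End ℂ _) f) h.eq
  rw [map_sub, ← h2, map_smul, hf, map_smul]
  module

/-- `T_i - ξ_i(g)` intertwines the eigenspaces of the points `g` and `s_i g`. -/
theorem IsEigen.intertwine (hn : 2 ≤ n) {i : ℕ} (h1 : 1 ≤ i) (hi : i ≤ n) {g : Fin n → ℂˣ}
    {f : LaurentAlg n} (h : IsEigen k r g f) (hne : monoAt r g (simpleRoot n i) ≠ 1) :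
    IsEigen k r (reflSpec i g) (T n k r i f - xi k i (monoAt r g) • f) := by
  have hb := isBraid_TUnit hn k r
  rw [isEigen_iff] at h ⊢
  have hd : 1 - monoAt r g (simpleRoot n i) ≠ 0 := sub_ne_zero.2 hne.symm
  have hxi := xi_monoAt (k := k) h1 hi hne
  rw [eq_div_iff hd] at hxi
  rcases hi.eq_or_lt with rfl | hin
  · intro x hx hxn
    rw [comp_reflSpec g hx hxn, if_pos rfl]
    split_ifs with hxi'
    · subst hxi'
      -- `U` is the conjugate of `T_0` with `Y_n = T_n U`, so it satisfies the quadratic relation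
      -- with parameter `t_0`.
      set U := (TUnit x k r x)⁻¹ * transl x (TUnit x k r) x with hU
      refine intertwiner_last (B := (U : Module.End ℂ (LaurentAlg x))) (T_quadratic x k r x)
        (p' := (k.root x 0 : ℂ) - (k.root x 0 : ℂ)⁻¹) ?_ ?_ (h x h1 hi) ?_ ?_
      · set C := ((List.range' 1 (x - 1)).reverse.map (TUnit x k r)).prod with hC
        have hUC : (U : Module.End ℂ (LaurentAlg x)) =
            (C : Module.End ℂ (LaurentAlg x)) * T x k r 0 * ((C⁻¹ : (Module.End ℂ (LaurentAlg x))ˣ) : Module.End ℂ _) :=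
          congrArg Units.val (inv_mul_transl_last (t := TUnit x k r) h1)
        rw [hUC]
        exact quadratic_conj C.inv_mul C.mul_inv (T_quadratic x k r 0)
      · have : transl x (TUnit x k r) x = TUnit x k r x * U := by
          rw [hU, mul_inv_cancel_left]
        exact congrArg Units.val this
      · rw [← Units.val_mul, inv_mul_cancel, Units.val_one]
      -- The dual parameter at `a_n / 2` is `t_0`, which matches the parameter of `U`.
      · rw [monoAt_root_last h1, monoAt_coroot_last h1, dual_half_last h1] at hxi
        have h0 : k.root x 0 = k.t0 := rfl
        rw [h0]
        have hz : (comp g x : ℂ) ≠ 0 := Units.ne_zero _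
        rw [Units.val_inv_eq_inv_val, ← mul_left_inj' hz]
        field_simp at hxi ⊢
        linear_combination -hxi
    · exact apply_of_commute (transl_comm_of_ne hb hx hxn h1 le_rfl (Ne.symm hxi') (by omega)) _
        (h x hx hxn)
  · have key := intertwiner_mid (T_quadratic n k r i)
      (congrArg Units.val (transl_eq (t := TUnit n k r) h1 hin)) (h i h1 hi)
      (h (i + 1) (by omega) hin) (ξ := xi k i (monoAt r g)) (by
        rw [monoAt_root_mid h1 hin, dual_half_mid h1 hin] at hxi
        have hz : (comp g (i + 1) : ℂ) ≠ 0 := Units.ne_zero _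
        rw [Units.val_one, inv_one, sub_self, zero_mul, add_zero] at hxi
        have e := div_mul_cancel₀ (comp g i : ℂ) hz
        linear_combination -(comp g (i + 1) : ℂ) * hxi +
          ((k.root n i : ℂ) - (k.root n i : ℂ)⁻¹ - xi k i (monoAt r g)) * e)
    intro x hx hxn
    rw [comp_reflSpec g hx hxn, if_neg hin.ne]
    split_ifs with h2 h3
    · subst h2; exact key.1
    · subst h3; exact key.2
    · exact apply_of_commute (transl_comm_of_ne hb hx hxn h1 hi (Ne.symm h2) (Ne.symm h3)) _
        (h x hx hxn)

/-! ### The coefficient of `x^{s_i l}` -/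

theorem domLE_zero_coroot {i : ℕ} (h1 : 1 ≤ i) (hi : i ≤ n) :
    DomLE 0 (simpleCoroot n i).1 := by
  rcases hi.eq_or_lt with rfl | hi
  · rw [simpleCoroot_last h1]
    exact domLE_zero_eps i i
  · rw [simpleCoroot_mid h1 hi]
    exact domLE_zero_eps_sub h1 (by omega) hi

theorem prec_refl {i : ℕ} (h1 : 1 ≤ i) (hi : i ≤ n) {l : Weight n}
    (h : l ⬝ᵥ (simpleCoroot n i).1 < 0) : Prec l (refl n i l) := by
  have hn : 1 ≤ n := h1.trans hi
  have h2 := sameOrbit_refl hn hi (refl n i l)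
  rw [refl_eq n i (refl n i l)] at h2
  have h3 := prec_reflection (simpleCoroot_fst_ne_zero hn hi) (domLE_zero_coroot h1 hi) h2 (by
    rw [shift_refl hn hi]
    have := shift_neg_iff.2 h
    omega)
  rwa [← refl_eq, refl_refl hn hi] at h3

theorem refl_eq_self {i : ℕ} {l : Weight n} (h : l ⬝ᵥ (simpleCoroot n i).1 = 0) :
    refl n i l = l := by
  rw [refl_eq, shift, h, mul_zero, zero_smul, sub_zero]

theorem between_le_lower {i : ℕ} (hn : 1 ≤ n) (hi : i ≤ n) (l : Weight n) :
    between n i l ≤ lower l := by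
  refine Submodule.span_le.2 ?_
  rintro _ ⟨j, hj, rfl⟩
  refine single_mem_lower (prec_between (simpleCoroot_fst_ne_zero hn hi) ?_ hj)
  rw [← refl_eq]
  exact sameOrbit_refl hn hi l

theorem simpleRoot_snd {i : ℕ} (h1 : 1 ≤ i) : (simpleRoot n i).2 = 0 := by
  rw [simpleRoot, if_neg (by omega)]
  split_ifs <;> rfl

/-- A lower monomial `x^m` cannot contribute: neither `m` nor `s_i m` equals `s_i l`, and the
interior terms lie below `m`, while `s_i l` is not below `l`. What remains is the leading
coefficient of `T_i x^l`. -/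
theorem coeffAt_T {i : ℕ} (h1 : 1 ≤ i) (hi : i ≤ n) {l : Weight n} {P : LaurentAlg n}
    (hP : P - AddMonoidAlgebra.single l 1 ∈ lower l) (h : l ⬝ᵥ (simpleCoroot n i).1 ≤ 0) :
    coeffAt (refl n i l) (T n k r i P) = k.root n i := by
  have hn : 1 ≤ n := h1.trans hi
  have hnp : ¬ Prec (refl n i l) l := by
    rcases h.eq_or_lt with h0 | h0
    · rw [refl_eq_self h0]; exact not_prec_self l
    · exact (prec_refl h1 hi h0).asymm
  have hlow : lower l ≤ LinearMap.ker (coeffAt (refl n i l) ∘ₗ T n k r i) := by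
    refine Submodule.span_le.2 ?_
    rintro _ ⟨m, hm, rfl⟩
    obtain ⟨B, hB, hT⟩ := T_single k r i m
    have hB' := coeffAt_eq_zero_of_mem_lower hnp (lower_mono hm (between_le_lower hn hi m hB))
    have e1 : m ≠ refl n i l := by
      rintro rfl
      exact hnp hm
    have e2 : refl n i m ≠ refl n i l := by
      intro e
      have := congrArg (refl n i) e
      rw [refl_refl hn hi, refl_refl hn hi] at this
      exact hm.2 this
    rw [SetLike.mem_coe, LinearMap.mem_ker, LinearMap.comp_apply, hT, map_add, map_add, hB',
      map_smul, map_smul, coeffAt_single, coeffAt_single, if_neg e1, if_neg e2, smul_zero,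
      smul_zero, add_zero, add_zero]
  have h2 : coeffAt (refl n i l) (T n k r i (P - AddMonoidAlgebra.single l 1)) = 0 := hlow hP
  rw [map_sub, map_sub, sub_eq_zero] at h2
  obtain ⟨B, hB, hT⟩ := T_single k r i l
  rw [h2, hT, map_add, map_add, coeffAt_eq_zero_of_mem_lower hnp (between_le_lower hn hi l hB),
    map_smul, map_smul, coeffAt_single, coeffAt_single, if_pos rfl, leadT, if_pos h,
    simpleRoot_snd h1]
  rcases h.eq_or_lt with h0 | h0
  · rw [if_neg (by omega)]; simp
  · rw [if_neg (prec_refl h1 hi h0).2]; simp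

end

/-! ### The action of `T_i` on monic joint eigenvectors -/

section

variable {n : ℕ} {k : Multiplicity} {r : ℂˣ}

/-- The simple reflections act on points by involutions. -/
theorem reflSpec_reflSpec {i : ℕ} (h1 : 1 ≤ i) (hi : i ≤ n) (g : Fin n → ℂˣ) :
    reflSpec i (reflSpec i g) = g := by
  funext j
  have key : ∀ x, 1 ≤ x → x ≤ n → comp (reflSpec i (reflSpec i g)) x = comp g x := by
    intro x hx hxn
    rw [comp_reflSpec _ hx hxn, comp_reflSpec _ hx hxn]
    rcases hi.eq_or_lt with rfl | hi
    · simp only [if_true]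
      split_ifs <;> simp
    · rw [comp_reflSpec _ h1 hi.le, comp_reflSpec _ (by omega) hi]
      split_ifs with h2 h3 h4 <;> first | omega | (subst_vars; rfl)
  have := key (j + 1) (by omega) (by omega)
  rwa [comp_succ, comp_succ] at this

theorem vRoot_congr {K : Type*} [Field K] [Algebra ℂ K] {i : ℕ} {e e' : AffWeight n → K}
    (ha : e (simpleRoot n i) = e' (simpleRoot n i))
    (hh : e (simpleCoroot n i) = e' (simpleCoroot n i)) : vRoot k i e = vRoot k i e' := by
  simp only [vRoot, vNum, ha, hh]

/-- Reflecting the point inverts `x^{a_i}`, so `ṽ_{a_i}` at `g` is `ṽ_{-a_i}` at `s_i g`. This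
expresses `η_i` through values of `ξ_i`. -/
theorem vRoot_dual_monoAt {i : ℕ} (h1 : 1 ≤ i) (hi : i ≤ n) (g : Fin n → ℂˣ) :
    (k.root n i : ℂ)⁻¹ * vRoot k.dual i (monoAt r g) =
      k.root n i - xi k i (monoAt r (reflSpec i g)) := by
  have h : vRoot k.dual i (fun β => monoAt r (reflSpec i g) (-β)) =
      vRoot k.dual i (monoAt r g) := by
    refine vRoot_congr ?_ ?_
    · rw [monoAt_neg, monoAt_reflSpec_root h1 hi, inv_inv]
    · rw [monoAt_neg, monoAt_reflSpec_coroot h1 hi, inv_inv]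
  rw [xi, h, dual_root h1, Algebra.algebraMap_self, RingHom.id_apply, RingHom.id_apply,
    Units.val_inv_eq_inv_val]
  ring

theorem vRoot_dual_monoAt_neg {i : ℕ} (h1 : 1 ≤ i) (g : Fin n → ℂˣ) :
    (k.root n i : ℂ)⁻¹ * vRoot k.dual i (fun β => monoAt r g (-β)) =
      k.root n i - xi k i (monoAt r g) := by
  rw [xi, dual_root h1, Algebra.algebraMap_self, RingHom.id_apply, RingHom.id_apply,
    Units.val_inv_eq_inv_val]
  ring

theorem dot_root_neg_iff {i : ℕ} {l : Weight n} :
    l ⬝ᵥ (simpleRoot n i).1 < 0 ↔ l ⬝ᵥ (simpleCoroot n i).1 < 0 := by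
  rw [simpleRoot_eq_smul, Prod.smul_fst, dotProduct_smul, smul_eq_mul]
  split_ifs <;> omega

theorem etaAt_of_neg {i : ℕ} (h1 : 1 ≤ i) {l : Weight n}
    (h : l ⬝ᵥ (simpleCoroot n i).1 < 0) : etaAt k r i l = k.root n i := by
  rw [etaAt, if_pos (dot_root_neg_iff.2 h), dual_root h1]

theorem etaAt_of_nonneg {i : ℕ} (h1 : 1 ≤ i) (hi : i ≤ n) {l : Weight n}
    (h : ¬ l ⬝ᵥ (simpleCoroot n i).1 < 0) :
    etaAt k r i l = (k.root n i : ℂ)⁻¹ * (k.root n i - xi k i (monoAt r (gamma k r l))) *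
      (k.root n i - xi k i (monoAt r (reflSpec i (gamma k r l)))) := by
  rw [etaAt, if_neg (fun h' => h (dot_root_neg_iff.1 h')), dual_root h1,
    ← vRoot_dual_monoAt h1 hi, ← vRoot_dual_monoAt_neg h1]
  ring

/-- A family of joint eigenvectors of the form `x^l + lower terms`. -/
structure IsMonicEigenFamily (k : Multiplicity) (r : ℂˣ) (P : Weight n → LaurentAlg n) : Prop where
  sub_mem : ∀ l, P l - AddMonoidAlgebra.single l 1 ∈ lower l
  isEigen : ∀ l, IsEigen k r (gamma k r l) (P l)

variable {P : Weight n → LaurentAlg n}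

/-- The intertwiner image is nonzero, since its coefficient at `s_i l` is `t_i`. It therefore spans
the joint eigenspace of a spectral point. -/
theorem IsMonicEigenFamily.T_of_neg (h : IsMonicEigenFamily k r P) (hn : 2 ≤ n)
    (hg : IsGeneric k r) {i : ℕ} (h1 : 1 ≤ i) (hi : i ≤ n) {l : Weight n}
    (hl : l ⬝ᵥ (simpleCoroot n i).1 < 0) :
    gamma k r (refl n i l) = reflSpec i (gamma k r l) ∧
      T n k r i (P l) = xi k i (monoAt r (gamma k r l)) • P l +
        (k.root n i : ℂ) • P (refl n i l) := by
  have he := (h.isEigen l).intertwine hn h1 hi (monoAt_gamma_ne_one hg h1 hi l)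
  have hc : coeffAt (refl n i l) (T n k r i (P l) - xi k i (monoAt r (gamma k r l)) • P l) =
      k.root n i := by
    have h2 := prec_refl h1 hi hl
    have h3 := coeffAt_eq_zero_of_mem_lower h2.asymm (h.sub_mem l)
    rw [map_sub, coeffAt_single, if_neg h2.2, sub_zero] at h3
    rw [map_sub, map_smul, h3, smul_zero, sub_zero, coeffAt_T h1 hi (h.sub_mem l) hl.le]
  have hne : T n k r i (P l) - xi k i (monoAt r (gamma k r l)) • P l ≠ 0 := by
    intro h0
    rw [h0, map_zero] at hc
    exact (Units.ne_zero _) hc.symm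
  -- The identity `s_i γ_l = γ_{s_i l}` is not computed from the exponents of `γ`: existence of a
  -- nonzero eigenvector forces it.
  obtain ⟨m, -, hm⟩ := he.exists_gamma hne
  obtain rfl := eq_refl_of_reflSpec_gamma hg h1 hi hm
  refine ⟨hm.symm, ?_⟩
  rw [hm] at he
  have h4 := IsEigen.eq_smul hg (h.sub_mem _) (h.isEigen _) he
  rw [hc, sub_eq_iff_eq_add'] at h4
  exact h4

theorem IsMonicEigenFamily.T_apply (h : IsMonicEigenFamily k r P) (hn : 2 ≤ n)
    (hg : IsGeneric k r) {i : ℕ} (h1 : 1 ≤ i) (hi : i ≤ n) (l : Weight n) :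
    T n k r i (P l) = xi k i (monoAt r (gamma k r l)) • P l + etaAt k r i l • P (refl n i l) := by
  have hne := monoAt_gamma_ne_one hg h1 hi l
  have ht : (k.root n i : ℂ) ≠ 0 := Units.ne_zero _
  rcases lt_trichotomy (l ⬝ᵥ (simpleCoroot n i).1) 0 with hl | hl | hl
  · rw [etaAt_of_neg h1 hl]
    exact (h.T_of_neg hn hg h1 hi hl).2
  -- On the wall a nonzero image would give `s_i γ_l = γ_l`, against `γ_l^{a_i} ≠ 1`. So the image
  -- is zero; its coefficient at `l` gives `ξ_i(γ_l) = t_i`, whence `η_i(γ_l) = 0`.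
  · have he := (h.isEigen l).intertwine hn h1 hi hne
    have h0 : T n k r i (P l) - xi k i (monoAt r (gamma k r l)) • P l = 0 := by
      by_contra hne0
      obtain ⟨m, -, hm⟩ := he.exists_gamma hne0
      have hml := eq_refl_of_reflSpec_gamma hg h1 hi hm
      rw [refl_eq_self hl] at hml
      subst hml
      exact hne (monoAt_root_eq_one_of_reflSpec h1 hi hm)
    have hxi : (k.root n i : ℂ) - xi k i (monoAt r (gamma k r l)) = 0 := by
      have h2 := congrArg (coeffAt (refl n i l)) h0
      have h3 := coeffAt_eq_zero_of_mem_lower (not_prec_self l) (h.sub_mem l)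
      rw [map_sub, coeffAt_single, if_pos rfl, sub_eq_zero] at h3
      rw [map_sub, coeffAt_T h1 hi (h.sub_mem l) hl.le, map_smul, refl_eq_self hl, h3, map_zero,
        smul_eq_mul, mul_one] at h2
      exact h2
    rw [etaAt_of_nonneg h1 hi (by omega), hxi, mul_zero, zero_mul, zero_smul, add_zero]
    exact sub_eq_zero.1 h0
  -- The negative case at `s_i l` expresses `P_l` through `T_i P_{s_i l}`; a second `T_i` is reduced
  -- by the quadratic relation, and the sum rule for `ξ_i` gives the coefficients.
  · have hl' : refl n i l ⬝ᵥ (simpleCoroot n i).1 < 0 := by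
      rw [refl_dot (by omega) hi]
      omega
    obtain ⟨hgam, hT⟩ := h.T_of_neg hn hg h1 hi hl'
    rw [refl_refl (by omega) hi] at hgam hT
    have hsum := xi_add_xi_reflSpec (k := k) h1 hi (monoAt_gamma_ne_one hg h1 hi (refl n i l))
    have hrr : reflSpec i (gamma k r l) = gamma k r (refl n i l) := by
      rw [hgam, reflSpec_reflSpec h1 hi]
    rw [etaAt_of_nonneg h1 hi (by omega), hrr]
    rw [← hgam] at hsum
    set ξ := xi k i (monoAt r (gamma k r l))
    set ξ' := xi k i (monoAt r (gamma k r (refl n i l)))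
    set t : ℂ := (k.root n i : ℂ) with htdef
    have hPl : P l = t⁻¹ • (T n k r i (P (refl n i l)) - ξ' • P (refl n i l)) := by
      rw [hT, add_sub_cancel_left, smul_smul, inv_mul_cancel₀ ht, one_smul]
    have hq : T n k r i (T n k r i (P (refl n i l))) =
        (t - t⁻¹) • T n k r i (P (refl n i l)) + P (refl n i l) :=
      congrArg (fun S : Module.End ℂ (LaurentAlg n) => S (P (refl n i l))) (T_quadratic n k r i)
    rw [hPl, map_smul, map_sub, map_smul, hq]
    have hξ : ξ = t - t⁻¹ - ξ' := by rw [← hsum]; ring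
    rw [hξ]
    match_scalars
    · ring
    · field_simp
      ring

end

end Koornwinder

/-! ### The basis, its uniqueness, and the action of `T_i` -/

theorem mainTheorem11 (n : ℕ) (hn : 2 ≤ n) (k : Multiplicity) (r : ℂˣ) (hgen : IsGeneric k r) :
    ∃ P : Module.Basis (Weight n) ℂ (LaurentAlg n),
      IsNonsymmetricKoornwinder k r P ∧
      (∀ P' : Module.Basis (Weight n) ℂ (LaurentAlg n),
        IsNonsymmetricKoornwinder k r P' → P' = P) ∧
      ∀ i : ℕ, 1 ≤ i → i ≤ n →
        -- the second expression for `ξ_i` as a rational function; the coefficient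
        -- of `x^{a_i / 2}` vanishes for `i < n`, and `a_n / 2 = a_n^∨`
        (xi k i (monoX (n := n) r) =
          (algebraMap ℂ _ ((k.dual.root n i : ℂ)⁻¹ - k.dual.root n i) * monoX r (simpleRoot n i) +
            algebraMap ℂ _ ((k.dual.half n i : ℂ)⁻¹ - k.dual.half n i) *
              monoX r (simpleCoroot n i)) / (1 - monoX r (simpleRoot n i))) ∧
        ∀ l : Weight n,
          monoAt r (gamma k r l) (simpleRoot n i) ≠ 1 ∧
          T n k r i (P l) =
            xi k i (monoAt r (gamma k r l)) • P l +
              etaAt k r i l • P (reflect n i (l, 0)).1 := by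
  choose Q hQ hQe using exists_isEigen (k := k) (r := r) hn hgen
  have hfam : IsMonicEigenFamily k r Q := ⟨hQ, hQe⟩
  set P := Module.Basis.mk (linearIndependent_of_lower hQ) (span_of_lower hQ) with hPdef
  have hPQ : ∀ l, P l = Q l := fun l => Module.Basis.mk_apply _ _ l
  refine ⟨P, ⟨fun l => ?_, fun l m hm => ?_, fun f l => ?_⟩, fun P' hP' => ?_,
    fun i h1 hi => ⟨xi_monoX h1 hi, fun l => ⟨monoAt_gamma_ne_one hgen h1 hi l, ?_⟩⟩⟩
  · have h2 := coeffAt_eq_zero_of_mem_lower (not_prec_self l) (hQ l)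
    rw [map_sub, coeffAt_single, if_pos rfl, sub_eq_zero, ← hPQ] at h2
    exact h2
  · by_contra! hc
    have h2 := coeffAt_eq_zero_of_mem_lower hc.2 (hQ l)
    rw [map_sub, coeffAt_single, if_neg hc.1.symm, sub_zero, ← hPQ] at h2
    exact hm h2
  · rw [hPQ]
    exact (hQe l).evalY f
  -- The joint eigenspace is a line, and being monic fixes the scalar.
  · refine Module.Basis.eq_of_apply_eq fun l => ?_
    have h2 := IsEigen.eq_smul hgen (hQ l) (hQe l) (hP'.isEigen l)
    rw [coeffAt_apply, hP'.monic, one_smul] at h2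
    rw [h2, hPQ]
  · rw [hPQ, hPQ]
    exact hfam.T_apply hn hgen h1 hi l
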